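/- All manifolds are smooth, finite-dimensional, without boundary, Hausdorff and $\sigma$-compact; all maps and vector bundles are smooth. A *Lie algebroid* $A$ on a manifold $M$ is a vector bundle $A\to M$ of finite rank with a bundle map $\varrho:A\to TM$ (the anchor) and an $\mathbb R$-bilinear Lie bracket $[\cdot,\cdot]$ on the space $\Gamma(A)$ of sections such that $[a,gb]=g[a,b]+(\varrho(a)g)\,b$ for $a,b\in\Gamma(A)$, $g\in C^\infty(M)$ (hence also $\varrho[a,b]=[\varrho a,\varrho b]$). A map $f:N\to M$ is *transverse to $A$* if $f_*(T_yN)+\varrho(A_{f(y)})=T_{f(y)}M$ for all $y\in N$. In that case the *pullback* $f^!(A)$ is the Lie algebroid on $N$ with fibres $f^!(A)_y=\{(u,a)\in T_yN\times A_{f(y)}: f_*u=\varrho(a)\}$, anchor $(u,a)\mapsto u$, and bracket $[(u,\sum_j\alpha_j\,s_j\circ f),(v,\sum_k\beta_k\,s_k\circ f)]=\big([u,v],\ \sum_k u(\beta_k)\,s_k\circ f-\sum_j v(\alpha_j)\,s_j\circ f+\sum_{j,k}\alpha_j\beta_k\,[s_j,s_k]\circ f\big)$ for a local frame $(s_j)$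 of $A$; the map $\widetilde f:f^!(A)\to A$, $(u,a)\mapsto a$, covers $f$. Let $A$ be a Lie algebroid on $M$ and let $i:X\hookrightarrow M$ be an embedded submanifold which is a Lie algebroid transversal, i.e. $i$ is transverse to $A$. Let $p:E\to X$ be a tubular neighborhood of $X$ in $M$, i.e. a vector bundle with a diffeomorphism $\psi$ of its total space $E$ onto an open subset of $M$ which restricts to $i$ on the zero section $0:X\to E$. Regard $i^!(A)$ as contained in $p^!i^!(A)$ along the zero section through $i^!(A)_x\ni c\mapsto(0_*u,c)\in p^!i^!(A)_{0(x)}$, where $u\in T_xX$ is the anchor of $c$. Then there exist an open neighborhood $U\subset E$ of the zero section, a map $\varphi$ which is a diffeomorphism from $U$ onto an open subset $\varphi(U)$ of $\psi(E)\subset M$, and an isomorphism of Lie algebroids covering $\varphi$ (a vector bundle isomorphism compatible with anchors and brackets) $$(\Phi,\varphi):\ p^!i^!(A)|_U\ \xrightarrow{\ \sim\ }\ A|_{\varphi(U)}$$ which extends $\widetilde i$: for all $x\in X$ and $c\in i^!(A)_x$ one has $\varphi(0(x))=i(x)$ and $\Phi(0_*u,c)=\widetilde i(c)$, with $u$ the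 anchor of $c$. -/

import Mathlib

set_option linter.unusedSectionVars false

open Bundle Set Filter VectorField
open scoped Manifold ContDiff Topology

noncomputable section

/-- A Lie algebroid on the manifold `M`: a smooth vector bundle `V` with model fibre `F`, a smooth
bundle map `ρ : V → TM` (the anchor) and a Lie bracket on the smooth sections of `V` satisfying the
Leibniz rule `[a, g b] = g [a, b] + (ρ(a) g) b`. That `ρ` maps brackets to Lie brackets of vector
fields follows from the other axioms; it is listed for convenience, as is often done. -/
structure LieAlgebroid {E : Type*} [NormedAddCommGroup E] [NormedSpace ℝ E]
    {H : Type*} [TopologicalSpace H] (I : ModelWithCorners ℝ E H)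
    {M : Type*} [TopologicalSpace M] [ChartedSpace H M] [IsManifold I ∞ M]
    (F : Type*) [NormedAddCommGroup F] [NormedSpace ℝ F]
    (V : M → Type*) [∀ x, AddCommGroup (V x)] [∀ x, Module ℝ (V x)]
    [∀ x, TopologicalSpace (V x)] [TopologicalSpace (TotalSpace F V)]
    [FiberBundle F V] [VectorBundle ℝ F V] [ContMDiffVectorBundle ∞ F V I] where
  anchor : ∀ x, V x →L[ℝ] TangentSpace I x
  contMDiff_anchor : ContMDiff I (I.prod 𝓘(ℝ, F →L[ℝ] E)) ∞
    (fun x ↦ TotalSpace.mk' (F →L[ℝ] E) (E := fun x ↦ V x →L[ℝ] TangentSpace I x) x (anchor x))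
  bracket : Cₛ^∞⟮I; F, V⟯ →ₗ[ℝ] Cₛ^∞⟮I; F, V⟯ →ₗ[ℝ] Cₛ^∞⟮I; F, V⟯
  bracket_self : ∀ a, bracket a a = 0
  jacobi : ∀ a b c, bracket a (bracket b c) = bracket (bracket a b) c + bracket b (bracket a c)
  anchor_bracket : ∀ a b x, anchor x (bracket a b x) =
    mlieBracket I (fun z ↦ anchor z (a z)) (fun z ↦ anchor z (b z)) x
  leibniz : ∀ (a b c : Cₛ^∞⟮I; F, V⟯) (g : C^∞⟮I, M; ℝ⟯), (∀ x, c x = g x • b x) → ∀ x,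
    bracket a c x = g x • bracket a b x + (mvfderiv I g x (anchor x (a x))) • b x


section Helpers

variable {E' : Type*} [NormedAddCommGroup E'] [NormedSpace ℝ E']
  {H' : Type*} [TopologicalSpace H'] {I' : ModelWithCorners ℝ E' H'}
  {N : Type*} [TopologicalSpace N] [ChartedSpace H' N]
  {E : Type*} [NormedAddCommGroup E] [NormedSpace ℝ E]
  {H : Type*} [TopologicalSpace H] {I : ModelWithCorners ℝ E H}
  {M : Type*} [TopologicalSpace M] [ChartedSpace H M]
  {F : Type*} [NormedAddCommGroup F] [NormedSpace ℝ F]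
  {V : M → Type*} [∀ x, AddCommGroup (V x)] [∀ x, Module ℝ (V x)]
  [∀ x, TopologicalSpace (V x)] [TopologicalSpace (TotalSpace F V)]
  [FiberBundle F V] [VectorBundle ℝ F V]
  {P Q : Type*} [NormedAddCommGroup P] [NormedSpace ℝ P] [NormedAddCommGroup Q] [NormedSpace ℝ Q]

theorem contMDiffAt_clm_of_apply [FiniteDimensional ℝ P] {n : WithTop ℕ∞} {G : N → P →L[ℝ] Q}
    {y₀ : N} (h : ∀ p, ContMDiffAt I' 𝓘(ℝ, Q) n (fun y ↦ G y p) y₀) :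
    ContMDiffAt I' 𝓘(ℝ, P →L[ℝ] Q) n G y₀ := by
  let b := Module.finBasis ℝ P
  let c : Fin (Module.finrank ℝ P) → (P →L[ℝ] ℝ) := fun i ↦ (b.coord i).toContinuousLinearMap
  have hG : G = fun y ↦ ∑ i, ContinuousLinearMap.smulRightL ℝ P Q (c i) (G y (b i)) := by
    funext y
    ext p
    have : p = ∑ i, b.repr p i • b i := (b.sum_repr p).symm
    conv_lhs => rw [this, map_sum]
    simp [c]
  rw [hG]
  refine contMDiffAt_finsetSum fun i _ ↦ ?_
  exact (ContinuousLinearMap.contMDiffAt (ContinuousLinearMap.smulRightL ℝ P Q (c i))).comp y₀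
    (h (b i))

theorem continuousLinearMapAt_eq_snd (e : Trivialization F (TotalSpace.proj : TotalSpace F V → M))
    [MemTrivializationAtlas e] {x : M} (hx : x ∈ e.baseSet) (v : V x) :
    e.continuousLinearMapAt ℝ x v = (e ⟨x, v⟩).2 := by
  simp [hx]

variable [ContMDiffVectorBundle ∞ F V I]

theorem contMDiffAt_symmL (e : Trivialization F (TotalSpace.proj : TotalSpace F V → M))
    [MemTrivializationAtlas e] {f : N → M} {w : N → F} {y₀ : N}
    (hf : ContMDiffAt I' I ∞ f y₀) (hw : ContMDiffAt I' 𝓘(ℝ, F) ∞ w y₀) (h : f y₀ ∈ e.baseSet) :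
    ContMDiffAt I' (I.prod 𝓘(ℝ, F)) ∞
      (fun y ↦ (⟨f y, e.symmL ℝ (f y) (w y)⟩ : TotalSpace F V)) y₀ := by
  rw [e.contMDiffAt_iff (by simpa [e.mem_source] using h)]
  refine ⟨hf, hw.congr_of_eventuallyEq ?_⟩
  filter_upwards [hf.continuousAt.preimage_mem_nhds (e.open_baseSet.mem_nhds h)] with y hy
  rw [← continuousLinearMapAt_eq_snd e hy, e.continuousLinearMapAt_symmL hy]

theorem contMDiffAt_coord (e : Trivialization F (TotalSpace.proj : TotalSpace F V → M))
    [MemTrivializationAtlas e] {f : N → M} {a : ∀ y, V (f y)} {y₀ : N}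
    (ha : ContMDiffAt I' (I.prod 𝓘(ℝ, F)) ∞ (fun y ↦ (⟨f y, a y⟩ : TotalSpace F V)) y₀)
    (h : f y₀ ∈ e.baseSet) :
    ContMDiffAt I' 𝓘(ℝ, F) ∞ (fun y ↦ e.continuousLinearMapAt ℝ (f y) (a y)) y₀ := by
  rw [e.contMDiffAt_iff (by simpa [e.mem_source] using h)] at ha
  refine ha.2.congr_of_eventuallyEq ?_
  filter_upwards [ha.1.continuousAt.preimage_mem_nhds (e.open_baseSet.mem_nhds h)] with y hy
  rw [continuousLinearMapAt_eq_snd e hy]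

theorem contMDiffAt_of_coord (e : Trivialization F (TotalSpace.proj : TotalSpace F V → M))
    [MemTrivializationAtlas e] {f : N → M} {a : ∀ y, V (f y)} {y₀ : N}
    (hf : ContMDiffAt I' I ∞ f y₀)
    (ha : ContMDiffAt I' 𝓘(ℝ, F) ∞ (fun y ↦ e.continuousLinearMapAt ℝ (f y) (a y)) y₀)
    (h : f y₀ ∈ e.baseSet) :
    ContMDiffAt I' (I.prod 𝓘(ℝ, F)) ∞ (fun y ↦ (⟨f y, a y⟩ : TotalSpace F V)) y₀ := by
  rw [e.contMDiffAt_iff (by simpa [e.mem_source] using h)]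
  refine ⟨hf, ha.congr_of_eventuallyEq ?_⟩
  filter_upwards [hf.continuousAt.preimage_mem_nhds (e.open_baseSet.mem_nhds h)] with y hy
  rw [continuousLinearMapAt_eq_snd e hy]

/-- A surjective linear map between finite-dimensional spaces can be completed to an
isomorphism. -/
theorem exists_isInvertible_prod [FiniteDimensional ℝ P] [FiniteDimensional ℝ Q]
    (D : P →L[ℝ] Q) (hD : Function.Surjective D) (k : ℕ)
    (hk : k + Module.finrank ℝ Q = Module.finrank ℝ P) :
    ∃ r : P →L[ℝ] (Fin k → ℝ), (D.prod r).IsInvertible := by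
  have hr := D.toLinearMap.finrank_range_add_finrank_ker
  rw [LinearMap.range_eq_top.2 hD, finrank_top] at hr
  have hker : Module.finrank ℝ (LinearMap.ker D.toLinearMap) =
      Module.finrank ℝ (Fin k → ℝ) := by simp; omega
  obtain ⟨L⟩ := FiniteDimensional.nonempty_linearEquiv_of_finrank_eq hker
  obtain ⟨q, hq⟩ := (LinearMap.ker D.toLinearMap).exists_isCompl
  let pr := (LinearMap.ker D.toLinearMap).projectionOnto q hq
  let r : P →L[ℝ] (Fin k → ℝ) := (L.toLinearMap ∘ₗ pr).toContinuousLinearMap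
  refine ⟨r, ?_⟩
  have hinj : Function.Injective (D.prod r) := by
    rw [injective_iff_map_eq_zero]
    intro v hv
    have h1 : D v = 0 := congrArg Prod.fst hv
    have h2 : L (pr v) = 0 := congrArg Prod.snd hv
    have h3 : pr v = 0 := by simpa using h2
    have h4 : pr v = ⟨v, h1⟩ :=
      Submodule.projectionOnto_apply_left hq ⟨v, h1⟩
    rw [h4] at h3
    exact congrArg Subtype.val h3
  have hfr : Module.finrank ℝ P = Module.finrank ℝ (Q × (Fin k → ℝ)) := by simp; omega
  let e := (LinearEquiv.ofInjectiveOfFinrankEq (D.prod r).toLinearMap hinj hfr).toContinuousLinearEquiv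
  exact ⟨e, by ext v <;> rfl⟩

end Helpers

namespace LieAlgebroid

section Pullback

variable {E : Type*} [NormedAddCommGroup E] [NormedSpace ℝ E]
  {H : Type*} [TopologicalSpace H] {I : ModelWithCorners ℝ E H}
  {M : Type*} [TopologicalSpace M] [ChartedSpace H M] [IsManifold I ∞ M]
  {F : Type*} [NormedAddCommGroup F] [NormedSpace ℝ F]
  {V : M → Type*} [∀ x, AddCommGroup (V x)] [∀ x, Module ℝ (V x)]
  [∀ x, TopologicalSpace (V x)] [TopologicalSpace (TotalSpace F V)]
  [FiberBundle F V] [VectorBundle ℝ F V] [ContMDiffVectorBundle ∞ F V I]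
  {A : LieAlgebroid I F V}
  {E' : Type*} [NormedAddCommGroup E'] [NormedSpace ℝ E']
  {H' : Type*} [TopologicalSpace H'] {I' : ModelWithCorners ℝ E' H'}
  {N : Type*} [TopologicalSpace N] [ChartedSpace H' N] [IsManifold I' ∞ N]

variable (A I' N) in
/-- A smooth map `f : N → M` transverse to the Lie algebroid `A` on `M`:
`df (T_y N) + ρ (A_{f y}) = T_{f y} M` for all `y`. -/
structure TransverseMap where
  toFun : N → M
  contMDiff : ContMDiff I' I ∞ toFun
  transverse : ∀ y, (mfderiv I' I toFun y).range ⊔ (A.anchor (toFun y)).range = ⊤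

namespace TransverseMap

instance : CoeFun (TransverseMap A I' N) fun _ ↦ N → M := ⟨toFun⟩

/-- The fibre product `T_y N ×_{T_{f y} M} A_{f y}`. -/
def fiberSubmodule (f : TransverseMap A I' N) (y : N) :
    Submodule ℝ (TangentSpace I' y × V (f y)) where
  carrier := {w | mfderiv I' I f y w.1 = A.anchor (f y) w.2}
  add_mem' {v w} hv hw := by
    simp only [mem_ofPred_eq, Prod.fst_add, Prod.snd_add, map_add] at *
    rw [hv, hw]
  zero_mem' := by simp
  smul_mem' c w hw := by
    simp only [mem_ofPred_eq, Prod.smul_fst, Prod.smul_snd, map_smul] at *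
    rw [hw]

/-- The fibre at `y` of the pullback Lie algebroid `f^! A`:
the pairs `(u, a)` with `u ∈ T_y N`, `a ∈ A_{f y}` and `df u = ρ a`. -/
def Fiber (f : TransverseMap A I' N) (y : N) : Type _ := f.fiberSubmodule y

variable (f : TransverseMap A I' N)

instance (y : N) : AddCommGroup (f.Fiber y) :=
  inferInstanceAs (AddCommGroup (f.fiberSubmodule y))

instance (y : N) : Module ℝ (f.Fiber y) :=
  inferInstanceAs (Module ℝ (f.fiberSubmodule y))

instance (y : N) : TopologicalSpace (f.Fiber y) :=
  inferInstanceAs (TopologicalSpace (f.fiberSubmodule y))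

/-- The component `u` of `(u, a) ∈ (f^! A)_y`; this is the anchor of `f^! A`. -/
def fst (y : N) : f.Fiber y →L[ℝ] TangentSpace I' y :=
  (ContinuousLinearMap.fst ℝ (TangentSpace I' y) (V (f y))).comp (f.fiberSubmodule y).subtypeL

/-- The component `a` of `(u, a) ∈ (f^! A)_y`; this is the canonical map `f^! A → A` over `f`. -/
def snd (y : N) : f.Fiber y →L[ℝ] V (f y) :=
  (ContinuousLinearMap.snd ℝ (TangentSpace I' y) (V (f y))).comp (f.fiberSubmodule y).subtypeL

/-- The element `(u, a)` of `(f^! A)_y`. -/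
def fiberMk {y : N} (u : TangentSpace I' y) (a : V (f y))
    (h : mfderiv I' I f y u = A.anchor (f y) a) : f.Fiber y := ⟨(u, a), h⟩

variable {f}

@[simp] theorem fst_fiberMk {y : N} (u : TangentSpace I' y) (a : V (f y))
    (h : mfderiv I' I f y u = A.anchor (f y) a) : f.fst y (f.fiberMk u a h) = u := rfl

@[simp] theorem snd_fiberMk {y : N} (u : TangentSpace I' y) (a : V (f y))
    (h : mfderiv I' I f y u = A.anchor (f y) a) : f.snd y (f.fiberMk u a h) = a := rfl

theorem mfderiv_fst {y : N} (w : f.Fiber y) :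
    mfderiv I' I f y (f.fst y w) = A.anchor (f y) (f.snd y w) := w.2

theorem fiber_ext {y : N} {v w : f.Fiber y} (h₁ : f.fst y v = f.fst y w)
    (h₂ : f.snd y v = f.snd y w) : v = w := Subtype.ext (Prod.ext h₁ h₂)

/-! The smooth vector bundle structure on `f^! A`. -/

variable (f)

/-- Trivialization of `T N` around `y₀`. -/
abbrev trivN (y₀ : N) := trivializationAt E' (TangentSpace I' : N → Type _) y₀

/-- Trivialization of `T M` around `f y₀`. -/
abbrev trivM (y₀ : N) := trivializationAt E (TangentSpace I : M → Type _) (f y₀)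

/-- Trivialization of `A` around `f y₀`. -/
abbrev trivA (y₀ : N) := trivializationAt F V (f y₀)

/-- The map `(u, a) ↦ df u - ρ a`, read in trivializations around `y₀`. -/
def localDiff (y₀ y : N) : E' × F →L[ℝ] E :=
  (((f.trivM y₀).continuousLinearMapAt ℝ (f y)) ∘L (mfderiv I' I f y) ∘L
    ((trivN (I' := I') y₀).symmL ℝ y)).coprod
  (-(((f.trivM y₀).continuousLinearMapAt ℝ (f y)) ∘L (A.anchor (f y)) ∘L
    ((f.trivA y₀).symmL ℝ (f y))))

theorem localDiff_apply (y₀ y : N) (w : E' × F) : f.localDiff y₀ y w =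
    (f.trivM y₀).continuousLinearMapAt ℝ (f y)
      (mfderiv I' I f y ((trivN (I' := I') y₀).symmL ℝ y w.1) -
        A.anchor (f y) ((f.trivA y₀).symmL ℝ (f y) w.2)) := by
  simp only [localDiff, ContinuousLinearMap.coprod_apply, map_sub]
  simp [sub_eq_add_neg]

/-- The open set on which the trivializations around `y₀` are all defined. -/
def preBase (y₀ : N) : Set N :=
  (trivN (I' := I') y₀).baseSet ∩ (f ⁻¹' (f.trivA y₀).baseSet ∩ f ⁻¹' (f.trivM y₀).baseSet)

theorem isOpen_preBase (y₀ : N) : IsOpen (f.preBase y₀) :=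
  (Trivialization.open_baseSet _).inter
    (((Trivialization.open_baseSet _).preimage f.contMDiff.continuous).inter
      ((Trivialization.open_baseSet _).preimage f.contMDiff.continuous))

theorem mem_preBase (y₀ : N) : y₀ ∈ f.preBase y₀ :=
  ⟨FiberBundle.mem_baseSet_trivializationAt' _,
    FiberBundle.mem_baseSet_trivializationAt' (F := F) (E := V) (f y₀),
    FiberBundle.mem_baseSet_trivializationAt' (F := E) (E := (TangentSpace I : M → Type _)) (f y₀)⟩

theorem surjective_localDiff (y₀ : N) : Function.Surjective (f.localDiff y₀ y₀) := by
  intro z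
  obtain ⟨h₁, h₂, h₃⟩ := f.mem_preBase y₀
  have hz : (f.trivM y₀).symmL ℝ (f y₀) z ∈
      (mfderiv I' I f y₀).range ⊔ (A.anchor (f y₀)).range := by
    rw [f.transverse]; trivial
  obtain ⟨_, ⟨u, rfl⟩, _, ⟨a, rfl⟩, h⟩ := Submodule.mem_sup.1 hz
  refine ⟨((trivN (I' := I') y₀).continuousLinearMapAt ℝ y₀ u,
    -(f.trivA y₀).continuousLinearMapAt ℝ (f y₀) a), ?_⟩
  rw [localDiff_apply]
  simp only [map_neg, sub_neg_eq_add]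
  rw [Trivialization.symmL_continuousLinearMapAt _ h₁,
    Trivialization.symmL_continuousLinearMapAt _ h₂]
  erw [h]
  exact Trivialization.continuousLinearMapAt_symmL _ h₃ z

variable [FiniteDimensional ℝ E] [FiniteDimensional ℝ F] [FiniteDimensional ℝ E']

theorem contMDiffAt_mfderiv_section {y₀ : N} {u : ∀ y : N, TangentSpace I' y}
    (hu : ContMDiffAt I' I'.tangent ∞ (fun y ↦ (⟨y, u y⟩ : TangentBundle I' N)) y₀) :
    ContMDiffAt I' I.tangent ∞
      (fun y ↦ (⟨f y, mfderiv I' I f y (u y)⟩ : TangentBundle I M)) y₀ := by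
  have := (f.contMDiff.contMDiff_tangentMap (m := ∞) (by simp)).contMDiffAt
    (x := (⟨y₀, u y₀⟩ : TangentBundle I' N))
  exact this.comp y₀ hu

variable (A) in
theorem _root_.LieAlgebroid.contMDiffAt_anchor_section {g : N → M} {a : ∀ y : N, V (g y)} {y₀ : N}
    (hg : ContMDiffAt I' I ∞ g y₀)
    (ha : ContMDiffAt I' (I.prod 𝓘(ℝ, F)) ∞ (fun y ↦ (⟨g y, a y⟩ : TotalSpace F V)) y₀) :
    ContMDiffAt I' I.tangent ∞
      (fun y ↦ (⟨g y, A.anchor (g y) (a y)⟩ : TangentBundle I M)) y₀ :=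
  ContMDiffAt.clm_bundle_apply (b := g) (ϕ := fun y ↦ A.anchor (g y))
    ((A.contMDiff_anchor.contMDiffAt (x := g y₀)).comp y₀ hg) ha

theorem contMDiffAt_localDiff {y₀ y₁ : N} (hy : y₁ ∈ f.preBase y₀) :
    ContMDiffAt I' 𝓘(ℝ, E' × F →L[ℝ] E) ∞ (f.localDiff y₀) y₁ := by
  refine contMDiffAt_clm_of_apply fun w ↦ ?_
  have hf := f.contMDiff.contMDiffAt (x := y₁)
  have h1 := contMDiffAt_coord (f.trivM y₀) (f.contMDiffAt_mfderiv_section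
    (contMDiffAt_symmL (trivN (I' := I') y₀) (f := id) contMDiffAt_id
      (contMDiffAt_const (c := w.1)) hy.1)) hy.2.2
  have h2 := contMDiffAt_coord (f.trivM y₀) (A.contMDiffAt_anchor_section hf
    (contMDiffAt_symmL (f.trivA y₀) hf (contMDiffAt_const (c := w.2)) hy.2.1)) hy.2.2
  refine (h1.sub h2).congr_of_eventuallyEq (Eventually.of_forall fun y ↦ ?_)
  exact (f.localDiff_apply y₀ y w).trans (map_sub _ _ _)

variable (E F E') in
/-- The model fibre of the pullback `f^! A`, a Euclidean space of dimension
`dim N + rank A - dim M`. -/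
abbrev Model : Type := Fin (Module.finrank ℝ E' + Module.finrank ℝ F - Module.finrank ℝ E) → ℝ

theorem exists_localProj (y₀ : N) : ∃ r : E' × F →L[ℝ] Model E F E',
    ((f.localDiff y₀ y₀).prod r).IsInvertible := by
  refine exists_isInvertible_prod _ (f.surjective_localDiff y₀) _ ?_
  have := LinearMap.finrank_le_finrank_of_surjective (f := (f.localDiff y₀ y₀).toLinearMap)
    (f.surjective_localDiff y₀)
  rw [Module.finrank_prod] at *
  omega

/-- A projection of `E' × F` to the model fibre which is an isomorphism on the kernel of
`localDiff` at `y₀`. -/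
def localProj (y₀ : N) : E' × F →L[ℝ] Model E F E' := (f.exists_localProj y₀).choose

/-- The base set of the trivialization around `y₀`. -/
def base (y₀ : N) : Set N :=
  {y | y ∈ f.preBase y₀ ∧ ((f.localDiff y₀ y).prod (f.localProj y₀)).IsInvertible}

theorem mem_base (y₀ : N) : y₀ ∈ f.base y₀ :=
  ⟨f.mem_preBase y₀, (f.exists_localProj y₀).choose_spec⟩

theorem contMDiffAt_prod {y₀ y₁ : N} (hy : y₁ ∈ f.preBase y₀) :
    ContMDiffAt I' 𝓘(ℝ, E' × F →L[ℝ] E × Model E F E') ∞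
      (fun y ↦ (f.localDiff y₀ y).prod (f.localProj y₀)) y₁ := by
  refine contMDiffAt_clm_of_apply fun w ↦ ?_
  exact ((f.contMDiffAt_localDiff hy).clm_apply contMDiffAt_const).prodMk_space contMDiffAt_const

theorem isOpen_base (y₀ : N) : IsOpen (f.base y₀) := by
  rw [isOpen_iff_mem_nhds]
  intro y₁ hy
  have h1 := (f.contMDiffAt_prod hy.1).continuousAt
  obtain ⟨e, he⟩ := hy.2
  have h2 : range (fun e : (E' × F) ≃L[ℝ] (E × Model E F E') ↦ (e : E' × F →L[ℝ] E × Model E F E')) ∈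
      𝓝 ((f.localDiff y₀ y₁).prod (f.localProj y₀)) := by
    rw [← he]; exact ContinuousLinearEquiv.nhds e
  filter_upwards [(f.isOpen_preBase y₀).mem_nhds hy.1, h1 h2] with y h3 h4
  exact ⟨h3, h4⟩

/-- The inverse of the trivialization around `y₀`, read in `E' × F`. -/
def localFrame (y₀ y : N) : Model E F E' →L[ℝ] E' × F :=
  ((f.localDiff y₀ y).prod (f.localProj y₀)).inverse ∘L ContinuousLinearMap.inr ℝ E (Model E F E')

theorem contMDiffAt_localFrame {y₀ y₁ : N} (hy : y₁ ∈ f.base y₀) :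
    ContMDiffAt I' 𝓘(ℝ, Model E F E' →L[ℝ] E' × F) ∞ (f.localFrame y₀) y₁ := by
  have h1 := hy.2.contDiffAt_map_inverse (n := ∞)
  have h2 := h1.contMDiffAt.comp y₁ (f.contMDiffAt_prod hy.1)
  exact h2.clm_comp contMDiffAt_const

theorem localDiff_localFrame {y₀ y : N} (hy : y ∈ f.base y₀) (z : Model E F E') :
    f.localDiff y₀ y (f.localFrame y₀ y z) = 0 := by
  have := hy.2.self_apply_inverse (0, z)
  exact congrArg Prod.fst this

theorem localProj_localFrame {y₀ y : N} (hy : y ∈ f.base y₀) (z : Model E F E') :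
    f.localProj y₀ (f.localFrame y₀ y z) = z := by
  have := hy.2.self_apply_inverse (0, z)
  exact congrArg Prod.snd this

theorem localFrame_localProj {y₀ y : N} (hy : y ∈ f.base y₀) (w : E' × F)
    (hw : f.localDiff y₀ y w = 0) : f.localFrame y₀ y (f.localProj y₀ w) = w := by
  have := hy.2.inverse_apply_self w
  rw [ContinuousLinearMap.prod_apply, hw] at this
  exact this

/-- An element of the fibre read in the trivializations around `y₀`. -/
def coords (y₀ y : N) : f.Fiber y →L[ℝ] E' × F :=
  (((trivN (I' := I') y₀).continuousLinearMapAt ℝ y) ∘L f.fst y).prod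
    (((f.trivA y₀).continuousLinearMapAt ℝ (f y)) ∘L f.snd y)

theorem localDiff_coords {y₀ y : N} (hy : y ∈ f.base y₀) (w : f.Fiber y) :
    f.localDiff y₀ y (f.coords y₀ y w) = 0 := by
  rw [localDiff_apply]
  simp only [coords, ContinuousLinearMap.prod_apply, ContinuousLinearMap.comp_apply]
  rw [Trivialization.symmL_continuousLinearMapAt _ hy.1.1,
    Trivialization.symmL_continuousLinearMapAt _ hy.1.2.1, mfderiv_fst, sub_self, map_zero]

/-- The inverse of the trivialization around `y₀` on the fibre over `y`. -/
def ofModel {y₀ y : N} (hy : y ∈ f.base y₀) (z : Model E F E') : f.Fiber y :=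
  f.fiberMk ((trivN (I' := I') y₀).symmL ℝ y (f.localFrame y₀ y z).1)
    ((f.trivA y₀).symmL ℝ (f y) (f.localFrame y₀ y z).2) (by
      have h := f.localDiff_localFrame hy z
      rw [localDiff_apply] at h
      have h' := congrArg ((f.trivM y₀).symmL ℝ (f y)) h
      rw [Trivialization.symmL_continuousLinearMapAt _ hy.1.2.2, map_zero] at h'
      exact sub_eq_zero.1 h')

theorem coords_ofModel {y₀ y : N} (hy : y ∈ f.base y₀) (z : Model E F E') :
    f.coords y₀ y (f.ofModel hy z) = f.localFrame y₀ y z := by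
  simp only [coords, ContinuousLinearMap.prod_apply, ContinuousLinearMap.comp_apply, ofModel,
    fst_fiberMk, snd_fiberMk]
  rw [Trivialization.continuousLinearMapAt_symmL _ hy.1.1,
    Trivialization.continuousLinearMapAt_symmL _ hy.1.2.1]

theorem ofModel_localProj_coords {y₀ y : N} (hy : y ∈ f.base y₀) (w : f.Fiber y) :
    f.ofModel hy (f.localProj y₀ (f.coords y₀ y w)) = w := by
  apply fiber_ext
  · rw [ofModel, fst_fiberMk, f.localFrame_localProj hy _ (f.localDiff_coords hy w)]
    exact Trivialization.symmL_continuousLinearMapAt _ hy.1.1 _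
  · rw [ofModel, snd_fiberMk, f.localFrame_localProj hy _ (f.localDiff_coords hy w)]
    exact Trivialization.symmL_continuousLinearMapAt _ hy.1.2.1 _

theorem continuous_ofModel {y₀ y : N} (hy : y ∈ f.base y₀) :
    Continuous (f.ofModel hy) := by
  refine Continuous.subtype_mk (f := fun z ↦ (((trivN (I' := I') y₀).symmL ℝ y (f.localFrame y₀ y z).1),
    ((f.trivA y₀).symmL ℝ (f y) (f.localFrame y₀ y z).2))) ?_ _
  exact (((trivN (I' := I') y₀).symmL ℝ y).continuous.comp
    (continuous_fst.comp (f.localFrame y₀ y).continuous)).prodMk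
    (((f.trivA y₀).symmL ℝ (f y)).continuous.comp
      (continuous_snd.comp (f.localFrame y₀ y).continuous))

open Classical in
/-- The trivialization of `f^! A` around `y₀`. -/
def pretriv (y₀ : N) : Pretrivialization (Model E F E')
    (TotalSpace.proj : TotalSpace (Model E F E') f.Fiber → N) where
  toFun p := (p.1, f.localProj y₀ (f.coords y₀ p.1 p.2))
  invFun q := ⟨q.1, if h : q.1 ∈ f.base y₀ then f.ofModel h q.2 else 0⟩
  source := TotalSpace.proj ⁻¹' f.base y₀
  target := f.base y₀ ×ˢ univ
  map_source' p hp := ⟨hp, trivial⟩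
  map_target' q hq := hq.1
  left_inv' := by
    rintro ⟨y, w⟩ (hy : y ∈ f.base y₀)
    simp only [dif_pos hy, ofModel_localProj_coords]
  right_inv' := by
    rintro ⟨y, z⟩ ⟨hy : y ∈ f.base y₀, -⟩
    simp only [dif_pos hy, coords_ofModel, localProj_localFrame f hy]
  open_target := (f.isOpen_base y₀).prod isOpen_univ
  baseSet := f.base y₀
  open_baseSet := f.isOpen_base y₀
  source_eq := rfl
  target_eq := rfl
  proj_toFun p hp := rfl

theorem pretriv_symm {y₀ y : N} (hy : y ∈ f.base y₀) (z : Model E F E') :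
    (f.pretriv y₀).symm y z = f.ofModel hy z := by
  rw [(f.pretriv y₀).symm_apply hy]
  exact (cast_eq rfl _).trans (dif_pos hy)

/-- The coordinate change between two trivializations. -/
def coordChange (y₀ y₁ y : N) : Model E F E' →L[ℝ] Model E F E' :=
  f.localProj y₁ ∘L
    (((trivN (I' := I') y₁).continuousLinearMapAt ℝ y ∘L (trivN (I' := I') y₀).symmL ℝ y).prodMap
      ((f.trivA y₁).continuousLinearMapAt ℝ (f y) ∘L (f.trivA y₀).symmL ℝ (f y))) ∘L
    f.localFrame y₀ y

theorem coordChange_apply {y₀ y₁ y : N} (hy : y ∈ f.base y₀) (z : Model E F E') :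
    f.coordChange y₀ y₁ y z = (f.pretriv y₁ ⟨y, (f.pretriv y₀).symm y z⟩).2 := by
  rw [pretriv_symm f hy]
  rfl

theorem contMDiffOn_coordChange (y₀ y₁ : N) :
    ContMDiffOn I' 𝓘(ℝ, Model E F E' →L[ℝ] Model E F E') ∞ (f.coordChange y₀ y₁)
      (f.base y₀ ∩ f.base y₁) := by
  rintro y ⟨h0, h1⟩
  refine (contMDiffAt_clm_of_apply fun z ↦ ?_).contMDiffWithinAt
  have hz := (f.contMDiffAt_localFrame h0).clm_apply (contMDiffAt_const (c := z))
  have h2 := contMDiffAt_coord (trivN (I' := I') y₁) (contMDiffAt_symmL (trivN (I' := I') y₀)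
    (f := id) contMDiffAt_id
    ((ContinuousLinearMap.contMDiffAt (ContinuousLinearMap.fst ℝ E' F)).comp y hz) h0.1.1) h1.1.1
  have h3 := contMDiffAt_coord (f.trivA y₁) (contMDiffAt_symmL (f.trivA y₀)
    f.contMDiff.contMDiffAt
    ((ContinuousLinearMap.contMDiffAt (ContinuousLinearMap.snd ℝ E' F)).comp y hz) h0.1.2.1)
    h1.1.2.1
  exact (ContinuousLinearMap.contMDiffAt (f.localProj y₁)).comp y (h2.prodMk_space h3)

theorem pretriv_isLinear (y₀ : N) : (f.pretriv y₀).IsLinear ℝ where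
  linear y _ :=
    { map_add := fun v w ↦ (f.localProj y₀ ∘L f.coords y₀ y).map_add v w
      map_smul := fun c v ↦ (f.localProj y₀ ∘L f.coords y₀ y).map_smul c v }

/-- The atlas of trivializations of `f^! A`. -/
def prebundle : VectorPrebundle ℝ (Model E F E') f.Fiber where
  pretrivializationAtlas := range f.pretriv
  pretrivialization_linear' := by
    rintro _ ⟨y₀, rfl⟩
    exact f.pretriv_isLinear y₀
  pretrivializationAt := f.pretriv
  mem_base_pretrivializationAt := f.mem_base
  pretrivialization_mem_atlas := mem_range_self
  exists_coordChange := by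
    rintro _ ⟨y₀, rfl⟩ _ ⟨y₁, rfl⟩
    exact ⟨f.coordChange y₀ y₁, (f.contMDiffOn_coordChange y₀ y₁).continuousOn,
      fun y hy z ↦ f.coordChange_apply hy.1 z⟩
  totalSpaceMk_isInducing y := by
    let h : f.Fiber y ≃ₜ Model E F E' :=
      { toFun := fun w ↦ f.localProj y (f.coords y y w)
        invFun := f.ofModel (f.mem_base y)
        left_inv := f.ofModel_localProj_coords (f.mem_base y)
        right_inv := fun z ↦ by
          simp only [coords_ofModel, localProj_localFrame f (f.mem_base y)]
        continuous_toFun := (f.localProj y ∘L f.coords y y).continuous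
        continuous_invFun := f.continuous_ofModel (f.mem_base y) }
    exact (Topology.isInducing_const_prod.2 h.isInducing)

instance : TopologicalSpace (TotalSpace (Model E F E') f.Fiber) := f.prebundle.totalSpaceTopology

instance : FiberBundle (Model E F E') f.Fiber := f.prebundle.toFiberBundle

instance : VectorBundle ℝ (Model E F E') f.Fiber := f.prebundle.toVectorBundle

instance : f.prebundle.IsContMDiff I' ∞ where
  exists_contMDiffCoordChange := by
    rintro _ ⟨y₀, rfl⟩ _ ⟨y₁, rfl⟩
    exact ⟨f.coordChange y₀ y₁, f.contMDiffOn_coordChange y₀ y₁,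
      fun y hy z ↦ f.coordChange_apply hy.1 z⟩

instance : ContMDiffVectorBundle ∞ (Model E F E') f.Fiber I' :=
  f.prebundle.contMDiffVectorBundle I'

theorem mem_baseSet_trivializationAt_iff (y₀ y : N) :
    y ∈ (trivializationAt (Model E F E') f.Fiber y₀).baseSet ↔ y ∈ f.base y₀ := Iff.rfl

theorem trivializationAt_apply (y₀ : N) (p : TotalSpace (Model E F E') f.Fiber) :
    trivializationAt (Model E F E') f.Fiber y₀ p =
      (p.1, f.localProj y₀ (f.coords y₀ p.1 p.2)) := rfl

/-- A section of `f^! A` with smooth components is smooth. -/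
theorem contMDiffAt_of_components {s : ∀ y, f.Fiber y} {y₀ : N}
    (hu : ContMDiffAt I' I'.tangent ∞ (fun y ↦ (⟨y, f.fst y (s y)⟩ : TangentBundle I' N)) y₀)
    (ha : ContMDiffAt I' (I.prod 𝓘(ℝ, F)) ∞
      (fun y ↦ (⟨f y, f.snd y (s y)⟩ : TotalSpace F V)) y₀) :
    ContMDiffAt I' (I'.prod 𝓘(ℝ, Model E F E')) ∞
      (fun y ↦ (⟨y, s y⟩ : TotalSpace (Model E F E') f.Fiber)) y₀ := by
  rw [contMDiffAt_section]
  obtain ⟨h1, h2, -⟩ := f.mem_preBase y₀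
  exact (ContinuousLinearMap.contMDiffAt (f.localProj y₀)).comp y₀
    ((contMDiffAt_coord (f := id) (trivN (I' := I') y₀) hu h1).prodMk_space
      (contMDiffAt_coord (f.trivA y₀) ha h2))

theorem contMDiffAt_coords {s : ∀ y, f.Fiber y} {y₀ : N}
    (hs : ContMDiffAt I' (I'.prod 𝓘(ℝ, Model E F E')) ∞
      (fun y ↦ (⟨y, s y⟩ : TotalSpace (Model E F E') f.Fiber)) y₀) :
    ContMDiffAt I' 𝓘(ℝ, E' × F) ∞ (fun y ↦ f.coords y₀ y (s y)) y₀ := by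
  rw [contMDiffAt_section] at hs
  refine ((f.contMDiffAt_localFrame (f.mem_base y₀)).clm_apply hs).congr_of_eventuallyEq ?_
  filter_upwards [(f.isOpen_base y₀).mem_nhds (f.mem_base y₀)] with y hy
  exact (f.localFrame_localProj hy _ (f.localDiff_coords hy _)).symm

theorem contMDiffAt_fst {s : ∀ y, f.Fiber y} {y₀ : N}
    (hs : ContMDiffAt I' (I'.prod 𝓘(ℝ, Model E F E')) ∞
      (fun y ↦ (⟨y, s y⟩ : TotalSpace (Model E F E') f.Fiber)) y₀) :
    ContMDiffAt I' I'.tangent ∞ (fun y ↦ (⟨y, f.fst y (s y)⟩ : TangentBundle I' N)) y₀ :=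
  contMDiffAt_of_coord (f := id) (trivN (I' := I') y₀) contMDiffAt_id
    ((ContinuousLinearMap.contMDiffAt (ContinuousLinearMap.fst ℝ E' F)).comp y₀
      (f.contMDiffAt_coords hs)) (f.mem_preBase y₀).1

theorem contMDiffAt_snd {s : ∀ y, f.Fiber y} {y₀ : N}
    (hs : ContMDiffAt I' (I'.prod 𝓘(ℝ, Model E F E')) ∞
      (fun y ↦ (⟨y, s y⟩ : TotalSpace (Model E F E') f.Fiber)) y₀) :
    ContMDiffAt I' (I.prod 𝓘(ℝ, F)) ∞ (fun y ↦ (⟨f y, f.snd y (s y)⟩ : TotalSpace F V)) y₀ :=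
  contMDiffAt_of_coord (f.trivA y₀) f.contMDiff.contMDiffAt
    ((ContinuousLinearMap.contMDiffAt (ContinuousLinearMap.snd ℝ E' F)).comp y₀
      (f.contMDiffAt_coords hs)) (f.mem_preBase y₀).2.1

theorem contMDiff_anchor : ContMDiff I' (I'.prod 𝓘(ℝ, Model E F E' →L[ℝ] E')) ∞
    (fun y ↦ TotalSpace.mk' (Model E F E' →L[ℝ] E')
      (E := fun y ↦ f.Fiber y →L[ℝ] TangentSpace I' y) y (f.fst y)) := by
  intro y₀
  rw [contMDiffAt_hom_bundle]
  refine ⟨contMDiffAt_id, contMDiffAt_clm_of_apply fun z ↦ ?_⟩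
  have h := contMDiffAt_symmL (trivializationAt (Model E F E') f.Fiber y₀) (f := id)
    (contMDiffAt_id (I := I') (n := ∞) (x := y₀)) (contMDiffAt_const (c := z)) (f.mem_base y₀)
  exact contMDiffAt_coord (trivN (I' := I') y₀) (f := id) (f.contMDiffAt_fst h) (f.mem_preBase y₀).1

end TransverseMap
end Pullback
end LieAlgebroid

section DerivativeHelpers

variable {E' : Type*} [NormedAddCommGroup E'] [NormedSpace ℝ E']
  {H' : Type*} [TopologicalSpace H'] {I' : ModelWithCorners ℝ E' H'}
  {N : Type*} [TopologicalSpace N] [ChartedSpace H' N]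
  {E : Type*} [NormedAddCommGroup E] [NormedSpace ℝ E]
  {H : Type*} [TopologicalSpace H] {I : ModelWithCorners ℝ E H}
  {M : Type*} [TopologicalSpace M] [ChartedSpace H M]
  {P Q : Type*} [NormedAddCommGroup P] [NormedSpace ℝ P] [NormedAddCommGroup Q] [NormedSpace ℝ Q]

theorem mvfderiv_congr {g g' : N → P} {y : N} (h : g =ᶠ[𝓝 y] g') :
    mvfderiv I' g y = mvfderiv I' g' y := by
  ext u
  have := h.mfderiv_eq (I := I') (I' := 𝓘(ℝ, P))
  exact congrArg (fun L ↦ (NormedSpace.fromTangentSpace (𝕜 := ℝ) (g y)) (L u)) this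

theorem mvfderiv_comp_apply' {g : M → P} {f : N → M} {y : N}
    (hg : MDifferentiableAt I 𝓘(ℝ, P) g (f y)) (hf : MDifferentiableAt I' I f y)
    (u : TangentSpace I' y) :
    mvfderiv I' (fun y ↦ g (f y)) y u = mvfderiv I g (f y) (mfderiv I' I f y u) :=
  mfderiv_comp_apply y hg hf u

theorem mvfderiv_clm_apply {L : N → P →L[ℝ] Q} {a : N → P} {y : N}
    (hL : MDifferentiableAt I' 𝓘(ℝ, P →L[ℝ] Q) L y) (ha : MDifferentiableAt I' 𝓘(ℝ, P) a y)
    (u : TangentSpace I' y) :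
    mvfderiv I' (fun y ↦ L y (a y)) y u =
      mvfderiv I' L y u (a y) + L y (mvfderiv I' a y u) := by
  rw [(hL.clm_apply ha).mvfderiv, hL.mvfderiv, ha.mvfderiv]
  have h3 := fderivWithin_clm_apply (I'.uniqueDiffWithinAt_image (x := chartAt H' y y))
    hL.hasMFDerivAt.2.differentiableWithinAt ha.hasMFDerivAt.2.differentiableWithinAt
  have h4 : writtenInExtChartAt I' 𝓘(ℝ, P →L[ℝ] Q) y L (I' (chartAt H' y y)) = L y :=
    congrArg L (extChartAt_to_inv (I := I') y)
  have h5 : writtenInExtChartAt I' 𝓘(ℝ, P) y a (I' (chartAt H' y y)) = a y :=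
    congrArg a (extChartAt_to_inv (I := I') y)
  rw [h4, h5] at h3
  exact (DFunLike.congr_fun h3 u).trans (add_comm _ _)

theorem mvfderiv_clm_comp (L : P →L[ℝ] Q) {a : N → P} {y : N}
    (ha : MDifferentiableAt I' 𝓘(ℝ, P) a y) (u : TangentSpace I' y) :
    mvfderiv I' (fun y ↦ L (a y)) y u = L (mvfderiv I' a y u) := by
  rw [mvfderiv_clm_apply (L := fun _ ↦ L) mdifferentiableAt_const ha, mvfderiv_const]
  simp

variable [IsManifold I' ∞ N]

theorem fderivWithin_chart {g : N → P} {y : N} {z : E'} (hz : z ∈ (extChartAt I' y).target)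
    (hg : MDifferentiableAt I' 𝓘(ℝ, P) g ((extChartAt I' y).symm z))
    (u : ∀ y : N, TangentSpace I' y) :
    fderivWithin ℝ (g ∘ (extChartAt I' y).symm) (range I') z
      (mpullbackWithin 𝓘(ℝ, E') I' (extChartAt I' y).symm u (range I') z) =
    mvfderiv I' g ((extChartAt I' y).symm z) (u ((extChartAt I' y).symm z)) := by
  have hzr : z ∈ range I' := extChartAt_target_subset_range y hz
  have : IsManifold I' 1 N := .of_le (n := ∞) (by simp)
  have h1 := mfderiv_comp_mfderivWithin (I := 𝓘(ℝ, E')) z hg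
    ((contMDiffWithinAt_extChartAt_symm_range (n := 1) y hz).mdifferentiableWithinAt (by simp))
    (I'.uniqueMDiffOn z hzr)
  rw [mfderivWithin_eq_fderivWithin] at h1
  rw [h1]
  have h2 := (isInvertible_mfderivWithin_extChartAt_symm hz).self_apply_inverse
    (u ((extChartAt I' y).symm z))
  simp only [mpullbackWithin]
  exact congrArg (fun w ↦ mvfderiv I' g ((extChartAt I' y).symm z) w) h2

theorem contMDiffAt_mvfderiv_apply {g : N → P} {y : N} {u : ∀ y : N, TangentSpace I' y}
    (hg : ContMDiffAt I' 𝓘(ℝ, P) ∞ g y)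
    (hu : ContMDiffAt I' I'.tangent ∞ (fun y ↦ (⟨y, u y⟩ : TangentBundle I' N)) y) :
    ContMDiffAt I' 𝓘(ℝ, P) ∞ (fun y ↦ mvfderiv I' g y (u y)) y := by
  have : IsManifold I' 1 N := .of_le (n := ∞) (by simp)
  have h1 := hg.mfderiv_const (m := ∞) (by simp)
  have h2 : ContMDiffAt I' 𝓘(ℝ, P).tangent ∞
      (fun y ↦ (⟨g y, mfderiv I' 𝓘(ℝ, P) g y (u y)⟩ : TangentBundle 𝓘(ℝ, P) P)) y :=
    ContMDiffAt.clm_apply_of_inCoordinates (b₁ := id) h1 hu hg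
  exact (contMDiff_snd_tangentBundle_modelSpace P 𝓘(ℝ, P)).contMDiffAt.comp y h2

theorem two_le_infty : (2 : WithTop ℕ∞) ≤ ∞ := WithTop.coe_le_coe.2 le_top

/-- The Lie bracket of vector fields acts on functions as the commutator of derivations. -/
theorem mvfderiv_mlieBracket [I'.Boundaryless] [CompleteSpace E'] {g : N → P} {y : N}
    {u v : ∀ y : N, TangentSpace I' y}
    (hg : ContMDiffAt I' 𝓘(ℝ, P) ∞ g y)
    (hu : ContMDiffAt I' I'.tangent ∞ (fun y ↦ (⟨y, u y⟩ : TangentBundle I' N)) y)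
    (hv : ContMDiffAt I' I'.tangent ∞ (fun y ↦ (⟨y, v y⟩ : TangentBundle I' N)) y) :
    mvfderiv I' g y (mlieBracket I' u v y) =
      mvfderiv I' (fun y ↦ mvfderiv I' g y (v y)) y (u y) -
      mvfderiv I' (fun y ↦ mvfderiv I' g y (u y)) y (v y) := by
  have : IsManifold I' 1 N := .of_le (n := ∞) (by simp)
  have : IsManifold I' 2 N := .of_le (n := ∞) two_le_infty
  set φ := extChartAt I' y with hφ
  have hr : range I' = univ := I'.range_eq_univ
  have hz₀ : φ y ∈ φ.target := mem_extChartAt_target y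
  have hinv : φ.symm (φ y) = y := extChartAt_to_inv y
  have hg' : ContDiffAt ℝ ∞ (g ∘ φ.symm) (φ y) := by
    have h := (contMDiffAt_iff.1 hg).2
    rw [hr, contDiffWithinAt_univ] at h
    exact h
  let pb (w : ∀ y : N, TangentSpace I' y) : E' → E' :=
    fun z ↦ mpullbackWithin 𝓘(ℝ, E') I' φ.symm w (range I') z
  have hpb {Q : Type _} [NormedAddCommGroup Q] [NormedSpace ℝ Q] (k : N → Q) (z : E')
      (hz : z ∈ φ.target) (hk : MDifferentiableAt I' 𝓘(ℝ, Q) k (φ.symm z))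
      (w : ∀ y : N, TangentSpace I' y) :
      fderiv ℝ (k ∘ φ.symm) z (pb w z) = mvfderiv I' k (φ.symm z) (w (φ.symm z)) := by
    have := fderivWithin_chart hz hk w
    rw [← fderivWithin_univ, ← hr]
    exact this
  have key (w : ∀ y : N, TangentSpace I' y)
      (hw : ContMDiffAt I' I'.tangent ∞ (fun y ↦ (⟨y, w y⟩ : TangentBundle I' N)) y)
      (u : ∀ y : N, TangentSpace I' y) :
      mvfderiv I' (fun y ↦ mvfderiv I' g y (w y)) y (u y) =
        fderiv ℝ (g ∘ φ.symm) (φ y) (fderiv ℝ (pb w) (φ y) (pb u (φ y))) +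
        fderiv ℝ (fderiv ℝ (g ∘ φ.symm)) (φ y) (pb u (φ y)) (pb w (φ y)) := by
    have hK := (contMDiffAt_mvfderiv_apply hg hw).mdifferentiableAt (by simp)
    have h1 := hpb (fun y ↦ mvfderiv I' g y (w y)) (φ y) hz₀ (by rwa [hinv]) u
    rw [hinv] at h1
    rw [← h1]
    have hev : (fun y ↦ mvfderiv I' g y (w y)) ∘ φ.symm =ᶠ[𝓝 (φ y)] fun z ↦
        fderiv ℝ (g ∘ φ.symm) z (pb w z) := by
      have h2 : ∀ᶠ y' in 𝓝 y, MDifferentiableAt I' 𝓘(ℝ, P) g y' := by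
        have := (contMDiffAt_iff_contMDiffAt_nhds (n := 1) (by simp)).1 (hg.of_le (by simp))
        filter_upwards [this] with y' h using h.mdifferentiableAt (by simp)
      have h3 := (continuousAt_extChartAt_symm (I := I') y).eventually (by rwa [← hφ, hinv])
      filter_upwards [h3, extChartAt_target_mem_nhds (I := I') y] with z hz hzt
      exact (hpb g z hzt hz w).symm
    rw [hev.fderiv_eq]
    have hd : DifferentiableAt ℝ (pb w) (φ y) := by
      have := (mdifferentiableWithinAt_univ.2 (hw.mdifferentiableAt
        (by simp))).differentiableWithinAt_mpullbackWithin_vectorField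
      rw [preimage_univ, univ_inter] at this
      exact (this.mono (s := univ) (by rw [hr])).differentiableAt univ_mem
    rw [fderiv_clm_apply ((hg'.fderiv_right (m := 1) two_le_infty).differentiableAt (by simp)) hd]
    rfl
  have hsymm : IsSymmSndFDerivAt ℝ (g ∘ φ.symm) (φ y) :=
    hg'.isSymmSndFDerivAt (by simpa using two_le_infty)
  have hs := hsymm.eq (pb u (φ y)) (pb v (φ y))
  rw [key v hv u, key u hu v, hs, add_sub_add_right_eq_sub, ← map_sub]
  have h1 : mvfderiv I' g y (mlieBracket I' u v y) =
      fderiv ℝ (g ∘ φ.symm) (φ y) (lieBracket ℝ (pb u) (pb v) (φ y)) := by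
    rw [(hg.mdifferentiableAt (by simp)).mvfderiv, hr, fderivWithin_univ]
    have h2 : mlieBracket I' u v y = lieBracket ℝ (pb u) (pb v) (φ y) := by
      rw [← mlieBracketWithin_univ, mlieBracketWithin_apply, preimage_univ, univ_inter]
      have hid : (mfderiv I' 𝓘(ℝ, E') (extChartAt I' y) y).inverse =
          (ContinuousLinearMap.id ℝ E') := by
        rw [mfderiv_extChartAt_self]
        exact ContinuousLinearMap.inverse_id
      have h3 : lieBracketWithin ℝ (pb u) (pb v) (range I') (φ y) =
          lieBracket ℝ (pb u) (pb v) (φ y) := by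
        rw [hr, lieBracketWithin_univ]
      exact (DFunLike.congr_fun hid _).trans h3
    rw [h2]
    rfl
  rw [h1]
  rfl

end DerivativeHelpers

namespace LieAlgebroid

section Local

variable {E : Type*} [NormedAddCommGroup E] [NormedSpace ℝ E] [FiniteDimensional ℝ E]
  {H : Type*} [TopologicalSpace H] {I : ModelWithCorners ℝ E H}
  {M : Type*} [TopologicalSpace M] [ChartedSpace H M] [IsManifold I ∞ M] [T2Space M]
  {F : Type*} [NormedAddCommGroup F] [NormedSpace ℝ F] [FiniteDimensional ℝ F]
  {V : M → Type*} [∀ x, AddCommGroup (V x)] [∀ x, Module ℝ (V x)]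
  [∀ x, TopologicalSpace (V x)] [TopologicalSpace (TotalSpace F V)]
  [FiberBundle F V] [VectorBundle ℝ F V] [ContMDiffVectorBundle ∞ F V I]
  (A : LieAlgebroid I F V)

theorem exists_bump {x : M} {U : Set M} (hU : U ∈ 𝓝 x) :
    ∃ χ : C^∞⟮I, M; ℝ⟯, tsupport χ ⊆ U ∧ ∀ᶠ z in 𝓝 x, χ z = 1 := by
  obtain ⟨f, -, hf⟩ := (SmoothBumpFunction.nhds_basis_tsupport (I := I) x).mem_iff.1 hU
  exact ⟨⟨f, f.contMDiff⟩, hf, f.eventuallyEq_one⟩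

theorem bracket_swap (a b : Cₛ^∞⟮I; F, V⟯) : A.bracket a b = -A.bracket b a := by
  have h := A.bracket_self (a + b)
  simp only [map_add, LinearMap.add_apply, A.bracket_self, zero_add, add_zero] at h
  exact eq_neg_of_add_eq_zero_right h

theorem bracket_congr_right (c : Cₛ^∞⟮I; F, V⟯) {a b : Cₛ^∞⟮I; F, V⟯} {x : M}
    (h : ∀ᶠ z in 𝓝 x, a z = b z) : A.bracket c a x = A.bracket c b x := by
  obtain ⟨χ, hχ, hχ1⟩ := exists_bump (I := I) h
  have h1 := A.leibniz c (a - b) 0 χ (fun z ↦ by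
    by_cases hz : z ∈ tsupport χ
    · have : a z = b z := hχ hz
      simp [this]
    · simp [image_eq_zero_of_notMem_tsupport hz]) x
  have h2 : a x = b x := h.self_of_nhds
  have h3 : χ x = 1 := hχ1.self_of_nhds
  simp only [map_zero, map_sub, ContMDiffSection.coe_zero, Pi.zero_apply, h3,
    ContMDiffSection.coe_sub, Pi.sub_apply, h2, sub_self, smul_zero, add_zero, one_smul] at h1
  exact sub_eq_zero.1 h1.symm

theorem bracket_congr_left (c : Cₛ^∞⟮I; F, V⟯) {a b : Cₛ^∞⟮I; F, V⟯} {x : M}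
    (h : ∀ᶠ z in 𝓝 x, a z = b z) : A.bracket a c x = A.bracket b c x := by
  rw [A.bracket_swap a, A.bracket_swap b, ContMDiffSection.coe_neg, ContMDiffSection.coe_neg,
    Pi.neg_apply, Pi.neg_apply, A.bracket_congr_right c h]

variable (e : Trivialization F (TotalSpace.proj : TotalSpace F V → M)) [MemTrivializationAtlas e]

variable (I) in
theorem exists_cutoff (x : M) : ∃ χ : C^∞⟮I, M; ℝ⟯, tsupport χ ⊆ e.baseSet ∧
    (x ∈ e.baseSet → ∀ᶠ z in 𝓝 x, χ z = 1) := by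
  by_cases hx : x ∈ e.baseSet
  · obtain ⟨χ, h1, h2⟩ := exists_bump (I := I) (e.open_baseSet.mem_nhds hx)
    exact ⟨χ, h1, fun _ ↦ h2⟩
  · exact ⟨⟨fun _ ↦ 0, contMDiff_const⟩, by simp [tsupport], fun h ↦ (hx h).elim⟩

variable (I) in
/-- A smooth function supported in the base set of `e`, equal to `1` near `x`. -/
def cutoff (x : M) : C^∞⟮I, M; ℝ⟯ := (exists_cutoff I e x).choose

theorem tsupport_cutoff (x : M) : tsupport (cutoff I e x) ⊆ e.baseSet :=
  (exists_cutoff I e x).choose_spec.1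

theorem cutoff_eventually {x : M} (hx : x ∈ e.baseSet) : ∀ᶠ z in 𝓝 x, cutoff I e x z = 1 :=
  (exists_cutoff I e x).choose_spec.2 hx

variable (I) in
/-- The section which in the trivialization `e` is constant near `x` equal to `v`,
cut off to a global section. -/
def constSection (x : M) : F →ₗ[ℝ] Cₛ^∞⟮I; F, V⟯ where
  toFun v := ⟨fun z ↦ cutoff I e x z • e.symmL ℝ z v,
    ContMDiffOn.smul_section_of_tsupport (s := fun z ↦ e.symmL ℝ z v)
      (cutoff I e x).contMDiff.contMDiffOn e.open_baseSet (tsupport_cutoff e x) fun z hz ↦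
        (contMDiffAt_symmL e (f := id) contMDiffAt_id contMDiffAt_const hz).contMDiffWithinAt⟩
  map_add' v w := by ext z; simp
  map_smul' r v := by ext z; simp [smul_comm r]

theorem constSection_apply (x : M) (v : F) (z : M) :
    constSection I e x v z = cutoff I e x z • e.symmL ℝ z v := rfl

theorem constSection_eventually {x : M} (hx : x ∈ e.baseSet) (v : F) :
    ∀ᶠ z in 𝓝 x, constSection I e x v z = e.symmL ℝ z v := by
  filter_upwards [cutoff_eventually (I := I) e hx] with z hz
  rw [constSection_apply, hz, one_smul]

/-- The bracket of sections constant in the trivialization `e`. -/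
def structLin (x : M) : F →ₗ[ℝ] F →ₗ[ℝ] F :=
  LinearMap.mk₂ ℝ (fun v w ↦ e.continuousLinearMapAt ℝ x
      (A.bracket (constSection I e x v) (constSection I e x w) x))
    (by intros; simp) (by intros; simp) (by intros; simp) (by intros; simp)

/-- The structure functions of `A` in the trivialization `e`: the bracket of the sections that are
constant in the trivialization. -/
def struct (x : M) : F →L[ℝ] F →L[ℝ] F := (A.structLin e x).toContinuousBilinearMap

theorem struct_apply (x : M) (v w : F) : A.struct e x v w = e.continuousLinearMapAt ℝ x
    (A.bracket (constSection I e x v) (constSection I e x w) x) := rfl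

theorem struct_swap (x : M) (v w : F) : A.struct e x v w = -A.struct e x w v := by
  rw [struct_apply, struct_apply, A.bracket_swap]
  simp

theorem struct_eventually {x : M} (hx : x ∈ e.baseSet) (v w : F) :
    ∀ᶠ z in 𝓝 x, A.struct e z v w = e.continuousLinearMapAt ℝ z
      (A.bracket (constSection I e x v) (constSection I e x w) z) := by
  filter_upwards [(constSection_eventually (I := I) e hx v).eventually_nhds,
    (constSection_eventually (I := I) e hx w).eventually_nhds, e.open_baseSet.mem_nhds hx]
    with z h1 h2 hz
  have h3 : ∀ᶠ z' in 𝓝 z, constSection I e z v z' = constSection I e x v z' := by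
    filter_upwards [h1, constSection_eventually (I := I) e hz v] with z' h4 h5
    rw [h4, h5]
  have h4 : ∀ᶠ z' in 𝓝 z, constSection I e z w z' = constSection I e x w z' := by
    filter_upwards [h2, constSection_eventually (I := I) e hz w] with z' h4 h5
    rw [h4, h5]
  rw [struct_apply, A.bracket_congr_left _ h3, A.bracket_congr_right _ h4]

theorem contMDiffAt_struct {x : M} (hx : x ∈ e.baseSet) :
    ContMDiffAt I 𝓘(ℝ, F →L[ℝ] F →L[ℝ] F) ∞ (A.struct e) x := by
  refine contMDiffAt_clm_of_apply fun v ↦ contMDiffAt_clm_of_apply fun w ↦ ?_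
  exact (contMDiffAt_coord e (f := id) (A.bracket (constSection I e x v)
    (constSection I e x w)).contMDiff.contMDiffAt hx).congr_of_eventuallyEq
    (A.struct_eventually e hx v w)

theorem contMDiffAt_coord_section (a : Cₛ^∞⟮I; F, V⟯) {x : M} (hx : x ∈ e.baseSet) :
    ContMDiffAt I 𝓘(ℝ, F) ∞ (fun z ↦ e.continuousLinearMapAt ℝ z (a z)) x :=
  contMDiffAt_coord e (f := id) a.contMDiff.contMDiffAt hx

theorem bracket_expand_right (c b : Cₛ^∞⟮I; F, V⟯) {x : M} (hx : x ∈ e.baseSet) :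
    e.continuousLinearMapAt ℝ x (A.bracket c b x) =
      mvfderiv I (fun z ↦ e.continuousLinearMapAt ℝ z (b z)) x (A.anchor x (c x)) +
      e.continuousLinearMapAt ℝ x
        (A.bracket c (constSection I e x (e.continuousLinearMapAt ℝ x (b x))) x) := by
  let B := Module.finBasis ℝ F
  let co : Fin (Module.finrank ℝ F) → (F →L[ℝ] ℝ) := fun i ↦ (B.coord i).toContinuousLinearMap
  have hco (v : F) : ∑ i, co i v • B i = v := B.sum_repr v
  let β : M → F := fun z ↦ e.continuousLinearMapAt ℝ z (b z)
  have hβ {z : M} (hz : z ∈ e.baseSet) : ContMDiffAt I 𝓘(ℝ, F) ∞ β z :=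
    contMDiffAt_coord_section e b hz
  let g : Fin (Module.finrank ℝ F) → C^∞⟮I, M; ℝ⟯ := fun i ↦
    ⟨fun z ↦ cutoff I e x z • co i (β z), contMDiff_of_tsupport fun z hz ↦
      (cutoff I e x).contMDiff.contMDiffAt.smul
        ((ContinuousLinearMap.contMDiffAt (co i)).comp z
          (hβ (tsupport_cutoff e x (tsupport_smul_subset_left _ _ hz))))⟩
  let s : Fin (Module.finrank ℝ F) → Cₛ^∞⟮I; F, V⟯ := fun i ↦
    ⟨fun z ↦ g i z • constSection I e x (B i) z,
      (g i).contMDiff.smul_section (constSection I e x (B i)).contMDiff⟩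
  have hg (i) : ∀ᶠ z in 𝓝 x, g i z = co i (β z) := by
    filter_upwards [cutoff_eventually (I := I) e hx] with z hz
    change cutoff I e x z • co i (β z) = _
    rw [hz, one_smul]
  have hsum (σ : Fin (Module.finrank ℝ F) → Cₛ^∞⟮I; F, V⟯) (z : M) :
      (∑ i, σ i) z = ∑ i, σ i z := by
    rw [← ContMDiffSection.coeAddHom_apply, map_sum, Finset.sum_apply]
    rfl
  have hb : ∀ᶠ z in 𝓝 x, b z = (∑ i, s i) z := by
    have h1 := eventually_all.2 fun i ↦ constSection_eventually (I := I) e hx (B i)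
    filter_upwards [eventually_all.2 hg, h1, e.open_baseSet.mem_nhds hx] with z h2 h3 hz
    rw [hsum]
    have : ∀ i, s i z = e.symmL ℝ z (co i (β z) • B i) := fun i ↦ by
      change g i z • constSection I e x (B i) z = _
      rw [h2, h3, map_smul]
    simp_rw [this]
    rw [← map_sum, hco]
    exact (e.symmL_continuousLinearMapAt hz _).symm
  have hL (i) : e.continuousLinearMapAt ℝ x (A.bracket c (s i) x) =
      co i (β x) • e.continuousLinearMapAt ℝ x (A.bracket c (constSection I e x (B i)) x) +
      co i (mvfderiv I β x (A.anchor x (c x))) • B i := by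
    rw [A.leibniz c (constSection I e x (B i)) (s i) (g i) (fun _ ↦ rfl) x, map_add, map_smul,
      map_smul, (constSection_eventually (I := I) e hx (B i)).self_of_nhds,
      e.continuousLinearMapAt_symmL hx, (hg i).self_of_nhds, mvfderiv_congr (hg i),
      mvfderiv_clm_comp (co i) ((hβ hx).mdifferentiableAt (by simp))]
  rw [A.bracket_congr_right c hb, map_sum, hsum, map_sum]
  simp_rw [hL]
  rw [Finset.sum_add_distrib, hco, add_comm]
  congr 1
  conv_rhs => rw [← hco (e.continuousLinearMapAt ℝ x (b x)), map_sum, map_sum, hsum, map_sum]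
  refine Finset.sum_congr rfl fun i _ ↦ ?_
  simp [β]

/-- The bracket in a trivialization. -/
theorem bracket_expand (a b : Cₛ^∞⟮I; F, V⟯) {x : M} (hx : x ∈ e.baseSet) :
    e.continuousLinearMapAt ℝ x (A.bracket a b x) =
      mvfderiv I (fun z ↦ e.continuousLinearMapAt ℝ z (b z)) x (A.anchor x (a x)) -
      mvfderiv I (fun z ↦ e.continuousLinearMapAt ℝ z (a z)) x (A.anchor x (b x)) +
      A.struct e x (e.continuousLinearMapAt ℝ x (a x)) (e.continuousLinearMapAt ℝ x (b x)) := by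
  rw [A.bracket_expand_right e a b hx, A.bracket_swap a, ContMDiffSection.coe_neg, Pi.neg_apply,
    map_neg, A.bracket_expand_right e _ a hx, (constSection_eventually (I := I) e hx _).self_of_nhds,
    e.symmL_continuousLinearMapAt hx, ← struct_apply, struct_swap]
  abel

end Local
end LieAlgebroid

theorem mvfderiv_clm_const {E : Type*} [NormedAddCommGroup E] [NormedSpace ℝ E]
    {H : Type*} [TopologicalSpace H] {I : ModelWithCorners ℝ E H}
    {M : Type*} [TopologicalSpace M] [ChartedSpace H M]
    {P Q : Type*} [NormedAddCommGroup P] [NormedSpace ℝ P] [NormedAddCommGroup Q] [NormedSpace ℝ Q]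
    {L : M → P →L[ℝ] Q} {x : M} (hL : MDifferentiableAt I 𝓘(ℝ, P →L[ℝ] Q) L x) (p : P)
    (u : TangentSpace I x) : mvfderiv I (fun z ↦ L z p) x u = mvfderiv I L x u p := by
  rw [mvfderiv_clm_apply hL mdifferentiableAt_const, mvfderiv_const]
  simp

namespace LieAlgebroid

section LocalIdentities

variable {E : Type*} [NormedAddCommGroup E] [NormedSpace ℝ E] [FiniteDimensional ℝ E]
  {H : Type*} [TopologicalSpace H] {I : ModelWithCorners ℝ E H}
  {M : Type*} [TopologicalSpace M] [ChartedSpace H M] [IsManifold I ∞ M] [T2Space M]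
  {F : Type*} [NormedAddCommGroup F] [NormedSpace ℝ F] [FiniteDimensional ℝ F]
  {V : M → Type*} [∀ x, AddCommGroup (V x)] [∀ x, Module ℝ (V x)]
  [∀ x, TopologicalSpace (V x)] [TopologicalSpace (TotalSpace F V)]
  [FiberBundle F V] [VectorBundle ℝ F V] [ContMDiffVectorBundle ∞ F V I]
  (A : LieAlgebroid I F V)
  (e e' : Trivialization F (TotalSpace.proj : TotalSpace F V → M))
  [MemTrivializationAtlas e] [MemTrivializationAtlas e']

/-- The transition function from the trivialization `e` to `e'`. -/
def transition (x : M) : F →L[ℝ] F := e'.continuousLinearMapAt ℝ x ∘L e.symmL ℝ x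

variable (I) in
theorem contMDiffAt_transition {x : M} (hx : x ∈ e.baseSet) (hx' : x ∈ e'.baseSet) :
    ContMDiffAt I 𝓘(ℝ, F →L[ℝ] F) ∞ (transition e e') x :=
  contMDiffAt_clm_of_apply fun v ↦ contMDiffAt_coord e' (f := id)
    (contMDiffAt_symmL e (f := id) contMDiffAt_id (contMDiffAt_const (c := v)) hx) hx'

theorem struct_transition {x : M} (hx : x ∈ e.baseSet) (hx' : x ∈ e'.baseSet) (v w : F) :
    transition e e' x (A.struct e x v w) =
      mvfderiv I (transition e e') x (A.anchor x (e.symmL ℝ x v)) w -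
      mvfderiv I (transition e e') x (A.anchor x (e.symmL ℝ x w)) v +
      A.struct e' x (transition e e' x v) (transition e e' x w) := by
  have hT := (contMDiffAt_transition I e e' hx hx').mdifferentiableAt (by simp)
  have h1 : transition e e' x (A.struct e x v w) = e'.continuousLinearMapAt ℝ x
      (A.bracket (constSection I e x v) (constSection I e x w) x) := by
    rw [struct_apply, transition, ContinuousLinearMap.comp_apply, e.symmL_continuousLinearMapAt hx]
  have h2 (v : F) : (fun z ↦ e'.continuousLinearMapAt ℝ z (constSection I e x v z)) =ᶠ[𝓝 x]
      fun z ↦ transition e e' z v := by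
    filter_upwards [constSection_eventually (I := I) e hx v] with z hz
    rw [hz, transition, ContinuousLinearMap.comp_apply]
  rw [h1, A.bracket_expand e' _ _ hx', mvfderiv_congr (h2 v), mvfderiv_congr (h2 w),
    mvfderiv_clm_const hT, mvfderiv_clm_const hT,
    (constSection_eventually (I := I) e hx v).self_of_nhds,
    (constSection_eventually (I := I) e hx w).self_of_nhds]
  rfl

/-- The anchor read in the trivialization `e` and, on the tangent side, through a function `h`. -/
def anchorIn (h : M → E) (x : M) : F →L[ℝ] E := mvfderiv I h x ∘L A.anchor x ∘L e.symmL ℝ x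

theorem contMDiffAt_anchorIn {h : M → E} {x : M} (hh : ContMDiffAt I 𝓘(ℝ, E) ∞ h x)
    (hx : x ∈ e.baseSet) : ContMDiffAt I 𝓘(ℝ, F →L[ℝ] E) ∞ (A.anchorIn e h) x :=
  contMDiffAt_clm_of_apply fun v ↦ contMDiffAt_mvfderiv_apply hh
    (A.contMDiffAt_anchor_section (g := id) contMDiffAt_id
      (contMDiffAt_symmL e (f := id) contMDiffAt_id (contMDiffAt_const (c := v)) hx))

theorem struct_anchorIn [I.Boundaryless] {h : M → E} {x : M} (hh : ContMDiffAt I 𝓘(ℝ, E) ∞ h x)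
    (hx : x ∈ e.baseSet) (v w : F) :
    A.anchorIn e h x (A.struct e x v w) =
      mvfderiv I (A.anchorIn e h) x (A.anchor x (e.symmL ℝ x v)) w -
      mvfderiv I (A.anchorIn e h) x (A.anchor x (e.symmL ℝ x w)) v := by
  have : CompleteSpace E := FiniteDimensional.complete ℝ E
  have hR := (A.contMDiffAt_anchorIn e hh hx).mdifferentiableAt (by simp)
  have h1 : A.anchorIn e h x (A.struct e x v w) = mvfderiv I h x (A.anchor x
      (A.bracket (constSection I e x v) (constSection I e x w) x)) := by
    rw [struct_apply, anchorIn, ContinuousLinearMap.comp_apply, ContinuousLinearMap.comp_apply,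
      e.symmL_continuousLinearMapAt hx]
  have h2 (v : F) : (fun z ↦ mvfderiv I h z (A.anchor z (constSection I e x v z))) =ᶠ[𝓝 x]
      fun z ↦ A.anchorIn e h z v := by
    filter_upwards [constSection_eventually (I := I) e hx v] with z hz
    rw [hz]
    rfl
  have h3 (v : F) : ContMDiffAt I I.tangent ∞ (fun z ↦ (⟨z, A.anchor z (constSection I e x v z)⟩ :
      TangentBundle I M)) x := A.contMDiffAt_anchor_section (g := id) contMDiffAt_id
    ((constSection I e x v).contMDiff.contMDiffAt (x := x))
  rw [h1, A.anchor_bracket, mvfderiv_mlieBracket hh (h3 v) (h3 w), mvfderiv_congr (h2 v),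
    mvfderiv_congr (h2 w), mvfderiv_clm_const hR, mvfderiv_clm_const hR,
    (constSection_eventually (I := I) e hx v).self_of_nhds,
    (constSection_eventually (I := I) e hx w).self_of_nhds]

theorem struct_jacobi {x : M} (hx : x ∈ e.baseSet) (u v w : F) :
    mvfderiv I (A.struct e) x (A.anchor x (e.symmL ℝ x u)) v w +
        A.struct e x u (A.struct e x v w) =
      (-mvfderiv I (A.struct e) x (A.anchor x (e.symmL ℝ x w)) u v +
        A.struct e x (A.struct e x u v) w) +
      (mvfderiv I (A.struct e) x (A.anchor x (e.symmL ℝ x v)) u w +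
        A.struct e x v (A.struct e x u w)) := by
  have hC := (A.contMDiffAt_struct e hx)
  have hC1 := hC.mdifferentiableAt (by simp)
  have h1 (v w : F) : (fun z ↦ e.continuousLinearMapAt ℝ z
      (A.bracket (constSection I e x v) (constSection I e x w) z)) =ᶠ[𝓝 x]
      fun z ↦ A.struct e z v w := by
    filter_upwards [A.struct_eventually e hx v w] with z hz using hz.symm
  have h2 (v w : F) (t : TangentSpace I x) : mvfderiv I (fun z ↦ e.continuousLinearMapAt ℝ z
      (A.bracket (constSection I e x v) (constSection I e x w) z)) x t =
      mvfderiv I (A.struct e) x t v w := by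
    rw [mvfderiv_congr (h1 v w), mvfderiv_clm_const (L := fun z ↦ A.struct e z v)
      ((hC.clm_apply contMDiffAt_const).mdifferentiableAt (by simp)), mvfderiv_clm_const hC1]
  have h3 (v : F) : (fun z ↦ e.continuousLinearMapAt ℝ z (constSection I e x v z)) =ᶠ[𝓝 x]
      fun _ ↦ v := by
    filter_upwards [constSection_eventually (I := I) e hx v, e.open_baseSet.mem_nhds hx] with z hz hz'
    rw [hz, e.continuousLinearMapAt_symmL hz']
  have h4 (v : F) (t : TangentSpace I x) : mvfderiv I (fun z ↦ e.continuousLinearMapAt ℝ z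
      (constSection I e x v z)) x t = 0 := by
    rw [mvfderiv_congr (h3 v), mvfderiv_const]
    rfl
  have h5 := congrArg (fun s : Cₛ^∞⟮I; F, V⟯ ↦ e.continuousLinearMapAt ℝ x (s x))
    (A.jacobi (constSection I e x u) (constSection I e x v) (constSection I e x w))
  simp only [ContMDiffSection.coe_add, Pi.add_apply, map_add] at h5
  rw [A.bracket_expand e (constSection I e x u) (A.bracket _ _) hx,
    A.bracket_expand e (A.bracket _ _) _ hx,
    A.bracket_expand e (constSection I e x v) (A.bracket _ _) hx] at h5
  have h6 (v w : F) := (h1 v w).self_of_nhds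
  simp only [h2, h4, h6, (constSection_eventually (I := I) e hx _).self_of_nhds,
    e.continuousLinearMapAt_symmL hx, sub_zero, zero_sub] at h5
  exact h5

end LocalIdentities
end LieAlgebroid

namespace LieAlgebroid
namespace TransverseMap

section Bracket

variable {E : Type*} [NormedAddCommGroup E] [NormedSpace ℝ E] [FiniteDimensional ℝ E]
  {H : Type*} [TopologicalSpace H] {I : ModelWithCorners ℝ E H} [I.Boundaryless]
  {M : Type*} [TopologicalSpace M] [ChartedSpace H M] [IsManifold I ∞ M] [T2Space M]
  {F : Type*} [NormedAddCommGroup F] [NormedSpace ℝ F] [FiniteDimensional ℝ F]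
  {V : M → Type*} [∀ x, AddCommGroup (V x)] [∀ x, Module ℝ (V x)]
  [∀ x, TopologicalSpace (V x)] [TopologicalSpace (TotalSpace F V)]
  [FiberBundle F V] [VectorBundle ℝ F V] [ContMDiffVectorBundle ∞ F V I]
  {A : LieAlgebroid I F V}
  {E' : Type*} [NormedAddCommGroup E'] [NormedSpace ℝ E'] [FiniteDimensional ℝ E']
  {H' : Type*} [TopologicalSpace H'] {I' : ModelWithCorners ℝ E' H'} [I'.Boundaryless]
  {N : Type*} [TopologicalSpace N] [ChartedSpace H' N] [IsManifold I' ∞ N]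
  (f : TransverseMap A I' N)
  (e e' : Trivialization F (TotalSpace.proj : TotalSpace F V → M))
  [MemTrivializationAtlas e] [MemTrivializationAtlas e']

/-- The vector field component of a section of `f^! A`. -/
def vec (σ : Cₛ^∞⟮I'; Model E F E', f.Fiber⟯) (y : N) : TangentSpace I' y := f.fst y (σ y)

/-- The `A` component of a section of `f^! A`, read in the trivialization `e` of `A`. -/
def coord (σ : Cₛ^∞⟮I'; Model E F E', f.Fiber⟯) (y : N) : F :=
  e.continuousLinearMapAt ℝ (f y) (f.snd y (σ y))

/-- The `A` component of the bracket of two sections of `f^! A`, in the trivialization `e`: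
for `σ = (u, α)` and `τ = (v, β)` it is `u β - v α + [α, β]`, where the last term is the bracket
of `A` extended bilinearly over functions from the sections constant in the trivialization. -/
def bracketIn (σ τ : Cₛ^∞⟮I'; Model E F E', f.Fiber⟯) (y : N) : F :=
  mvfderiv I' (f.coord e τ) y (f.vec σ y) - mvfderiv I' (f.coord e σ) y (f.vec τ y) +
    A.struct e (f y) (f.coord e σ y) (f.coord e τ y)

variable {f e e'}

theorem contMDiffAt_vec (σ : Cₛ^∞⟮I'; Model E F E', f.Fiber⟯) (y : N) :
    ContMDiffAt I' I'.tangent ∞ (fun y ↦ (⟨y, f.vec σ y⟩ : TangentBundle I' N)) y :=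
  f.contMDiffAt_fst σ.contMDiff.contMDiffAt

theorem contMDiffAt_coord {y : N} (hy : f y ∈ e.baseSet)
    (σ : Cₛ^∞⟮I'; Model E F E', f.Fiber⟯) : ContMDiffAt I' 𝓘(ℝ, F) ∞ (f.coord e σ) y :=
  _root_.contMDiffAt_coord e (f.contMDiffAt_snd σ.contMDiff.contMDiffAt) hy

theorem symmL_coord {y : N} (hy : f y ∈ e.baseSet)
    (σ : Cₛ^∞⟮I'; Model E F E', f.Fiber⟯) : e.symmL ℝ (f y) (f.coord e σ y) = f.snd y (σ y) :=
  e.symmL_continuousLinearMapAt hy _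

theorem mfderiv_vec {y : N} (hy : f y ∈ e.baseSet) (σ : Cₛ^∞⟮I'; Model E F E', f.Fiber⟯) :
    mfderiv I' I f y (f.vec σ y) = A.anchor (f y) (e.symmL ℝ (f y) (f.coord e σ y)) := by
  rw [symmL_coord hy, vec, mfderiv_fst]

theorem eventually_mem_baseSet {y : N} (hy : f y ∈ e.baseSet) : ∀ᶠ z in 𝓝 y, f z ∈ e.baseSet :=
  f.contMDiff.continuous.continuousAt.preimage_mem_nhds (e.open_baseSet.mem_nhds hy)

theorem contMDiffAt_bracketIn {y : N} (hy : f y ∈ e.baseSet)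
    (σ τ : Cₛ^∞⟮I'; Model E F E', f.Fiber⟯) :
    ContMDiffAt I' 𝓘(ℝ, F) ∞ (f.bracketIn e σ τ) y :=
  ((contMDiffAt_mvfderiv_apply (contMDiffAt_coord hy τ) (contMDiffAt_vec σ y)).sub
    (contMDiffAt_mvfderiv_apply (contMDiffAt_coord hy σ) (contMDiffAt_vec τ y))).add
    ((((A.contMDiffAt_struct e hy).comp y f.contMDiff.contMDiffAt).clm_apply
      (contMDiffAt_coord hy σ)).clm_apply (contMDiffAt_coord hy τ))

/-- Derivative of `y ↦ L (f y) (coord σ y)` in the direction of a section. -/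
theorem mvfderiv_comp_coord {P : Type*} [NormedAddCommGroup P] [NormedSpace ℝ P]
    {L : M → F →L[ℝ] P} {y : N} (hy : f y ∈ e.baseSet)
    (hL : ContMDiffAt I 𝓘(ℝ, F →L[ℝ] P) ∞ L (f y)) (σ τ : Cₛ^∞⟮I'; Model E F E', f.Fiber⟯) :
    mvfderiv I' (fun z ↦ L (f z) (f.coord e σ z)) y (f.vec τ y) =
      mvfderiv I L (f y) (A.anchor (f y) (e.symmL ℝ (f y) (f.coord e τ y))) (f.coord e σ y) +
      L (f y) (mvfderiv I' (f.coord e σ) y (f.vec τ y)) := by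
  have hf := f.contMDiff.contMDiffAt (x := y)
  rw [mvfderiv_clm_apply (L := fun z ↦ L (f z)) ((hL.comp y hf).mdifferentiableAt (by simp))
    ((contMDiffAt_coord hy σ).mdifferentiableAt (by simp)),
    mvfderiv_comp_apply' (hL.mdifferentiableAt (by simp)) (hf.mdifferentiableAt (by simp)),
    mfderiv_vec hy]

theorem transition_bracketIn {y : N} (hy : f y ∈ e.baseSet) (hy' : f y ∈ e'.baseSet)
    (σ τ : Cₛ^∞⟮I'; Model E F E', f.Fiber⟯) :
    transition e e' (f y) (f.bracketIn e σ τ y) = f.bracketIn e' σ τ y := by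
  have hT := contMDiffAt_transition I e e' hy hy'
  have h1 (σ : Cₛ^∞⟮I'; Model E F E', f.Fiber⟯) :
      f.coord e' σ =ᶠ[𝓝 y] fun z ↦ transition e e' (f z) (f.coord e σ z) := by
    filter_upwards [eventually_mem_baseSet hy] with z hz
    rw [transition, ContinuousLinearMap.comp_apply, symmL_coord hz]
    rfl
  rw [bracketIn, bracketIn, mvfderiv_congr (h1 τ), mvfderiv_congr (h1 σ), (h1 σ).self_of_nhds,
    (h1 τ).self_of_nhds, mvfderiv_comp_coord hy hT, mvfderiv_comp_coord hy hT, map_add, map_sub,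
    A.struct_transition e e' hy hy']
  abel

theorem mfderiv_mlieBracket {y : N} (hy : f y ∈ e.baseSet)
    (σ τ : Cₛ^∞⟮I'; Model E F E', f.Fiber⟯) :
    mfderiv I' I f y (mlieBracket I' (f.vec σ) (f.vec τ) y) =
      A.anchor (f y) (e.symmL ℝ (f y) (f.bracketIn e σ τ y)) := by
  have : CompleteSpace E' := FiniteDimensional.complete ℝ E'
  have : IsManifold I 1 M := .of_le (n := ∞) (by simp)
  let h : M → E := extChartAt I (f y)
  have hh : ContMDiffAt I 𝓘(ℝ, E) ∞ h (f y) := contMDiffAt_extChartAt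
  have hf := f.contMDiff.contMDiffAt (x := y)
  have hk : ContMDiffAt I' 𝓘(ℝ, E) ∞ (fun z ↦ h (f z)) y := hh.comp y hf
  have hR := A.contMDiffAt_anchorIn e hh hy
  have h1 (σ : Cₛ^∞⟮I'; Model E F E', f.Fiber⟯) :
      (fun z ↦ mvfderiv I' (fun z ↦ h (f z)) z (f.vec σ z)) =ᶠ[𝓝 y]
        fun z ↦ A.anchorIn e h (f z) (f.coord e σ z) := by
    have h2 : ∀ᶠ z in 𝓝 y, f z ∈ (chartAt H (f y)).source :=
      f.contMDiff.continuous.continuousAt.preimage_mem_nhds (chart_source_mem_nhds H (f y))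
    filter_upwards [h2, eventually_mem_baseSet hy] with z hz hz'
    rw [mvfderiv_comp_apply' ((contMDiffAt_extChartAt' hz).mdifferentiableAt one_ne_zero)
      (f.contMDiff.contMDiffAt.mdifferentiableAt (by simp)), mfderiv_vec hz']
    rfl
  have h3 : mvfderiv I h (f y) (mfderiv I' I f y (mlieBracket I' (f.vec σ) (f.vec τ) y)) =
      mvfderiv I h (f y) (A.anchor (f y) (e.symmL ℝ (f y) (f.bracketIn e σ τ y))) := by
    rw [← mvfderiv_comp_apply' (hh.mdifferentiableAt (by simp)) (hf.mdifferentiableAt (by simp)),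
      mvfderiv_mlieBracket hk (contMDiffAt_vec σ y) (contMDiffAt_vec τ y),
      mvfderiv_congr (h1 τ), mvfderiv_congr (h1 σ), mvfderiv_comp_coord hy hR,
      mvfderiv_comp_coord hy hR]
    change _ = A.anchorIn e h (f y) (f.bracketIn e σ τ y)
    rw [bracketIn, map_add, map_sub, A.struct_anchorIn e hh hy]
    abel
  have hid (w : TangentSpace I (f y)) : mvfderiv I h (f y) w = w :=
    DFunLike.congr_fun (mfderiv_extChartAt_self (I := I) (x := f y)) w
  rw [hid, hid] at h3
  exact h3

/-! The bracket of `f^! A`. -/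

theorem contMDiffAt_mlieBracket_vec (σ τ : Cₛ^∞⟮I'; Model E F E', f.Fiber⟯) (y : N) :
    ContMDiffAt I' I'.tangent ∞
      (fun y ↦ (⟨y, mlieBracket I' (f.vec σ) (f.vec τ) y⟩ : TangentBundle I' N)) y := by
  have : CompleteSpace E' := FiniteDimensional.complete ℝ E'
  have : IsManifold I' (minSmoothness ℝ 2) N := .of_le (n := ∞) (by simpa using two_le_infty)
  have : IsManifold I' (((⊤ : ℕ∞) : WithTop ℕ∞) + 1) N := .of_le (n := ∞) (by simp)
  exact ContMDiffAt.mlieBracket_vectorField (m := ⊤) (n := ⊤) (contMDiffAt_vec σ y)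
    (contMDiffAt_vec τ y) (by simp)

variable (f) in
/-- The value at `y` of the bracket of two sections of `f^! A`. -/
def bracketVal (σ τ : Cₛ^∞⟮I'; Model E F E', f.Fiber⟯) (y : N) : f.Fiber y :=
  f.fiberMk (mlieBracket I' (f.vec σ) (f.vec τ) y)
    ((f.trivA y).symmL ℝ (f y) (f.bracketIn (f.trivA y) σ τ y))
    (mfderiv_mlieBracket (f.mem_preBase y).2.1 σ τ)

theorem snd_bracketVal {y : N} (hy : f y ∈ e.baseSet) (σ τ : Cₛ^∞⟮I'; Model E F E', f.Fiber⟯) :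
    f.snd y (f.bracketVal σ τ y) = e.symmL ℝ (f y) (f.bracketIn e σ τ y) := by
  have h := (f.mem_preBase y).2.1
  rw [← transition_bracketIn (e := f.trivA y) h hy, transition, ContinuousLinearMap.comp_apply,
    e.symmL_continuousLinearMapAt hy]
  rfl

theorem contMDiff_bracketVal (σ τ : Cₛ^∞⟮I'; Model E F E', f.Fiber⟯) :
    ContMDiff I' (I'.prod 𝓘(ℝ, Model E F E')) ∞
      (fun y ↦ (⟨y, f.bracketVal σ τ y⟩ : TotalSpace (Model E F E') f.Fiber)) := by
  intro y
  have hy := (f.mem_preBase y).2.1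
  refine f.contMDiffAt_of_components (contMDiffAt_mlieBracket_vec σ τ y) ?_
  refine (contMDiffAt_symmL (f.trivA y) f.contMDiff.contMDiffAt
    (contMDiffAt_bracketIn hy σ τ) hy).congr_of_eventuallyEq ?_
  filter_upwards [eventually_mem_baseSet hy] with z hz
  rw [snd_bracketVal hz]

variable (f) in
/-- The bracket of two sections of `f^! A`. -/
def bracketSection (σ τ : Cₛ^∞⟮I'; Model E F E', f.Fiber⟯) : Cₛ^∞⟮I'; Model E F E', f.Fiber⟯ :=
  ⟨f.bracketVal σ τ, contMDiff_bracketVal σ τ⟩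

theorem vec_bracketSection (σ τ : Cₛ^∞⟮I'; Model E F E', f.Fiber⟯) :
    f.vec (f.bracketSection σ τ) = mlieBracket I' (f.vec σ) (f.vec τ) := rfl

theorem coord_bracketSection {y : N} (hy : f y ∈ e.baseSet)
    (σ τ : Cₛ^∞⟮I'; Model E F E', f.Fiber⟯) :
    f.coord e (f.bracketSection σ τ) y = f.bracketIn e σ τ y := by
  rw [coord]
  change e.continuousLinearMapAt ℝ (f y) (f.snd y (f.bracketVal σ τ y)) = _
  rw [snd_bracketVal hy, e.continuousLinearMapAt_symmL hy]

theorem section_ext {σ τ : Cₛ^∞⟮I'; Model E F E', f.Fiber⟯} (h₁ : ∀ y, f.vec σ y = f.vec τ y)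
    (h₂ : ∀ y, f.coord (f.trivA y) σ y = f.coord (f.trivA y) τ y) : σ = τ := by
  ext y
  refine fiber_ext (h₁ y) ?_
  have hy := (f.mem_preBase y).2.1
  rw [← symmL_coord hy, ← symmL_coord hy, h₂]

theorem vec_add (σ τ : Cₛ^∞⟮I'; Model E F E', f.Fiber⟯) : f.vec (σ + τ) = f.vec σ + f.vec τ := by
  ext y; exact map_add _ _ _

theorem vec_smul (r : ℝ) (σ : Cₛ^∞⟮I'; Model E F E', f.Fiber⟯) :
    f.vec (r • σ) = r • f.vec σ := by
  ext y; exact (f.fst y).map_smul r (σ y)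

theorem coord_add (σ τ : Cₛ^∞⟮I'; Model E F E', f.Fiber⟯) :
    f.coord e (σ + τ) = f.coord e σ + f.coord e τ := by
  ext y; simp [coord]

theorem coord_smul (r : ℝ) (σ : Cₛ^∞⟮I'; Model E F E', f.Fiber⟯) :
    f.coord e (r • σ) = r • f.coord e σ := by
  ext y; simp [coord]

theorem vec_neg (σ : Cₛ^∞⟮I'; Model E F E', f.Fiber⟯) : f.vec (-σ) = -f.vec σ := by
  ext y; exact map_neg _ _

theorem coord_neg (σ : Cₛ^∞⟮I'; Model E F E', f.Fiber⟯) : f.coord e (-σ) = -f.coord e σ := by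
  ext y; simp [coord]

theorem bracketSection_swap (σ τ : Cₛ^∞⟮I'; Model E F E', f.Fiber⟯) :
    f.bracketSection σ τ = -f.bracketSection τ σ := by
  refine section_ext (fun y ↦ ?_) fun y ↦ ?_
  · rw [vec_neg, vec_bracketSection, vec_bracketSection, mlieBracket_swap]
  · have hy := (f.mem_preBase y).2.1
    rw [coord_neg, Pi.neg_apply, coord_bracketSection hy, coord_bracketSection hy, bracketIn,
      bracketIn, A.struct_swap]
    abel

theorem bracketSection_self (σ : Cₛ^∞⟮I'; Model E F E', f.Fiber⟯) :
    f.bracketSection σ σ = 0 := by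
  have h := bracketSection_swap σ σ
  have h2 : (2 : ℝ) • f.bracketSection σ σ = 0 := by
    rw [two_smul]
    nth_rewrite 2 [h]
    exact add_neg_cancel _
  have h3 := congrArg (fun s ↦ (2 : ℝ)⁻¹ • s) h2
  simpa only [smul_smul, smul_zero, inv_mul_cancel₀ (two_ne_zero (α := ℝ)), one_smul] using h3

theorem bracketSection_add_right (σ τ υ : Cₛ^∞⟮I'; Model E F E', f.Fiber⟯) :
    f.bracketSection σ (τ + υ) = f.bracketSection σ τ + f.bracketSection σ υ := by
  have : CompleteSpace E' := FiniteDimensional.complete ℝ E'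
  have : IsManifold I' 2 N := .of_le (n := ∞) two_le_infty
  refine section_ext (fun y ↦ ?_) fun y ↦ ?_
  · rw [vec_add]
    simp only [vec_bracketSection, Pi.add_apply]
    rw [vec_add, mlieBracket_add_right ((contMDiffAt_vec τ y).mdifferentiableAt (by simp))
      ((contMDiffAt_vec υ y).mdifferentiableAt (by simp))]
  · have hy := (f.mem_preBase y).2.1
    have h1 : mvfderiv I' (f.coord (f.trivA y) (τ + υ)) y =
        mvfderiv I' (f.coord (f.trivA y) τ) y + mvfderiv I' (f.coord (f.trivA y) υ) y := by
      rw [coord_add, mvfderiv_add ((contMDiffAt_coord hy τ).mdifferentiableAt (by simp))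
        ((contMDiffAt_coord hy υ).mdifferentiableAt (by simp))]
    rw [coord_add, Pi.add_apply, coord_bracketSection hy, coord_bracketSection hy,
      coord_bracketSection hy, bracketIn, h1, coord_add, vec_add]
    simp only [Pi.add_apply, map_add, add_apply, bracketIn]
    abel

theorem bracketSection_smul_right (r : ℝ) (σ τ : Cₛ^∞⟮I'; Model E F E', f.Fiber⟯) :
    f.bracketSection σ (r • τ) = r • f.bracketSection σ τ := by
  have : CompleteSpace E' := FiniteDimensional.complete ℝ E'
  have : IsManifold I' 2 N := .of_le (n := ∞) two_le_infty
  refine section_ext (fun y ↦ ?_) fun y ↦ ?_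
  · rw [vec_smul]
    simp only [vec_bracketSection, Pi.smul_apply]
    rw [vec_smul, mlieBracket_const_smul_right ((contMDiffAt_vec τ y).mdifferentiableAt (by simp))]
  · have hy := (f.mem_preBase y).2.1
    have h1 : mvfderiv I' (f.coord (f.trivA y) (r • τ)) y (f.vec σ y) =
        r • mvfderiv I' (f.coord (f.trivA y) τ) y (f.vec σ y) := by
      rw [coord_smul]
      exact mvfderiv_clm_comp (r • ContinuousLinearMap.id ℝ F)
        ((contMDiffAt_coord hy τ).mdifferentiableAt (by simp)) _
    rw [coord_smul, Pi.smul_apply, coord_bracketSection hy,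
      coord_bracketSection hy, bracketIn, h1, coord_smul, vec_smul]
    simp only [Pi.smul_apply, map_smul, bracketIn, smul_add, smul_sub]

variable (f) in
/-- The bracket of sections of `f^! A` as a bilinear map. -/
def bracket : Cₛ^∞⟮I'; Model E F E', f.Fiber⟯ →ₗ[ℝ] Cₛ^∞⟮I'; Model E F E', f.Fiber⟯ →ₗ[ℝ]
    Cₛ^∞⟮I'; Model E F E', f.Fiber⟯ :=
  LinearMap.mk₂ ℝ f.bracketSection
    (fun σ τ υ ↦ by
      rw [bracketSection_swap, bracketSection_add_right, bracketSection_swap υ,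
        bracketSection_swap υ]
      abel)
    (fun r σ τ ↦ by
      rw [bracketSection_swap, bracketSection_smul_right, bracketSection_swap τ, smul_neg, neg_neg])
    bracketSection_add_right bracketSection_smul_right

theorem mvfderiv_bracketIn {y : N} (hy : f y ∈ e.baseSet)
    (σ τ υ : Cₛ^∞⟮I'; Model E F E', f.Fiber⟯) :
    mvfderiv I' (f.bracketIn e τ υ) y (f.vec σ y) =
      mvfderiv I' (fun z ↦ mvfderiv I' (f.coord e υ) z (f.vec τ z)) y (f.vec σ y) -
      mvfderiv I' (fun z ↦ mvfderiv I' (f.coord e τ) z (f.vec υ z)) y (f.vec σ y) +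
      (mvfderiv I (A.struct e) (f y) (A.anchor (f y) (e.symmL ℝ (f y) (f.coord e σ y)))
          (f.coord e τ y) (f.coord e υ y) +
        A.struct e (f y) (mvfderiv I' (f.coord e τ) y (f.vec σ y)) (f.coord e υ y) +
        A.struct e (f y) (f.coord e τ y) (mvfderiv I' (f.coord e υ) y (f.vec σ y))) := by
  have hC := A.contMDiffAt_struct e hy
  have hCf : ContMDiffAt I' 𝓘(ℝ, F →L[ℝ] F →L[ℝ] F) ∞ (fun z ↦ A.struct e (f z)) y :=
    hC.comp y f.contMDiff.contMDiffAt
  have h1 := (contMDiffAt_mvfderiv_apply (contMDiffAt_coord hy υ)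
    (contMDiffAt_vec τ y)).mdifferentiableAt (by simp)
  have h2 := (contMDiffAt_mvfderiv_apply (contMDiffAt_coord hy τ)
    (contMDiffAt_vec υ y)).mdifferentiableAt (by simp)
  have h3 := hCf.clm_apply (contMDiffAt_coord hy τ)
  have h4 := h3.clm_apply (contMDiffAt_coord hy υ)
  have h5 : f.bracketIn e τ υ = ((fun z ↦ mvfderiv I' (f.coord e υ) z (f.vec τ z)) -
      (fun z ↦ mvfderiv I' (f.coord e τ) z (f.vec υ z))) +
      (fun z ↦ A.struct e (f z) (f.coord e τ z) (f.coord e υ z)) := rfl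
  rw [h5, mvfderiv_add (h1.sub h2) (h4.mdifferentiableAt (by simp)), mvfderiv_sub h1 h2]
  have h6 := mvfderiv_clm_apply (L := fun z ↦ A.struct e (f z) (f.coord e τ z))
    (h3.mdifferentiableAt (by simp)) ((contMDiffAt_coord hy υ).mdifferentiableAt (by simp))
    (f.vec σ y)
  rw [mvfderiv_comp_coord hy hC] at h6
  exact congrArg (_ + ·) h6

theorem bracket_jacobi (σ τ υ : Cₛ^∞⟮I'; Model E F E', f.Fiber⟯) :
    f.bracketSection σ (f.bracketSection τ υ) =
      f.bracketSection (f.bracketSection σ τ) υ + f.bracketSection τ (f.bracketSection σ υ) := by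
  have : CompleteSpace E' := FiniteDimensional.complete ℝ E'
  refine section_ext (fun y ↦ ?_) fun y ↦ ?_
  · have : IsManifold I' (minSmoothness ℝ 3) N :=
      .of_le (n := ∞) (by simpa using (WithTop.coe_le_coe.2 le_top : (3 : WithTop ℕ∞) ≤ ∞))
    have h (σ : Cₛ^∞⟮I'; Model E F E', f.Fiber⟯) := (contMDiffAt_vec σ y).of_le
      (m := minSmoothness ℝ 2) (by simpa using two_le_infty)
    rw [vec_add]
    simp only [vec_bracketSection, Pi.add_apply]
    exact leibniz_identity_mlieBracket_apply (h σ) (h τ) (h υ)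
  · have hy := (f.mem_preBase y).2.1
    set e := f.trivA y with he
    have h1 (σ τ : Cₛ^∞⟮I'; Model E F E', f.Fiber⟯) :
        f.coord e (f.bracketSection σ τ) =ᶠ[𝓝 y] f.bracketIn e σ τ := by
      filter_upwards [eventually_mem_baseSet hy] with z hz
      exact coord_bracketSection hz σ τ
    have h2 (σ τ υ : Cₛ^∞⟮I'; Model E F E', f.Fiber⟯) :
        f.bracketIn e σ (f.bracketSection τ υ) y =
          mvfderiv I' (f.bracketIn e τ υ) y (f.vec σ y) -
          (mvfderiv I' (fun z ↦ mvfderiv I' (f.coord e σ) z (f.vec υ z)) y (f.vec τ y) -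
            mvfderiv I' (fun z ↦ mvfderiv I' (f.coord e σ) z (f.vec τ z)) y (f.vec υ y)) +
          A.struct e (f y) (f.coord e σ y) (f.bracketIn e τ υ y) := by
      rw [bracketIn, mvfderiv_congr (h1 τ υ), vec_bracketSection,
        mvfderiv_mlieBracket (contMDiffAt_coord hy σ) (contMDiffAt_vec τ y) (contMDiffAt_vec υ y),
        coord_bracketSection hy]
    rw [bracketSection_swap (f.bracketSection σ τ), coord_add, coord_neg]
    simp only [Pi.add_apply, Pi.neg_apply]
    rw [coord_bracketSection hy, coord_bracketSection hy, coord_bracketSection hy, h2, h2, h2,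
      mvfderiv_bracketIn hy, mvfderiv_bracketIn hy, mvfderiv_bracketIn hy]
    have h3 := A.struct_jacobi e hy (f.coord e σ y) (f.coord e τ y) (f.coord e υ y)
    simp only [bracketIn, map_add, map_sub]
    rw [A.struct_swap e _ (A.struct e _ _ _) (f.coord e υ y)] at h3
    rw [A.struct_swap e _ (mvfderiv I' (f.coord e τ) y (f.vec σ y)),
      A.struct_swap e _ (mvfderiv I' (f.coord e σ) y (f.vec υ y)),
      A.struct_swap e _ (mvfderiv I' (f.coord e σ) y (f.vec τ y))]
    linear_combination (norm := abel) h3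

end Bracket
end TransverseMap
end LieAlgebroid

namespace LieAlgebroid
namespace TransverseMap

section PullbackAlgebroid

variable {E : Type*} [NormedAddCommGroup E] [NormedSpace ℝ E] [FiniteDimensional ℝ E]
  {H : Type*} [TopologicalSpace H] {I : ModelWithCorners ℝ E H} [I.Boundaryless]
  {M : Type*} [TopologicalSpace M] [ChartedSpace H M] [IsManifold I ∞ M] [T2Space M]
  {F : Type*} [NormedAddCommGroup F] [NormedSpace ℝ F] [FiniteDimensional ℝ F]
  {V : M → Type*} [∀ x, AddCommGroup (V x)] [∀ x, Module ℝ (V x)]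
  [∀ x, TopologicalSpace (V x)] [TopologicalSpace (TotalSpace F V)]
  [FiberBundle F V] [VectorBundle ℝ F V] [ContMDiffVectorBundle ∞ F V I]
  {A : LieAlgebroid I F V}
  {E' : Type*} [NormedAddCommGroup E'] [NormedSpace ℝ E'] [FiniteDimensional ℝ E']
  {H' : Type*} [TopologicalSpace H'] {I' : ModelWithCorners ℝ E' H'} [I'.Boundaryless]
  {N : Type*} [TopologicalSpace N] [ChartedSpace H' N] [IsManifold I' ∞ N]
  (f : TransverseMap A I' N)
  (e e' : Trivialization F (TotalSpace.proj : TotalSpace F V → M))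
  [MemTrivializationAtlas e] [MemTrivializationAtlas e']

variable {f} in
theorem bracket_leibniz (σ τ υ : Cₛ^∞⟮I'; Model E F E', f.Fiber⟯) (g : C^∞⟮I', N; ℝ⟯)
    (h : ∀ y, υ y = g y • τ y) (y : N) :
    f.bracketSection σ υ y =
      g y • f.bracketSection σ τ y + (mvfderiv I' g y (f.fst y (σ y))) • τ y := by
  have : CompleteSpace E' := FiniteDimensional.complete ℝ E'
  have : IsManifold I' 2 N := .of_le (n := ∞) two_le_infty
  have hg : MDifferentiableAt I' 𝓘(ℝ, ℝ) g y := g.contMDiff.contMDiffAt.mdifferentiableAt (by simp)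
  have hv : f.vec υ = (g : N → ℝ) • f.vec τ := by
    ext y
    exact (congrArg (f.fst y) (h y)).trans ((f.fst y).map_smul _ _)
  have hy := (f.mem_preBase y).2.1
  set e := f.trivA y
  have hc : f.coord e υ = (g : N → ℝ) • f.coord e τ := by
    ext y
    simp [coord, h y]
  refine fiber_ext ?_ ?_
  · rw [map_add, map_smul, map_smul]
    change mlieBracket I' (f.vec σ) (f.vec υ) y = g y • mlieBracket I' (f.vec σ) (f.vec τ) y +
      mvfderiv I' g y (f.vec σ y) • f.vec τ y
    rw [hv, mlieBracket_smul_right hg ((contMDiffAt_vec τ y).mdifferentiableAt (by simp)), add_comm]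
  · rw [map_add, map_smul, map_smul]
    change e.symmL ℝ (f y) (f.bracketIn e σ υ y) = g y • e.symmL ℝ (f y) (f.bracketIn e σ τ y) +
      mvfderiv I' g y (f.vec σ y) • f.snd y (τ y)
    have h1 : mvfderiv I' (f.coord e υ) y (f.vec σ y) =
        g y • mvfderiv I' (f.coord e τ) y (f.vec σ y) +
          mvfderiv I' g y (f.vec σ y) • f.coord e τ y := by
      rw [hc, mvfderiv_smul hg ((contMDiffAt_coord hy τ).mdifferentiableAt (by simp))]
      rfl
    rw [← symmL_coord hy, ← map_smul, ← map_smul, ← map_add]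
    congr 1
    rw [bracketIn, h1, hc, hv]
    simp only [Pi.smul_apply', map_smul, bracketIn, smul_add, smul_sub]
    abel

/-- The pullback `f^! A` of the Lie algebroid `A` along the transverse map `f`. -/
def pullback : LieAlgebroid I' (Model E F E') f.Fiber where
  anchor := f.fst
  contMDiff_anchor := f.contMDiff_anchor
  bracket := f.bracket
  bracket_self := bracketSection_self
  jacobi := bracket_jacobi
  anchor_bracket _ _ _ := rfl
  leibniz := bracket_leibniz

end PullbackAlgebroid
end TransverseMap
end LieAlgebroid

namespace LieAlgebroid

namespace TransverseMap

section Related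

variable {E : Type*} [NormedAddCommGroup E] [NormedSpace ℝ E] [FiniteDimensional ℝ E]
  {H : Type*} [TopologicalSpace H] {I : ModelWithCorners ℝ E H} [I.Boundaryless]
  {M : Type*} [TopologicalSpace M] [ChartedSpace H M] [IsManifold I ∞ M] [T2Space M]
  {F : Type*} [NormedAddCommGroup F] [NormedSpace ℝ F] [FiniteDimensional ℝ F]
  {V : M → Type*} [∀ x, AddCommGroup (V x)] [∀ x, Module ℝ (V x)]
  [∀ x, TopologicalSpace (V x)] [TopologicalSpace (TotalSpace F V)]
  [FiberBundle F V] [VectorBundle ℝ F V] [ContMDiffVectorBundle ∞ F V I]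
  {A : LieAlgebroid I F V}
  {E' : Type*} [NormedAddCommGroup E'] [NormedSpace ℝ E'] [FiniteDimensional ℝ E']
  {H' : Type*} [TopologicalSpace H'] {I' : ModelWithCorners ℝ E' H'} [I'.Boundaryless]
  {N : Type*} [TopologicalSpace N] [ChartedSpace H' N] [IsManifold I' ∞ N]
  (f : TransverseMap A I' N)

/-- The canonical map `f^! A → A` over `f` is compatible with brackets: if sections `σ, τ` of
`f^! A` project to sections `a, b` of `A` near `y`, then `[σ, τ]` projects to `[a, b]` at `y`. -/
theorem snd_pullback_bracket {σ τ : Cₛ^∞⟮I'; Model E F E', f.Fiber⟯} {a b : Cₛ^∞⟮I; F, V⟯} {y : N}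
    (hσ : ∀ᶠ z in 𝓝 y, f.snd z (σ z) = a (f z)) (hτ : ∀ᶠ z in 𝓝 y, f.snd z (τ z) = b (f z)) :
    f.snd y (f.pullback.bracket σ τ y) = A.bracket a b (f y) := by
  have hy := (f.mem_preBase y).2.1
  have hf := f.contMDiff.contMDiffAt (x := y)
  have h1 {σ : Cₛ^∞⟮I'; Model E F E', f.Fiber⟯} {a : Cₛ^∞⟮I; F, V⟯}
      (hσ : ∀ᶠ z in 𝓝 y, f.snd z (σ z) = a (f z)) : f.coord (f.trivA y) σ =ᶠ[𝓝 y]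
        fun z ↦ (f.trivA y).continuousLinearMapAt ℝ (f z) (a (f z)) := by
    filter_upwards [hσ] with z hz
    rw [coord, hz]
  have h2 (a : Cₛ^∞⟮I; F, V⟯) (u : TangentSpace I' y) : mvfderiv I'
      (fun z ↦ (f.trivA y).continuousLinearMapAt ℝ (f z) (a (f z))) y u = mvfderiv I
        (fun z ↦ (f.trivA y).continuousLinearMapAt ℝ z (a z)) (f y) (mfderiv I' I f y u) :=
    mvfderiv_comp_apply' ((contMDiffAt_coord_section (f.trivA y) a hy).mdifferentiableAt (by simp))
      (hf.mdifferentiableAt (by simp)) u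
  have h3 : f.bracketIn (f.trivA y) σ τ y =
      (f.trivA y).continuousLinearMapAt ℝ (f y) (A.bracket a b (f y)) := by
    rw [A.bracket_expand (f.trivA y) a b hy, bracketIn, mvfderiv_congr (h1 hσ),
      mvfderiv_congr (h1 hτ), h2, h2, vec, vec, mfderiv_fst, mfderiv_fst, hσ.self_of_nhds,
      hτ.self_of_nhds, (h1 hσ).self_of_nhds, (h1 hτ).self_of_nhds]
  exact (congrArg _ h3).trans ((f.trivA y).symmL_continuousLinearMapAt hy _)

end Related

end TransverseMap

section VectorBundleProjection

variable {E : Type*} [NormedAddCommGroup E] [NormedSpace ℝ E]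
  {H : Type*} [TopologicalSpace H] {I : ModelWithCorners ℝ E H}
  {X : Type*} [TopologicalSpace X] [ChartedSpace H X] [IsManifold I ∞ X]
  {F : Type*} [NormedAddCommGroup F] [NormedSpace ℝ F]
  {V : X → Type*} [∀ x, AddCommGroup (V x)] [∀ x, Module ℝ (V x)]
  [∀ x, TopologicalSpace (V x)] [TopologicalSpace (TotalSpace F V)]
  [FiberBundle F V] [VectorBundle ℝ F V] [ContMDiffVectorBundle ∞ F V I]
  (B : LieAlgebroid I F V)
  (G : Type*) [NormedAddCommGroup G] [NormedSpace ℝ G]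
  (W : X → Type*) [∀ x, AddCommGroup (W x)] [∀ x, Module ℝ (W x)]
  [∀ x, TopologicalSpace (W x)] [TopologicalSpace (TotalSpace G W)]
  [FiberBundle G W] [VectorBundle ℝ G W] [ContMDiffVectorBundle ∞ G W I]

variable (I) in
theorem mfderiv_proj_section {s : X → TotalSpace G W} {x : X}
    (hs : ContMDiffAt I (I.prod 𝓘(ℝ, G)) ∞ s x) (h : ∀ z, (s z).proj = z)
    (u : TangentSpace I x) :
    mfderiv (I.prod 𝓘(ℝ, G)) I (TotalSpace.proj : TotalSpace G W → X) (s x)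
      (mfderiv I (I.prod 𝓘(ℝ, G)) s x u) = u := by
  have h1 := mfderiv_comp_apply (I := I) (I' := I.prod 𝓘(ℝ, G)) (I'' := I) x
    (g := (TotalSpace.proj : TotalSpace G W → X)) (f := s)
    ((Bundle.contMDiff_proj W (n := ∞)).contMDiffAt.mdifferentiableAt (by simp))
    (hs.mdifferentiableAt (by simp)) u
  have h2 : (TotalSpace.proj : TotalSpace G W → X) ∘ s = id := funext h
  rw [← h1, h2, mfderiv_id]
  rfl

/-- The projection `p : W → X` of a vector bundle is a submersion, hence transverse to every
Lie algebroid on `X`. -/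
def bundleProj : TransverseMap B (I.prod 𝓘(ℝ, G)) (TotalSpace G W) where
  toFun := TotalSpace.proj
  contMDiff := Bundle.contMDiff_proj W
  transverse p := by
    obtain ⟨x, w⟩ := p
    have hx : x ∈ (trivializationAt G W x).baseSet := FiberBundle.mem_baseSet_trivializationAt' x
    let s : X → TotalSpace G W := fun z ↦ ⟨z, (trivializationAt G W x).symmL ℝ z
      ((trivializationAt G W x).continuousLinearMapAt ℝ x w)⟩
    have hs : ContMDiffAt I (I.prod 𝓘(ℝ, G)) ∞ s x :=
      contMDiffAt_symmL (trivializationAt G W x) (f := id) contMDiffAt_id contMDiffAt_const hx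
    have hsx : s x = ⟨x, w⟩ :=
      congrArg (TotalSpace.mk x) ((trivializationAt G W x).symmL_continuousLinearMapAt hx w)
    rw [eq_top_iff, ← hsx]
    intro u _
    exact Submodule.mem_sup_left ⟨_, mfderiv_proj_section I G W hs (fun _ ↦ rfl) u⟩

/-- The canonical inclusion `B → p^! B` over the zero section of the vector bundle `p : W → X`:
`c ∈ B_x` is sent to `(d0 (ρ c), c)`. -/
def inclZero (x : X) (c : V x) : (B.bundleProj G W).Fiber (zeroSection G W x) :=
  (B.bundleProj G W).fiberMk (y := zeroSection G W x)
    (mfderiv I (I.prod 𝓘(ℝ, G)) (zeroSection G W) x (B.anchor x c)) c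
    (mfderiv_proj_section I G W (Bundle.contMDiff_zeroSection ℝ W).contMDiffAt (fun _ ↦ rfl) _)

end VectorBundleProjection

section Isomorphism

variable {E : Type*} [NormedAddCommGroup E] [NormedSpace ℝ E]
  {H : Type*} [TopologicalSpace H] {I : ModelWithCorners ℝ E H}
  {M : Type*} [TopologicalSpace M] [ChartedSpace H M] [IsManifold I ∞ M]
  {F : Type*} [NormedAddCommGroup F] [NormedSpace ℝ F]
  {V : M → Type*} [∀ x, AddCommGroup (V x)] [∀ x, Module ℝ (V x)]
  [∀ x, TopologicalSpace (V x)] [TopologicalSpace (TotalSpace F V)]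
  [FiberBundle F V] [VectorBundle ℝ F V] [ContMDiffVectorBundle ∞ F V I]
  {E' : Type*} [NormedAddCommGroup E'] [NormedSpace ℝ E']
  {H' : Type*} [TopologicalSpace H'] {I' : ModelWithCorners ℝ E' H'}
  {N : Type*} [TopologicalSpace N] [ChartedSpace H' N] [IsManifold I' ∞ N]
  {F' : Type*} [NormedAddCommGroup F'] [NormedSpace ℝ F']
  {V' : N → Type*} [∀ x, AddCommGroup (V' x)] [∀ x, Module ℝ (V' x)]
  [∀ x, TopologicalSpace (V' x)] [TopologicalSpace (TotalSpace F' V')]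
  [FiberBundle F' V'] [VectorBundle ℝ F' V'] [ContMDiffVectorBundle ∞ F' V' I']

/-- `(Φ, φ)` is an isomorphism of Lie algebroids from `B|_U` onto `A|_{φ(U)}`, where `U` is an open
subset of the base `N` of `B`: the base map `φ` is a diffeomorphism from `U` onto the open set
`φ(U)`, and `Φ` is over `U` a smooth vector bundle isomorphism covering `φ`, compatible with anchors
and brackets.

Brackets of Lie algebroids are local, and every local section has near a given point the germ of a
global one. Compatibility with brackets is therefore expressed through global sections which
correspond to each other under `Φ` near a given point of `U`. The values of `φ` and `Φ`
outside `U` play no role. -/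
structure IsIsoOn (B : LieAlgebroid I' F' V') (A : LieAlgebroid I F V) (U : Set N) (φ : N → M)
    (Φ : ∀ y, V' y →ₗ[ℝ] V (φ y)) : Prop where
  isOpen : IsOpen U
  injOn : InjOn φ U
  isLocalDiffeomorphOn : IsLocalDiffeomorphOn I' I ∞ φ U
  contMDiffOn : ContMDiffOn (I'.prod 𝓘(ℝ, F')) (I.prod 𝓘(ℝ, F)) ∞
    (fun b : TotalSpace F' V' ↦ (⟨φ b.proj, Φ b.proj b.2⟩ : TotalSpace F V))
    (TotalSpace.proj ⁻¹' U)
  bijective : ∀ y ∈ U, Function.Bijective (Φ y)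
  anchor : ∀ y ∈ U, ∀ b : V' y, mfderiv I' I φ y (B.anchor y b) = A.anchor (φ y) (Φ y b)
  bracket : ∀ y ∈ U, ∀ (b₁ b₂ : Cₛ^∞⟮I'; F', V'⟯) (a₁ a₂ : Cₛ^∞⟮I; F, V⟯),
    (∀ᶠ z in 𝓝 y, Φ z (b₁ z) = a₁ (φ z)) → (∀ᶠ z in 𝓝 y, Φ z (b₂ z) = a₂ (φ z)) →
    Φ y (B.bracket b₁ b₂ y) = A.bracket a₁ a₂ (φ y)

end Isomorphism

end LieAlgebroid

/-- A tubular neighborhood of `i : X → M`: a smooth vector bundle `p : W → X` together with a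
diffeomorphism of its total space onto an open subset of `M` which restricts to `i` on
the zero section. -/
structure TubularNeighborhood
    {E : Type*} [NormedAddCommGroup E] [NormedSpace ℝ E]
    {H : Type*} [TopologicalSpace H] (I : ModelWithCorners ℝ E H)
    {M : Type*} [TopologicalSpace M] [ChartedSpace H M]
    {E' : Type*} [NormedAddCommGroup E'] [NormedSpace ℝ E']
    {H' : Type*} [TopologicalSpace H'] (I' : ModelWithCorners ℝ E' H')
    {X : Type*} [TopologicalSpace X] [ChartedSpace H' X] (i : X → M)
    (G : Type*) [NormedAddCommGroup G] [NormedSpace ℝ G]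
    (W : X → Type*) [∀ x, AddCommGroup (W x)] [∀ x, Module ℝ (W x)]
    [∀ x, TopologicalSpace (W x)] [TopologicalSpace (TotalSpace G W)]
    [FiberBundle G W] [VectorBundle ℝ G W] [ContMDiffVectorBundle ∞ G W I'] where
  toFun : TotalSpace G W → M
  isLocalDiffeomorph : IsLocalDiffeomorph (I'.prod 𝓘(ℝ, G)) I ∞ toFun
  injective : Function.Injective toFun
  toFun_zero : ∀ x, toFun (zeroSection G W x) = i x

end

/-! Write `W` for the bundle of the tubular neighborhood, `p` for its projection and `ρ` for the
anchor. Choose sections `a_w` of `A`, depending smoothly on `w ∈ W` and linearly on `w` along the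
fibres, such that along `X` the vector `ρ(a_w)` agrees, up to vectors tangent to `X`, with the
normal velocity that `ψ` attaches to `w`. Transversality gives such lifts locally, and a partition
of unity glues them (`TubularNeighborhood.exists_transverseFamily`). Let `φ_t(w)` be the point
reached at time `t` from `i(p w)` along the vector field `ρ(a_w)`. Since `a` vanishes on the zero
section, `φ_t` restricts to `i` there. Its derivative at time 1 sends a tangent vector `v` of `X`
and a vertical vector `y` to `di v + ρ(a_y)`, which is an isomorphism. So `φ = φ_1` is a local
diffeomorphism near `X`, and injective on a smaller neighborhood (`exists_isOpen_injOn`).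

To lift `φ` to algebroids, take `(u, c)` with `d(i ∘ p) u = ρ(c)`; these pairs form the fibres of
`p^! i^! A`. Transport `c` along `t ↦ φ_t(w)` by the linear equation which in a frame reads `∂_t β =
∂_u α - C(α, β)`, where `α = a_w(φ_t w)`, `C` is the bracket of constant sections and `β(0) = c`.
This is the Maurer-Cartan equation for `α dt + β`: it makes `T ℝ × p^! i^! A → A` a morphism over
`(t, w) ↦ φ_t(w)`. The anchor condition `dφ_t(u) = ρ(β)` holds because both sides solve the
linearized flow equation (`LocalFamily.IsSolution.fderiv_m`). For brackets, the bracket of two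
transported sections solves the transport equation of the bracket of their initial data, by the
Jacobi identity (`LocalFamily.IsSolution.Ψ_bracket`). In both cases the initial values agree, and
linear equations have unique solutions. Over the zero section the transport at time 1 is `(u, c) ↦ c
+ a_y` with `y` the vertical part of `u`. It is therefore bijective on fibres there, hence nearby,
and it extends the canonical map `i^! A → A`, where `y = 0`.

All computations take place in charts (`LocalFamily`). Linearity of `a` in the fibre trades a short
time of existence for a smaller fibre coordinate, so that time 1 is reached near the zero section.
The transport equation has the same form in every trivialization and unique solutions
(`TransverseFamily.IsTransport.eq_localTransport`), so the local constructions agree on overlaps. -/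

/-! ### Smooth superposition operators on spaces of continuous functions. -/

section Superposition

set_option synthInstance.maxHeartbeats 200000

universe u

variable {K : Type*} [TopologicalSpace K] [CompactSpace K]
  {S F : Type u} [NormedAddCommGroup S] [NormedSpace ℝ S]
  [NormedAddCommGroup F] [NormedSpace ℝ F]

/-- A continuous bilinear map, applied pointwise to continuous functions. -/
noncomputable def ContinuousMap.bilin {T S F : Type*} [NormedAddCommGroup T] [NormedSpace ℝ T]
    [NormedAddCommGroup S] [NormedSpace ℝ S] [NormedAddCommGroup F] [NormedSpace ℝ F]
    (B : T →L[ℝ] S →L[ℝ] F) : C(K, T) →L[ℝ] C(K, S) →L[ℝ] C(K, F) :=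
  LinearMap.mkContinuous₂
    (LinearMap.mk₂ ℝ (fun (L : C(K, T)) (γ : C(K, S)) ↦
        (⟨fun k ↦ B (L k) (γ k), (B.continuous.comp L.continuous).clm_apply γ.continuous⟩ : C(K, F)))
      (by intros; ext; simp) (by intros; ext; simp) (by intros; ext; simp) (by intros; ext; simp))
    ‖B‖ (fun L γ ↦ by
      refine (ContinuousMap.norm_le _ (by positivity)).2 fun k ↦ ?_
      refine (B.le_opNorm₂ _ _).trans ?_
      gcongr
      exacts [L.norm_coe_le_norm k, γ.norm_coe_le_norm k])

theorem ContinuousMap.contDiff_bilin {T S F : Type*} [NormedAddCommGroup T] [NormedSpace ℝ T]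
    [NormedAddCommGroup S] [NormedSpace ℝ S] [NormedAddCommGroup F] [NormedSpace ℝ F]
    (B : T →L[ℝ] S →L[ℝ] F) (n : WithTop ℕ∞) :
    ContDiff ℝ n (fun L : C(K, T) ↦ ContinuousMap.bilin B L) :=
  ContinuousLinearMap.contDiff (ContinuousMap.bilin (K := K) B)

/-- Pointwise application of a continuous family of linear maps to a continuous function. -/
noncomputable abbrev ContinuousMap.clmApply :
    C(K, S →L[ℝ] F) →L[ℝ] C(K, S) →L[ℝ] C(K, F) :=
  ContinuousMap.bilin (ContinuousLinearMap.id ℝ (S →L[ℝ] F))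

/-- Uniform continuity of `g'` gives one `δ` for all points `γ k`. The mean value inequality on the
ball of radius `δ` around `γ k` then bounds the remainder by `c ‖η k‖` uniformly in `k`. -/
theorem hasFDerivAt_comp_continuousMap {g : C(S, F)} {g' : C(S, S →L[ℝ] F)}
    (hg : ∀ x, HasFDerivAt g (g' x) x) (hu : UniformContinuous g') (γ : C(K, S)) :
    HasFDerivAt (fun γ : C(K, S) ↦ g.comp γ) (ContinuousMap.clmApply (g'.comp γ)) γ := by
  rw [hasFDerivAt_iff_isLittleO_nhds_zero, Asymptotics.isLittleO_iff]
  intro c hc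
  obtain ⟨δ, hδ, h⟩ := Metric.uniformContinuous_iff.1 hu c hc
  filter_upwards [Metric.ball_mem_nhds (0 : C(K, S)) hδ] with η hη
  refine (ContinuousMap.norm_le _ (by positivity)).2 fun k ↦ ?_
  have hk : ‖η k‖ < δ := (η.norm_coe_le_norm k).trans_lt (by simpa using hη)
  have h1 := (convex_ball (γ k) δ).norm_image_sub_le_of_norm_hasFDerivWithin_le' (f := g)
    (φ := g' (γ k)) (C := c) (x := γ k) (y := γ k + η k)
    (fun x _ ↦ (hg x).hasFDerivWithinAt)
    (fun x hx ↦ by rw [← dist_eq_norm]; exact (h hx).le)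
    (Metric.mem_ball_self hδ) (by simpa using hk)
  rw [add_sub_cancel_left] at h1
  exact h1.trans (mul_le_mul_of_nonneg_left (η.norm_coe_le_norm k) hc.le)

/-- Superposition with a smooth compactly supported function is smooth on spaces of continuous
functions. -/
theorem contDiff_comp_continuousMap (g : C(S, F)) (hg : ContDiff ℝ ∞ g)
    (hs : HasCompactSupport g) : ContDiff ℝ ∞ (fun γ : C(K, S) ↦ g.comp γ) := by
  rw [contDiff_infty]
  intro n
  -- The derivative of superposition with `g` is superposition with `fderiv ℝ g`, followed by
  -- pointwise application, which is bounded linear. Smoothness of one order more for `g` thus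
  -- follows from the previous order for `fderiv ℝ g`, again compactly supported but with values in
  -- `S →L[ℝ] F`. Hence the target varies in the induction, and `S` and `F` share a universe.
  induction n generalizing F with
  | zero =>
    exact contDiff_zero.2 (ContinuousMap.continuous_postcomp g)
  | succ n ih =>
    let g' : C(S, S →L[ℝ] F) := ⟨fderiv ℝ g, hg.continuous_fderiv (by simp)⟩
    have h1 : ContDiff ℝ ∞ g' := hg.fderiv_right (m := ∞) (by simp)
    have h2 : HasCompactSupport g' := hs.fderiv ℝ
    have h3 : ContDiff ℝ n (fun L : C(K, S →L[ℝ] F) ↦ ContinuousMap.clmApply L) :=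
      ContinuousMap.contDiff_bilin _ _
    push_cast
    rw [contDiff_succ_iff_hasFDerivAt]
    refine ⟨fun γ ↦ ContinuousMap.clmApply (g'.comp γ),
      h3.comp (ih g' h1 h2), fun γ ↦ ?_⟩
    exact hasFDerivAt_comp_continuousMap (fun x ↦ (hg.differentiable (by simp) x).hasFDerivAt)
      (h2.uniformContinuous_of_continuous g'.continuous) γ

end Superposition

/-! ### Smooth dependence of local flows on time and initial value. -/

section Flow

variable {S : Type*} [NormedAddCommGroup S] [NormedSpace ℝ S]

/-- The interval on which rescaled integral curves are parametrized. -/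
abbrev timeInterval : Type := Icc (-1 : ℝ) 1

theorem continuous_projIcc_comp (γ : C(timeInterval, S)) :
    Continuous fun s ↦ γ (projIcc (-1) 1 (by norm_num) s) :=
  γ.continuous.comp continuous_projIcc

/-- The primitive vanishing at `0` of a continuous function on `[-1, 1]`, as a linear map. -/
noncomputable def primitiveLin : C(timeInterval, S) →ₗ[ℝ] C(timeInterval, S) where
  toFun γ := ⟨fun t ↦ ∫ s in (0 : ℝ)..t, γ (projIcc (-1) 1 (by norm_num) s),
    (intervalIntegral.continuous_primitive (fun _ _ ↦
      (continuous_projIcc_comp γ).intervalIntegrable _ _) 0).comp continuous_subtype_val⟩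
  map_add' γ η := by
    ext t
    exact intervalIntegral.integral_add ((continuous_projIcc_comp γ).intervalIntegrable _ _)
      ((continuous_projIcc_comp η).intervalIntegrable _ _)
  map_smul' r γ := by
    ext t
    exact intervalIntegral.integral_smul r _

/-- The primitive vanishing at `0` of a continuous function on `[-1, 1]`. -/
noncomputable def primitive : C(timeInterval, S) →L[ℝ] C(timeInterval, S) :=
  primitiveLin.mkContinuous 1 fun γ ↦ by
    refine (ContinuousMap.norm_le (primitiveLin γ) (by positivity)).2 fun t ↦ ?_
    refine (intervalIntegral.norm_integral_le_of_norm_le_const (C := ‖γ‖)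
      (fun s _ ↦ γ.norm_coe_le_norm _)).trans ?_
    rw [mul_comm]
    have := abs_le.2 t.2
    gcongr
    simpa using this

/-- A smooth family of maps whose derivative in the second variable vanishes at a fixed point
has a smooth family of fixed points. -/
theorem exists_contDiffOn_fixedPoint {Q X : Type*} [NormedAddCommGroup Q] [NormedSpace ℝ Q]
    [NormedAddCommGroup X] [NormedSpace ℝ X] [CompleteSpace Q] [CompleteSpace X] {N : Q × X → X}
    (hN : ContDiff ℝ ∞ N) {q₀ : Q} {x₀ : X} (h₀ : N (q₀, x₀) = x₀) {l : Q →L[ℝ] X}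
    (hl : HasFDerivAt N (l ∘L ContinuousLinearMap.fst ℝ Q X) (q₀, x₀)) :
    ∃ O : Set Q, IsOpen O ∧ q₀ ∈ O ∧ ∃ Γ : Q → X, ContDiffOn ℝ ∞ Γ O ∧
      ∀ q ∈ O, Γ q = N (q, Γ q) := by
  let Θ : Q × X → Q × X := fun z ↦ (z.1, z.2 - N z)
  have hΘ : ContDiff ℝ ∞ Θ := contDiff_fst.prodMk (contDiff_snd.sub hN)
  -- The derivative of `Θ` at the base point is unipotent, `(q, x) ↦ (q, x - l q)`, hence invertible
  -- for every `l`. Fixed points at the parameter `q` are the preimages of `(q, 0)` under `Θ`.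
  let A : (Q × X) ≃L[ℝ] (Q × X) := ContinuousLinearEquiv.equivOfInverse
    ((ContinuousLinearMap.fst ℝ Q X).prod
      (ContinuousLinearMap.snd ℝ Q X - l ∘L ContinuousLinearMap.fst ℝ Q X))
    ((ContinuousLinearMap.fst ℝ Q X).prod
      (ContinuousLinearMap.snd ℝ Q X + l ∘L ContinuousLinearMap.fst ℝ Q X))
    (fun z ↦ by simp) (fun z ↦ by simp)
  have hA : HasFDerivAt Θ (A : Q × X →L[ℝ] Q × X) (q₀, x₀) :=
    hasFDerivAt_fst.prodMk (hasFDerivAt_snd.sub hl)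
  have hat := hΘ.contDiffAt (x := (q₀, x₀))
  let h := hat.toOpenPartialHomeomorph Θ hA (by simp)
  have hsrc : (q₀, x₀) ∈ h.source := hat.mem_toOpenPartialHomeomorph_source hA (by simp)
  have hval : Θ (q₀, x₀) = (q₀, 0) := by simp [Θ, h₀]
  have htgt : (q₀, (0 : X)) ∈ h.target := hval ▸ h.map_source hsrc
  have hinv : h.symm (q₀, 0) = (q₀, x₀) := by
    rw [← hval]
    exact h.left_inv hsrc
  -- Smoothness of the local inverse at a point needs an invertible derivative of `Θ` at its image
  -- under the inverse. This is an open condition, imposed here so that the fixed points are smooth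
  -- on a whole neighborhood.
  let T : Set (Q × X) := {z | fderiv ℝ Θ z ∈ range ((↑) : ((Q × X) ≃L[ℝ] (Q × X)) → _)}
  have hT : IsOpen T := ContinuousLinearEquiv.isOpen.preimage (hΘ.continuous_fderiv (by simp))
  have hT₀ : (q₀, x₀) ∈ T := ⟨A, hA.fderiv.symm⟩
  have hO : IsOpen (h.target ∩ h.symm ⁻¹' T) :=
    h.symm.isOpen_inter_preimage hT
  let j : Q → Q × X := fun q ↦ (q, 0)
  have hj : ContDiff ℝ ∞ j := contDiff_id.prodMk contDiff_const
  refine ⟨j ⁻¹' (h.target ∩ h.symm ⁻¹' T), hO.preimage hj.continuous,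
    ⟨htgt, by rw [mem_preimage, hinv]; exact hT₀⟩, fun q ↦ (h.symm (j q)).2, ?_, ?_⟩
  · rintro q ⟨h1, e, he⟩
    have h2 : ContDiffAt ℝ ∞ h.symm (j q) := h.contDiffAt_symm (f₀' := e) h1
      (by rw [he]; exact (hΘ.differentiable (by simp) _).hasFDerivAt) hΘ.contDiffAt
    exact (contDiffAt_snd.comp q (h2.comp q hj.contDiffAt)).contDiffWithinAt
  · rintro q ⟨h1, -⟩
    have h3 : Θ (h.symm (j q)) = (q, 0) := h.right_inv h1
    have h4 : (h.symm (j q)).1 = q := congrArg Prod.fst h3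
    have h5 : (h.symm (j q)).2 - N (h.symm (j q)) = 0 := congrArg Prod.snd h3
    have h6 : (q, (h.symm (j q)).2) = h.symm (j q) := Prod.ext h4.symm rfl
    rw [h6]
    exact sub_eq_zero.1 h5

/-- Constant functions, as a continuous linear map. -/
noncomputable def constCLM : S →L[ℝ] C(timeInterval, S) :=
  LinearMap.mkContinuous
    { toFun := ContinuousMap.const timeInterval
      map_add' := fun _ _ ↦ rfl
      map_smul' := fun _ _ ↦ rfl } 1 fun y ↦ by
    rw [one_mul]
    exact (ContinuousMap.norm_le _ (norm_nonneg y)).2 fun _ ↦ le_rfl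

/-- An integral curve up to time `t`, rescaled to the interval `[-1, 1]`, is a fixed point of `γ ↦ y
+ t ∫₀ Y(γ)`, a smooth map on a space of continuous functions with parameters `(t, y)`. At `t = 0`
it does not depend on `γ`, so `exists_contDiffOn_fixedPoint` gives a smooth family of fixed points.
The flow is the value of the fixed point at rescaled time 1. -/
theorem exists_contDiff_flow_of_hasCompactSupport [CompleteSpace S] {Y : S → S}
    (hY : ContDiff ℝ ∞ Y) (hs : HasCompactSupport Y) (y₀ : S) :
    ∃ ε > 0, ∃ N : Set S, IsOpen N ∧ y₀ ∈ N ∧ ∃ Fl : ℝ × S → S,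
      ContDiffOn ℝ ∞ Fl (Ioo (-ε) ε ×ˢ N) ∧ (∀ y ∈ N, Fl (0, y) = y) ∧
      ∀ t ∈ Ioo (-ε) ε, ∀ y ∈ N, HasDerivAt (fun s ↦ Fl (s, y)) (Y (Fl (t, y))) t := by
  let Yc : C(S, S) := ⟨Y, hY.continuous⟩
  let NY : C(timeInterval, S) → C(timeInterval, S) := fun γ ↦ Yc.comp γ
  have hNY : ContDiff ℝ ∞ NY := contDiff_comp_continuousMap Yc hY hs
  let N : (ℝ × S) × C(timeInterval, S) → C(timeInterval, S) :=
    fun z ↦ constCLM z.1.2 + z.1.1 • primitive (NY z.2)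
  have hN : ContDiff ℝ ∞ N :=
    (constCLM.contDiff.comp (contDiff_snd.comp contDiff_fst)).add
      ((contDiff_fst.comp contDiff_fst).smul
        ((ContinuousLinearMap.contDiff primitive).comp (hNY.comp contDiff_snd)))
  let l : ℝ × S →L[ℝ] C(timeInterval, S) :=
    constCLM ∘L ContinuousLinearMap.snd ℝ ℝ S +
      (ContinuousLinearMap.fst ℝ ℝ S).smulRight (primitive (NY (constCLM y₀)))
  obtain ⟨O, hO, hO₀, Γ, hΓ, hfix⟩ := exists_contDiffOn_fixedPoint hN (q₀ := (0, y₀))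
    (x₀ := constCLM y₀) (l := l) (by simp [N]) (by
      have h1 : HasFDerivAt (fun z : (ℝ × S) × C(timeInterval, S) ↦ primitive (NY z.2)) _
          ((0, y₀), constCLM y₀) :=
        ((((ContinuousLinearMap.contDiff primitive).comp (hNY.comp contDiff_snd)).differentiable
          (by simp)) _).hasFDerivAt
      have h2 : HasFDerivAt (fun z : (ℝ × S) × C(timeInterval, S) ↦ z.1.1)
          (ContinuousLinearMap.fst ℝ ℝ S ∘L ContinuousLinearMap.fst ℝ (ℝ × S) _)
          ((0, y₀), constCLM y₀) := ContinuousLinearMap.hasFDerivAt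
            (ContinuousLinearMap.fst ℝ ℝ S ∘L
              ContinuousLinearMap.fst ℝ (ℝ × S) C(timeInterval, S))
      have h3 : HasFDerivAt (fun z : (ℝ × S) × C(timeInterval, S) ↦ constCLM z.1.2)
          (constCLM ∘L ContinuousLinearMap.snd ℝ ℝ S ∘L ContinuousLinearMap.fst ℝ (ℝ × S) _)
          ((0, y₀), constCLM y₀) := ContinuousLinearMap.hasFDerivAt
            (constCLM (S := S) ∘L ContinuousLinearMap.snd ℝ ℝ S ∘L
              ContinuousLinearMap.fst ℝ (ℝ × S) C(timeInterval, S))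
      refine (h3.add (h2.smul h1)).congr_fderiv ?_
      ext z <;> simp [l])
  obtain ⟨U, hU, N', hN', hUN⟩ := mem_nhds_prod_iff.1 (hO.mem_nhds hO₀)
  obtain ⟨ε', hε', hUε⟩ := Metric.mem_nhds_iff.1 hU
  obtain ⟨N₀, hN₀, hN₀o, hyN₀⟩ := mem_nhds_iff.1 hN'
  have hmem {t : ℝ} (ht : |t| < ε') {y : S} (hy : y ∈ N₀) : (t, y) ∈ O :=
    hUN ⟨hUε (by simpa using ht), hN₀ hy⟩
  -- the solutions, extended to all times
  let G : ℝ × S → ℝ → S := fun q t ↦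
    q.2 + q.1 • ∫ s in (0 : ℝ)..t, Y (Γ q (projIcc (-1) 1 (by norm_num) s))
  have hG {q : ℝ × S} (hq : q ∈ O) {t : ℝ} (ht : t ∈ Icc (-1 : ℝ) 1) : G q t = Γ q ⟨t, ht⟩ :=
    (DFunLike.congr_fun (hfix q hq) ⟨t, ht⟩).symm
  have hG' {q : ℝ × S} (hq : q ∈ O) {t : ℝ} (ht : t ∈ Icc (-1 : ℝ) 1) :
      HasDerivAt (G q) (q.1 • Y (G q t)) t := by
    have h1 := ((hY.continuous.comp (continuous_projIcc_comp (Γ q))).integral_hasStrictDerivAt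
      0 t).hasDerivAt
    rw [hG hq ht, ← projIcc_of_mem (by norm_num) ht]
    exact (h1.const_smul q.1).const_add q.2
  have hG₀ (q : ℝ × S) : G q 0 = q.2 := by simp [G]
  obtain ⟨C, hC⟩ := ContDiff.lipschitzWith_of_hasCompactSupport hs hY (by simp)
  -- The flow varies the parameter `s` at rescaled time 1, whereas the integral equation gives a
  -- derivative in the rescaled time. Both are compared through one reference curve with parameter
  -- `ε' / 2`: after rescaling time by `s / (ε' / 2)` it solves the same equation with field `s •
  -- Y`, which is globally Lipschitz because `Y` has compact support.
  have hscale {s : ℝ} (hs : s ∈ Ioo (-(ε' / 2)) (ε' / 2)) {y : S} (hy : y ∈ N₀) :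
      G (s, y) 1 = G (ε' / 2, y) (s / (ε' / 2)) := by
    have h1 : |s| < ε' := by rw [abs_lt]; constructor <;> linarith [hs.1, hs.2]
    have h2 : |ε' / 2| < ε' := by rw [abs_of_pos] <;> linarith
    have h3 {t : ℝ} (ht : t ∈ Icc (0 : ℝ) 1) : t * (s / (ε' / 2)) ∈ Icc (-1 : ℝ) 1 := by
      have h5 : |s / (ε' / 2)| ≤ 1 := by
        rw [abs_div, abs_of_pos (half_pos hε'), div_le_one (half_pos hε')]
        exact abs_le.2 ⟨hs.1.le, hs.2.le⟩
      rw [mem_Icc, ← abs_le, abs_mul, abs_of_nonneg ht.1]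
      exact mul_le_one₀ ht.2 (abs_nonneg _) h5
    have h4 {t : ℝ} (ht : t ∈ Icc (0 : ℝ) 1) : HasDerivAt
        (fun t ↦ G (ε' / 2, y) (t * (s / (ε' / 2)))) (s • Y (G (ε' / 2, y) (t * (s / (ε' / 2))))) t := by
      have h5 := (hG' (hmem h2 hy) (h3 ht)).scomp t ((hasDerivAt_id t).mul_const (s / (ε' / 2)))
      refine h5.congr_deriv ?_
      rw [smul_smul]
      congr 1
      field_simp
    have h5 {t : ℝ} (ht : t ∈ Icc (0 : ℝ) 1) : HasDerivAt (G (s, y)) (s • Y (G (s, y) t)) t :=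
      hG' (hmem h1 hy) ⟨by linarith [ht.1], ht.2⟩
    have h6 := ODE_solution_unique (v := fun _ z ↦ s • Y z) (K := ‖s‖₊ * C) (a := 0) (b := 1)
      (fun _ ↦ (lipschitzWith_smul s).comp hC)
      (fun t ht ↦ (h5 ht).continuousAt.continuousWithinAt)
      (fun t ht ↦ (h5 ⟨ht.1, ht.2.le⟩).hasDerivWithinAt)
      (fun t ht ↦ (h4 ht).continuousAt.continuousWithinAt)
      (fun t ht ↦ (h4 ⟨ht.1, ht.2.le⟩).hasDerivWithinAt) (by simp [hG₀])
      (right_mem_Icc.2 zero_le_one)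
    simpa using h6
  refine ⟨ε' / 2, half_pos hε', N₀, hN₀o, hyN₀,
    fun q ↦ ContinuousMap.evalCLM ℝ (⟨1, by norm_num⟩ : timeInterval) (Γ q), ?_, ?_, ?_⟩
  · refine (ContinuousLinearMap.contDiff _).comp_contDiffOn (hΓ.mono ?_)
    rintro ⟨s, y⟩ ⟨hs, hy⟩
    exact hmem (by rw [abs_lt]; constructor <;> linarith [hs.1, hs.2]) hy
  · intro y hy
    have h1 := hG (hmem (t := 0) (by simpa using hε') hy) (t := 1) (by norm_num)
    exact h1.symm.trans (by simp [G])
  · intro t ht y hy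
    have h1 {s : ℝ} (hs : s ∈ Ioo (-(ε' / 2)) (ε' / 2)) :
        ContinuousMap.evalCLM ℝ (⟨1, by norm_num⟩ : timeInterval) (Γ (s, y)) =
          G (ε' / 2, y) (s / (ε' / 2)) := by
      rw [← hscale hs hy]
      exact (hG (hmem (by rw [abs_lt]; constructor <;> linarith [hs.1, hs.2]) hy) _).symm
    have h2 : t / (ε' / 2) ∈ Icc (-1 : ℝ) 1 := by
      rw [mem_Icc, le_div_iff₀ (half_pos hε'), div_le_iff₀ (half_pos hε')]
      constructor <;> linarith [ht.1, ht.2]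
    have h3 := (hG' (hmem (t := ε' / 2) (by rw [abs_of_pos] <;> linarith) hy) h2).scomp t
      ((hasDerivAt_id t).div_const (ε' / 2))
    change HasDerivAt _ (Y (ContinuousMap.evalCLM ℝ (⟨1, by norm_num⟩ : timeInterval) (Γ (t, y)))) t
    rw [h1 ht]
    refine (h3.congr_deriv ?_).congr_of_eventuallyEq ?_
    · rw [smul_smul, one_div_mul_cancel (half_pos hε').ne', one_smul]
    · filter_upwards [isOpen_Ioo.mem_nhds ht] with s hs using h1 hs

/-- The local flow of a smooth vector field is smooth. -/
theorem exists_contDiff_flow [FiniteDimensional ℝ S] {Y : S → S} {O : Set S} (hO : IsOpen O)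
    (hY : ContDiffOn ℝ ∞ Y O) {y₀ : S} (hy₀ : y₀ ∈ O) :
    ∃ ε > 0, ∃ N : Set S, IsOpen N ∧ y₀ ∈ N ∧ ∃ Fl : ℝ × S → S,
      ContDiffOn ℝ ∞ Fl (Ioo (-ε) ε ×ˢ N) ∧ (∀ y ∈ N, Fl (0, y) = y) ∧
      ∀ t ∈ Ioo (-ε) ε, ∀ y ∈ N, Fl (t, y) ∈ O ∧
        HasDerivAt (fun s ↦ Fl (s, y)) (Y (Fl (t, y))) t := by
  have : CompleteSpace S := FiniteDimensional.complete ℝ S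
  obtain ⟨r, hr, hrO⟩ := Metric.isOpen_iff.1 hO y₀ hy₀
  -- The cutoff equals 1 on the ball of radius `r / 4` and has support in `O`. Times and initial
  -- values are then restricted so that the flow of `χ • Y` stays in the smaller ball, where it is
  -- the flow of `Y`.
  let χ : ContDiffBump y₀ := ⟨r / 4, r / 2, by positivity, by linarith⟩
  have hχO : tsupport χ ⊆ O := by
    rw [χ.tsupport_eq]
    exact (Metric.closedBall_subset_ball (by simp [χ]; linarith)).trans hrO
  let Y' : S → S := fun y ↦ χ y • Y y
  have hY' : ContDiff ℝ ∞ Y' := by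
    rw [contDiff_iff_contDiffAt]
    intro y
    by_cases hy : y ∈ tsupport χ
    · exact χ.contDiffAt.smul (hY.contDiffAt (hO.mem_nhds (hχO hy)))
    · have h1 : Y' =ᶠ[𝓝 y] fun _ ↦ 0 := by
        filter_upwards [(isClosed_tsupport χ).isOpen_compl.mem_nhds hy] with z hz
        simp [Y', image_eq_zero_of_notMem_tsupport hz]
      exact contDiffAt_const.congr_of_eventuallyEq h1
  obtain ⟨ε, hε, N, hN, hyN, Fl, hFl, hFl₀, hFl'⟩ := exists_contDiff_flow_of_hasCompactSupport hY'
    χ.hasCompactSupport.smul_right y₀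
  have hD : IsOpen (Ioo (-ε) ε ×ˢ N) := isOpen_Ioo.prod hN
  have h1 : (0, y₀) ∈ Ioo (-ε) ε ×ˢ N := ⟨by simpa using hε, hyN⟩
  have h2 : Fl ⁻¹' Metric.ball y₀ (r / 4) ∈ 𝓝 (0, y₀) :=
    (hFl.continuousOn.continuousAt (hD.mem_nhds h1)).preimage_mem_nhds
      (by rw [hFl₀ _ hyN]; exact Metric.ball_mem_nhds _ (by positivity))
  obtain ⟨U, hU, N', hN', hUN⟩ := mem_nhds_prod_iff.1 (inter_mem h2 (hD.mem_nhds h1))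
  obtain ⟨δ, hδ, hUδ⟩ := Metric.mem_nhds_iff.1 hU
  obtain ⟨N₀, hN₀, hN₀o, hyN₀⟩ := mem_nhds_iff.1 hN'
  have hmem {t : ℝ} (ht : t ∈ Ioo (-δ) δ) {y : S} (hy : y ∈ N₀) :
      (t, y) ∈ Fl ⁻¹' Metric.ball y₀ (r / 4) ∩ Ioo (-ε) ε ×ˢ N :=
    hUN ⟨hUδ (by simpa [Real.ball_eq_Ioo] using ht), hN₀ hy⟩
  refine ⟨δ, hδ, N₀, hN₀o, hyN₀, Fl, hFl.mono fun q hq ↦ (hmem hq.1 hq.2).2, fun y hy ↦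
    hFl₀ y (hmem (t := 0) (by simpa using hδ) hy).2.2, fun t ht y hy ↦ ?_⟩
  obtain ⟨h3, h4⟩ := hmem ht hy
  have h5 : χ (Fl (t, y)) = 1 := χ.one_of_mem_closedBall (Metric.ball_subset_closedBall h3)
  refine ⟨hrO (Metric.ball_subset_ball (by linarith) h3), ?_⟩
  have h6 := hFl' t h4.1 y h4.2
  simpa [Y', h5] using h6

end Flow

/-! ### Uniqueness for linear differential equations. -/

section LinearODE

variable {F : Type*} [NormedAddCommGroup F] [NormedSpace ℝ F]

/-- Uniqueness of solutions of linear differential equations. -/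
theorem eqOn_of_hasDerivAt_linear {a b t₀ : ℝ} {L : ℝ → F →L[ℝ] F} {h f g : ℝ → F}
    (hL : ContinuousOn L (Ioo a b)) (ht₀ : t₀ ∈ Ioo a b)
    (hf : ∀ t ∈ Ioo a b, HasDerivAt f (L t (f t) + h t) t)
    (hg : ∀ t ∈ Ioo a b, HasDerivAt g (L t (g t) + h t) t) (h₀ : f t₀ = g t₀) :
    EqOn f g (Ioo a b) := by
  intro t ht
  -- `L` is only continuous on the open interval and may be unbounded there. On a compact
  -- subinterval whose interior contains `t₀` and `t` it is bounded, which provides the Lipschitz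
  -- constant.
  obtain ⟨c, hac, hc⟩ := exists_between (lt_min ht₀.1 ht.1)
  obtain ⟨d, hd, hdb⟩ := exists_between (max_lt ht₀.2 ht.2)
  rw [lt_min_iff] at hc
  rw [max_lt_iff] at hd
  have hsub : Icc c d ⊆ Ioo a b := fun s hs ↦ ⟨hac.trans_le hs.1, hs.2.trans_lt hdb⟩
  obtain ⟨K, hK⟩ := isCompact_Icc.exists_bound_of_continuousOn (hL.mono hsub)
  refine ODE_solution_unique_of_mem_Ioo (v := fun s z ↦ L s z + h s) (s := fun _ ↦ univ)
    (K := K.toNNReal) (a := c) (b := d) (fun s hs ↦ ?_) ⟨hc.1, hd.1⟩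
    (fun s hs ↦ ⟨hf s (hsub (Ioo_subset_Icc_self hs)), trivial⟩)
    (fun s hs ↦ ⟨hg s (hsub (Ioo_subset_Icc_self hs)), trivial⟩) h₀ ⟨hc.2, hd.2⟩
  refine (LipschitzWith.of_dist_le_mul fun x y ↦ ?_).lipschitzOnWith
  rw [dist_add_right, dist_eq_norm, ← map_sub, dist_eq_norm]
  refine (L s).le_of_opNorm_le ((hK s (Ioo_subset_Icc_self hs)).trans ?_) _
  exact Real.le_coe_toNNReal K

theorem eqOn_of_hasDerivAt_const {a b t₀ : ℝ} {f : ℝ → F} {v : F} (ht₀ : t₀ ∈ Ioo a b)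
    (hf : ∀ t ∈ Ioo a b, HasDerivAt f v t) {t : ℝ} (ht : t ∈ Ioo a b) :
    f t = f t₀ + (t - t₀) • v := by
  refine eqOn_of_hasDerivAt_linear (L := 0) (h := fun _ ↦ v)
    (g := fun t ↦ f t₀ + (t - t₀) • v) continuousOn_const ht₀
    (fun t ht ↦ by simpa using hf t ht) (fun t _ ↦ ?_) (by simp) ht
  have := (((hasDerivAt_id t).sub_const t₀).smul_const v).const_add (f t₀)
  simpa using this

end LinearODE

section ProductDerivatives

variable {P E : Type*} [NormedAddCommGroup P] [NormedSpace ℝ P] [NormedAddCommGroup E]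
  [NormedSpace ℝ E] {f : ℝ → P × E} {f' : P × E} {t : ℝ}

theorem HasDerivAt.prod_fst (h : HasDerivAt f f' t) : HasDerivAt (fun s ↦ (f s).1) f'.1 t :=
  (ContinuousLinearMap.fst ℝ P E).hasFDerivAt.comp_hasDerivAt t h

theorem HasDerivAt.prod_snd (h : HasDerivAt f f' t) : HasDerivAt (fun s ↦ (f s).2) f'.2 t :=
  (ContinuousLinearMap.snd ℝ P E).hasFDerivAt.comp_hasDerivAt t h

end ProductDerivatives

/-! ### Interchanging time and parameter derivatives. -/

section MixedDerivatives

variable {P E : Type*} [NormedAddCommGroup P] [NormedSpace ℝ P] [NormedAddCommGroup E]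
  [NormedSpace ℝ E]

theorem fderiv_slice {g : ℝ × P → E} {t : ℝ} {p : P} (hg : DifferentiableAt ℝ g (t, p)) (u : P) :
    fderiv ℝ (fun q ↦ g (t, q)) p u = fderiv ℝ g (t, p) (0, u) := by
  have h := hg.hasFDerivAt.comp p (hasFDerivAt_prodMk_right t p)
  rw [HasFDerivAt.fderiv (f := fun q ↦ g (t, q)) h]
  rfl

/-- Time derivatives commute with derivatives in the space variable. -/
theorem hasDerivAt_fderiv_slice {g k : ℝ × P → E} {D : Set (ℝ × P)} (hD : IsOpen D)
    (hg : ContDiffOn ℝ ∞ g D)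
    (hk : ∀ t p, (t, p) ∈ D → HasDerivAt (fun s ↦ g (s, p)) (k (t, p)) t) {t : ℝ} {p : P}
    (htp : (t, p) ∈ D) (u : P) :
    HasDerivAt (fun s ↦ fderiv ℝ (fun q ↦ g (s, q)) p u) (fderiv ℝ (fun q ↦ k (t, q)) p u) t := by
  have hat {z : ℝ × P} (hz : z ∈ D) : ContDiffAt ℝ ∞ g z := hg.contDiffAt (hD.mem_nhds hz)
  have hd {z : ℝ × P} (hz : z ∈ D) : DifferentiableAt ℝ g z := (hat hz).differentiableAt (by simp)
  -- On `D` the function `k` is the time derivative of `g`, so the claim is the symmetry of the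
  -- second derivative of `g` in the directions `(1, 0)` and `(0, u)`.
  have hk' {z : ℝ × P} (hz : z ∈ D) : k z = fderiv ℝ g z (1, 0) := by
    have h1 := (hd hz).hasFDerivAt.comp_hasDerivAt z.1
      ((hasDerivAt_id z.1).prodMk (hasDerivAt_const z.1 z.2))
    exact (hk z.1 z.2 hz).unique h1
  have h2 : DifferentiableAt ℝ (fderiv ℝ g) (t, p) :=
    ((hat htp).fderiv_right (m := 1) two_le_infty).differentiableAt (by simp)
  have hsymm : IsSymmSndFDerivAt ℝ g (t, p) :=
    (hat htp).isSymmSndFDerivAt (by simpa using two_le_infty)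
  have h3 : (fun q ↦ k (t, q)) =ᶠ[𝓝 p] fun q ↦ fderiv ℝ g (t, q) (1, 0) := by
    have : ∀ᶠ q in 𝓝 p, (t, q) ∈ D :=
      (Continuous.prodMk_right t).continuousAt.preimage_mem_nhds (hD.mem_nhds htp)
    filter_upwards [this] with q hq using hk' hq
  have h4 : (fun s ↦ fderiv ℝ (fun q ↦ g (s, q)) p u) =ᶠ[𝓝 t] fun s ↦ fderiv ℝ g (s, p) (0, u) := by
    have : ∀ᶠ s in 𝓝 t, (s, p) ∈ D :=
      (Continuous.prodMk_left p).continuousAt.preimage_mem_nhds (hD.mem_nhds htp)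
    filter_upwards [this] with s hs using fderiv_slice (hd hs) u
  have h5 : fderiv ℝ (fun q ↦ k (t, q)) p u = fderiv ℝ (fderiv ℝ g) (t, p) (1, 0) (0, u) := by
    rw [h3.fderiv_eq, fderiv_slice (g := fun z ↦ fderiv ℝ g z (1, 0))
      (h2.clm_apply (differentiableAt_const _))]
    have h7 : HasFDerivAt (fun z ↦ fderiv ℝ g z (1, 0))
        ((ContinuousLinearMap.apply ℝ E ((1 : ℝ), (0 : P))) ∘L fderiv ℝ (fderiv ℝ g) (t, p)) (t, p) :=
      (ContinuousLinearMap.apply ℝ E ((1 : ℝ), (0 : P))).hasFDerivAt.comp (t, p) h2.hasFDerivAt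
    rw [h7.fderiv]
    exact hsymm.eq _ _
  rw [h5]
  refine HasDerivAt.congr_of_eventuallyEq ?_ h4
  have h6 : HasDerivAt (fun s ↦ fderiv ℝ g (s, p)) (fderiv ℝ (fderiv ℝ g) (t, p) (1, 0)) t :=
    h2.hasFDerivAt.comp_hasDerivAt t ((hasDerivAt_id t).prodMk (hasDerivAt_const t p))
  exact (ContinuousLinearMap.apply ℝ E ((0 : ℝ), u)).hasFDerivAt.comp_hasDerivAt t h6

end MixedDerivatives

/-! ### The flow and transport equations in charts, and existence of solutions. -/

/-- A Lie algebroid over an open subset of `E`, in a trivialization with fibre `F`, together with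
a family of sections `a` parametrized by the fibres of a trivial vector bundle over an open
subset of `Q` with fibre `G`, and a map `j` from the base of this bundle to `E`. -/
structure LocalFamily (Q G E F : Type*) [NormedAddCommGroup Q] [NormedSpace ℝ Q]
    [NormedAddCommGroup G] [NormedSpace ℝ G] [NormedAddCommGroup E] [NormedSpace ℝ E]
    [NormedAddCommGroup F] [NormedSpace ℝ F] where
  domQ : Set Q
  domE : Set E
  isOpen_domQ : IsOpen domQ
  isOpen_domE : IsOpen domE
  a : (Q × G) × E → F
  R : E → F →L[ℝ] E
  C : E → F →L[ℝ] F →L[ℝ] F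
  j : Q → E
  contDiffOn_a : ContDiffOn ℝ ∞ a ((domQ ×ˢ univ) ×ˢ domE)
  contDiffOn_R : ContDiffOn ℝ ∞ R domE
  contDiffOn_C : ContDiffOn ℝ ∞ C domE
  contDiffOn_j : ContDiffOn ℝ ∞ j domQ
  a_smul : ∀ ξ ∈ domQ, ∀ μ ∈ domE, ∀ (r : ℝ) (y : G), a ((ξ, r • y), μ) = r • a ((ξ, y), μ)
  -- `R` is the anchor and `C` the bracket of constant sections. The remaining fields are
  -- antisymmetry, compatibility of the anchor with brackets, and the Jacobi identity, each written
  -- for constant sections, whose brackets need not be constant.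
  C_swap : ∀ μ ∈ domE, ∀ v w, C μ v w = -C μ w v
  R_C : ∀ μ ∈ domE, ∀ v w,
    R μ (C μ v w) = fderiv ℝ R μ (R μ v) w - fderiv ℝ R μ (R μ w) v
  jacobi : ∀ μ ∈ domE, ∀ u v w,
    fderiv ℝ C μ (R μ u) v w + C μ u (C μ v w) =
      (-fderiv ℝ C μ (R μ w) u v + C μ (C μ u v) w) + (fderiv ℝ C μ (R μ v) u w + C μ v (C μ u w))

namespace LocalFamily

variable {Q G E F : Type*} [NormedAddCommGroup Q] [NormedSpace ℝ Q]
    [NormedAddCommGroup G] [NormedSpace ℝ G] [NormedAddCommGroup E] [NormedSpace ℝ E]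
    [NormedAddCommGroup F] [NormedSpace ℝ F] (D : LocalFamily Q G E F)

/-- The domain of the family of sections. -/
def dom : Set ((Q × G) × E) := (D.domQ ×ˢ univ) ×ˢ D.domE

theorem isOpen_dom : IsOpen D.dom := (D.isOpen_domQ.prod isOpen_univ).prod D.isOpen_domE

/-- The right-hand side of the linear differential equation for the transport of a pair consisting
of a tangent vector `u` to the parameter space and an element of the fibre. -/
noncomputable def rhs (p : Q × G) (μ : E) (u : Q × G) (β : F) : F :=
  -- With `α = a(p, m(t, p))` and `R β` the derivative of `m` along `u`, this is the total
  -- derivative of `α` along `u` minus the bracket term `C(α, β)`. Having `R β` in place of the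
  -- derivative of `m` closes the equation before the anchor condition is known.
  fderiv ℝ D.a (p, μ) (u, D.R μ β) - D.C μ (D.a (p, μ)) β

/-- `m` and `Ψ` are the flow of the anchors of the family of sections, and the transport along it. -/
structure IsSolution (N : Set (Q × G)) (m : ℝ × (Q × G) → E)
    (Ψ : ℝ × (Q × G) → (Q × G) × F →L[ℝ] F) : Prop where
  isOpen : IsOpen N
  subset : ∀ p ∈ N, p.1 ∈ D.domQ
  -- Only the times 0 and 1 matter in the end. The interval is chosen to have both in its interior.
  contDiffOn_m : ContDiffOn ℝ ∞ m (Ioo (-2) 2 ×ˢ N)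
  contDiffOn_Ψ : ContDiffOn ℝ ∞ Ψ (Ioo (-2) 2 ×ˢ N)
  mem : ∀ t ∈ Ioo (-2 : ℝ) 2, ∀ p ∈ N, m (t, p) ∈ D.domE
  m_zero : ∀ p ∈ N, m (0, p) = D.j p.1
  Ψ_zero : ∀ p ∈ N, Ψ (0, p) = ContinuousLinearMap.snd ℝ (Q × G) F
  hasDerivAt_m : ∀ t ∈ Ioo (-2 : ℝ) 2, ∀ p ∈ N,
    HasDerivAt (fun s ↦ m (s, p)) (D.R (m (t, p)) (D.a (p, m (t, p)))) t
  hasDerivAt_Ψ : ∀ t ∈ Ioo (-2 : ℝ) 2, ∀ p ∈ N, ∀ v,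
    HasDerivAt (fun s ↦ Ψ (s, p) v) (D.rhs p (m (t, p)) v.1 (Ψ (t, p) v)) t

variable {D}

theorem differentiableAt_a {p : Q × G} (hp : p.1 ∈ D.domQ) {μ : E} (hμ : μ ∈ D.domE) :
    DifferentiableAt ℝ D.a (p, μ) :=
  (D.contDiffOn_a.contDiffAt (D.isOpen_dom.mem_nhds ⟨⟨hp, trivial⟩, hμ⟩)).differentiableAt (by simp)

theorem a_zero {ξ : Q} (hξ : ξ ∈ D.domQ) {μ : E} (hμ : μ ∈ D.domE) : D.a ((ξ, 0), μ) = 0 := by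
  simpa using D.a_smul ξ hξ μ hμ 0 0

/-- The derivative of the homogeneity relation `a_smul`, which makes the transport equation
homogeneous as well. -/
theorem fderiv_a_smul {p : Q × G} (hp : p.1 ∈ D.domQ) {μ : E} (hμ : μ ∈ D.domE) (r : ℝ)
    (u : Q × G) (v : E) :
    fderiv ℝ D.a ((p.1, r • p.2), μ) ((u.1, r • u.2), v) = r • fderiv ℝ D.a (p, μ) (u, v) := by
  let S : (Q × G) × E →L[ℝ] (Q × G) × E := ((ContinuousLinearMap.id ℝ Q).prodMap
    (r • ContinuousLinearMap.id ℝ G)).prodMap (ContinuousLinearMap.id ℝ E)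
  have h1 : HasFDerivAt (fun z ↦ D.a (S z)) (fderiv ℝ D.a (S (p, μ)) ∘L S) (p, μ) :=
    HasFDerivAt.comp (p, μ) (differentiableAt_a (p := (p.1, r • p.2)) hp hμ).hasFDerivAt
      S.hasFDerivAt
  have h2 : (fun z ↦ D.a (S z)) =ᶠ[𝓝 (p, μ)] fun z ↦ r • D.a z := by
    filter_upwards [D.isOpen_dom.mem_nhds (show (p, μ) ∈ D.dom from ⟨⟨hp, trivial⟩, hμ⟩)] with z hz
    exact D.a_smul z.1.1 hz.1.1 z.2 hz.2 r z.1.2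
  have h3 := (h1.congr_of_eventuallyEq h2.symm).unique
    ((differentiableAt_a hp hμ).hasFDerivAt.const_smul r)
  exact DFunLike.congr_fun h3 (u, v)

/-- Directions without fibre component contribute nothing, by `fderiv_a_smul` with `r = 0`. In a
fibre direction `a` is linear, hence its own derivative. -/
theorem fderiv_a_zero {ξ : Q} (hξ : ξ ∈ D.domQ) {μ : E} (hμ : μ ∈ D.domE) (u : Q × G) (v : E) :
    fderiv ℝ D.a ((ξ, 0), μ) (u, v) = D.a ((ξ, u.2), μ) := by
  have hd := (differentiableAt_a (p := (ξ, 0)) hξ hμ).hasFDerivAt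
  have h1 : fderiv ℝ D.a ((ξ, 0), μ) ((u.1, 0), v) = 0 := by
    have := fderiv_a_smul (p := (ξ, 0)) hξ hμ 0 (u.1, 0) v
    simpa using this
  have h2 : fderiv ℝ D.a ((ξ, 0), μ) ((0, u.2), 0) = D.a ((ξ, u.2), μ) := by
    have h3 : HasDerivAt (fun r : ℝ ↦ (((ξ, r • u.2), μ) : (Q × G) × E)) ((0, u.2), 0) 0 := by
      have := ((hasDerivAt_const (0 : ℝ) ξ).prodMk
        ((hasDerivAt_id (0 : ℝ)).smul_const u.2)).prodMk (hasDerivAt_const (0 : ℝ) μ)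
      simpa using this
    have h4 := HasFDerivAt.comp_hasDerivAt (0 : ℝ) (f := fun r : ℝ ↦ (((ξ, r • u.2), μ) : (Q × G) × E))
      (l := D.a) (by simpa using hd) h3
    have h5 : D.a ∘ (fun r : ℝ ↦ (((ξ, r • u.2), μ) : (Q × G) × E)) =
        fun r : ℝ ↦ r • D.a ((ξ, u.2), μ) := funext fun r ↦ D.a_smul ξ hξ μ hμ r u.2
    rw [h5] at h4
    have h6 := (hasDerivAt_id (0 : ℝ)).smul_const (D.a ((ξ, u.2), μ))
    simpa using h4.unique h6
  have h3 : (u, v) = ((u.1, 0), v) + (((0, u.2), 0) : (Q × G) × E) := by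
    ext <;> simp
  rw [h3, map_add, h1, h2, zero_add]

variable (D) in
/-- The linear differential equation for the transport, on linear maps. -/
noncomputable def rhsCLM (p : Q × G) (μ : E) (Ψ : (Q × G) × F →L[ℝ] F) : (Q × G) × F →L[ℝ] F :=
  fderiv ℝ D.a (p, μ) ∘L ((ContinuousLinearMap.fst ℝ (Q × G) F).prod (D.R μ ∘L Ψ)) -
    D.C μ (D.a (p, μ)) ∘L Ψ

variable [FiniteDimensional ℝ Q] [FiniteDimensional ℝ G] [FiniteDimensional ℝ E]
  [FiniteDimensional ℝ F]

variable (D) in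
-- Base point and transport form one autonomous system, with `p` as a constant component and the
-- transport as an unknown linear map. Its flow near `(ξ₀, 0)` exists on some interval `(-ε, ε)`
-- only. Homogeneity of `a` in the fibre stretches this interval to `(-2, 2)`.
theorem exists_isSolution {ξ₀ : Q} (hξ₀ : ξ₀ ∈ D.domQ) (hj : D.j ξ₀ ∈ D.domE) :
    ∃ N m Ψ, (ξ₀, 0) ∈ N ∧ D.IsSolution N m Ψ := by
  let O : Set ((Q × G) × E × ((Q × G) × F →L[ℝ] F)) := {z | z.1.1 ∈ D.domQ ∧ z.2.1 ∈ D.domE}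
  have hO : IsOpen O := (D.isOpen_domQ.preimage (by fun_prop)).inter
    (D.isOpen_domE.preimage (by fun_prop))
  let Y : (Q × G) × E × ((Q × G) × F →L[ℝ] F) → (Q × G) × E × ((Q × G) × F →L[ℝ] F) := fun z ↦
    (0, D.R z.2.1 (D.a (z.1, z.2.1)), D.rhsCLM z.1 z.2.1 z.2.2)
  have hY : ContDiffOn ℝ ∞ Y O := by
    have hk : ContDiffOn ℝ ∞ (fun z : (Q × G) × E × ((Q × G) × F →L[ℝ] F) ↦ (z.1, z.2.1)) O :=
      (contDiff_fst.prodMk (contDiff_fst.comp contDiff_snd)).contDiffOn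
    have hmaps : MapsTo (fun z : (Q × G) × E × ((Q × G) × F →L[ℝ] F) ↦ (z.1, z.2.1)) O D.dom :=
      fun z hz ↦ ⟨⟨hz.1, trivial⟩, hz.2⟩
    have ha : ContDiffOn ℝ ∞ (fun z : (Q × G) × E × ((Q × G) × F →L[ℝ] F) ↦ D.a (z.1, z.2.1)) O :=
      D.contDiffOn_a.comp hk hmaps
    have hda : ContDiffOn ℝ ∞
        (fun z : (Q × G) × E × ((Q × G) × F →L[ℝ] F) ↦ fderiv ℝ D.a (z.1, z.2.1)) O :=
      (D.contDiffOn_a.fderiv_of_isOpen (m := ∞) D.isOpen_dom (by simp)).comp hk hmaps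
    have h2 : ContDiffOn ℝ ∞ (fun z : (Q × G) × E × ((Q × G) × F →L[ℝ] F) ↦ z.2.1) O :=
      (contDiff_fst.comp contDiff_snd).contDiffOn
    have hΨ : ContDiffOn ℝ ∞ (fun z : (Q × G) × E × ((Q × G) × F →L[ℝ] F) ↦ z.2.2) O :=
      (contDiff_snd.comp contDiff_snd).contDiffOn
    have hR := D.contDiffOn_R.comp h2 (fun z hz ↦ hz.2)
    have hC := D.contDiffOn_C.comp h2 (fun z hz ↦ hz.2)
    refine contDiffOn_const.prodMk ((hR.clm_apply ha).prodMk ?_)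
    refine (hda.clm_comp ?_).sub ((hC.clm_apply ha).clm_comp hΨ)
    have h3 : ContDiffOn ℝ ∞ (fun z : (Q × G) × E × ((Q × G) × F →L[ℝ] F) ↦
        ContinuousLinearMap.inl ℝ (Q × G) E ∘L ContinuousLinearMap.fst ℝ (Q × G) F +
          ContinuousLinearMap.inr ℝ (Q × G) E ∘L (D.R z.2.1 ∘L z.2.2)) O :=
      contDiffOn_const.add (contDiffOn_const.clm_comp (hR.clm_comp hΨ))
    refine h3.congr fun z _ ↦ ?_
    ext v <;> simp
  obtain ⟨ε, hε, NS, hNS, hyN, Fl, hFl, hFl₀, hFl'⟩ := exists_contDiff_flow hO hY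
    (y₀ := ((ξ₀, 0), D.j ξ₀, ContinuousLinearMap.snd ℝ (Q × G) F)) ⟨hξ₀, hj⟩
  have hfst {t : ℝ} (ht : t ∈ Ioo (-ε) ε) {y} (hy : y ∈ NS) : (Fl (t, y)).1 = y.1 := by
    have := eqOn_of_hasDerivAt_const (f := fun s ↦ (Fl (s, y)).1) (v := 0) (t₀ := 0)
      ⟨by linarith, hε⟩ (fun t ht ↦ (hFl' t ht y hy).2.prod_fst) ht
    simpa [hFl₀ y hy] using this
  -- Running the system at `ε / 2` times the speed brings times in `(-2, 2)` into `(-ε, ε)`.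
  -- Multiplying the fibre coordinate by the inverse factor `r` compensates for this in the
  -- equation. The map `δ` acts in the same way on the tangent vector `u`, so the transport is
  -- composed with it.
  let r : ℝ := 2 / ε
  let δ : Q × G →L[ℝ] Q × G :=
    (ContinuousLinearMap.id ℝ Q).prodMap (r • ContinuousLinearMap.id ℝ G)
  have hδ (p : Q × G) : δ p = (p.1, r • p.2) := rfl
  let ι : Q × G → (Q × G) × E × ((Q × G) × F →L[ℝ] F) := fun p ↦
    (δ p, D.j p.1, ContinuousLinearMap.snd ℝ (Q × G) F)
  let B : Set (Q × G) := Prod.fst ⁻¹' D.domQ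
  have hB : IsOpen B := D.isOpen_domQ.preimage continuous_fst
  have hι : ContDiffOn ℝ ∞ ι B := δ.contDiff.contDiffOn.prodMk
    ((D.contDiffOn_j.comp contDiff_fst.contDiffOn fun p hp ↦ hp).prodMk contDiffOn_const)
  have hN : IsOpen (B ∩ ι ⁻¹' NS) := hι.continuousOn.isOpen_inter_preimage hB hNS
  let κ : ℝ × (Q × G) → ℝ × ((Q × G) × E × ((Q × G) × F →L[ℝ] F)) := fun z ↦
    (ε / 2 * z.1, ι z.2)
  have htime {t : ℝ} (ht : t ∈ Ioo (-2 : ℝ) 2) : ε / 2 * t ∈ Ioo (-ε) ε :=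
    ⟨by nlinarith [ht.1], by nlinarith [ht.2]⟩
  have hκ : ContDiffOn ℝ ∞ κ (Ioo (-2) 2 ×ˢ (B ∩ ι ⁻¹' NS)) :=
    (contDiff_const.mul contDiff_fst).contDiffOn.prodMk
      (hι.comp contDiff_snd.contDiffOn fun z hz ↦ hz.2.1)
  have hFκ : ContDiffOn ℝ ∞ (fun z ↦ Fl (κ z)) (Ioo (-2) 2 ×ˢ (B ∩ ι ⁻¹' NS)) :=
    hFl.comp hκ fun z hz ↦ ⟨htime hz.1, hz.2.2⟩
  have hderiv {t : ℝ} (ht : t ∈ Ioo (-2 : ℝ) 2) {p : Q × G} (hp : p ∈ B ∩ ι ⁻¹' NS) :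
      HasDerivAt (fun s ↦ Fl (κ (s, p))) ((ε / 2) • Y (Fl (κ (t, p)))) t := by
    have h1 := (hFl' _ (htime ht) _ hp.2).2.scomp t ((hasDerivAt_id t).const_mul (ε / 2))
    rw [mul_one] at h1
    exact h1
  have hrε : ε / 2 * r = 1 := by simp only [r]; field_simp
  refine ⟨B ∩ ι ⁻¹' NS, fun z ↦ (Fl (κ z)).2.1, fun z ↦ (Fl (κ z)).2.2 ∘L
    (δ.prodMap (ContinuousLinearMap.id ℝ F)), ⟨hξ₀, by simpa [ι, hδ] using hyN⟩, ?_⟩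
  refine ⟨hN, fun p hp ↦ hp.1, (contDiff_fst.comp contDiff_snd).comp_contDiffOn hFκ,
    ((contDiff_snd.comp contDiff_snd).comp_contDiffOn hFκ).clm_comp contDiffOn_const,
    fun t ht p hp ↦ (hFl' _ (htime ht) _ hp.2).1.2, fun p hp ↦ ?_, fun p hp ↦ ?_,
    fun t ht p hp ↦ ?_, fun t ht p hp v ↦ ?_⟩
  · simp [κ, hFl₀ _ hp.2, ι]
  · ext v <;> simp [κ, hFl₀ _ hp.2, ι]
  · have h1 := (hderiv ht hp).prod_snd.prod_fst
    refine h1.congr_deriv ?_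
    have h2 := hfst (htime ht) hp.2
    have h3 := (hFl' _ (htime ht) _ hp.2).1.2
    change (ε / 2) • D.R _ (D.a ((Fl (κ (t, p))).1, _)) = _
    change (Fl (κ (t, p))).1 = _ at h2
    rw [h2, show (ι p).1 = (p.1, r • p.2) from rfl, D.a_smul _ hp.1 _ h3, map_smul, smul_smul, hrε,
      one_smul]
  · have h1 := (hderiv ht hp).prod_snd.prod_snd.clm_apply (hasDerivAt_const t (δ v.1, v.2))
    refine (h1.congr_deriv ?_)
    have h2 := hfst (htime ht) hp.2
    have h3 := (hFl' _ (htime ht) _ hp.2).1.2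
    simp only [map_zero, add_zero]
    change (ε / 2) • D.rhs (Fl (κ (t, p))).1 _ (δ v.1) ((Fl (κ (t, p))).2.2 (δ v.1, v.2)) = _
    change (Fl (κ (t, p))).1 = _ at h2
    rw [h2, show (ι p).1 = (p.1, r • p.2) from rfl, rhs, D.a_smul _ hp.1 _ h3, hδ,
      fderiv_a_smul hp.1 h3, map_smul, smul_apply, ← smul_sub, smul_smul, hrε,
      one_smul]
    rfl

end LocalFamily

/-! ### Compatibility of the transport with anchors and brackets. -/

namespace LocalFamily

variable {Q G E F : Type*} [NormedAddCommGroup Q] [NormedSpace ℝ Q]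
    [NormedAddCommGroup G] [NormedSpace ℝ G] [NormedAddCommGroup E] [NormedSpace ℝ E]
    [NormedAddCommGroup F] [NormedSpace ℝ F] {D : LocalFamily Q G E F}

theorem contDiffAt_a {p : Q × G} (hp : p.1 ∈ D.domQ) {μ : E} (hμ : μ ∈ D.domE) :
    ContDiffAt ℝ ∞ D.a (p, μ) :=
  D.contDiffOn_a.contDiffAt (D.isOpen_dom.mem_nhds ⟨⟨hp, trivial⟩, hμ⟩)

theorem contDiffAt_R {μ : E} (hμ : μ ∈ D.domE) : ContDiffAt ℝ ∞ D.R μ :=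
  D.contDiffOn_R.contDiffAt (D.isOpen_domE.mem_nhds hμ)

theorem contDiffAt_C {μ : E} (hμ : μ ∈ D.domE) : ContDiffAt ℝ ∞ D.C μ :=
  D.contDiffOn_C.contDiffAt (D.isOpen_domE.mem_nhds hμ)

/-- If two vector fields are mapped to sections along a map, then so is their bracket. -/
theorem fderiv_eq_R_bracket {P : Type*} [NormedAddCommGroup P] [NormedSpace ℝ P] {M : P → E}
    {u₁ u₂ : P → P} {β₁ β₂ : P → F} {p : P} (hp : M p ∈ D.domE) (hM : ContDiffAt ℝ ∞ M p)
    (hu₁ : DifferentiableAt ℝ u₁ p) (hu₂ : DifferentiableAt ℝ u₂ p)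
    (hβ₁ : DifferentiableAt ℝ β₁ p) (hβ₂ : DifferentiableAt ℝ β₂ p)
    (h₁ : ∀ᶠ q in 𝓝 p, fderiv ℝ M q (u₁ q) = D.R (M q) (β₁ q))
    (h₂ : ∀ᶠ q in 𝓝 p, fderiv ℝ M q (u₂ q) = D.R (M q) (β₂ q)) :
    fderiv ℝ M p (fderiv ℝ u₂ p (u₁ p) - fderiv ℝ u₁ p (u₂ p)) =
      D.R (M p) (fderiv ℝ β₂ p (u₁ p) - fderiv ℝ β₁ p (u₂ p) + D.C (M p) (β₁ p) (β₂ p)) := by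
  have hM' : HasFDerivAt (fderiv ℝ M) (fderiv ℝ (fderiv ℝ M) p) p :=
    ((hM.fderiv_right (m := 1) two_le_infty).differentiableAt (by simp)).hasFDerivAt
  have hR : HasFDerivAt (fun q ↦ D.R (M q)) (fderiv ℝ D.R (M p) ∘L fderiv ℝ M p) p :=
    HasFDerivAt.comp p (f := M) ((contDiffAt_R hp).differentiableAt (by simp)).hasFDerivAt
      (hM.differentiableAt (by simp)).hasFDerivAt
  -- This is the derivative of the relation `dM(u) = R(M) β` along `v`. Antisymmetrizing in the two
  -- pairs cancels the second derivatives of `M`, and `R_C` turns the remaining derivatives of `R`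
  -- into the term with `C`.
  have key {u : P → P} {β : P → F} (hu : DifferentiableAt ℝ u p) (hβ : DifferentiableAt ℝ β p)
      (h : ∀ᶠ q in 𝓝 p, fderiv ℝ M q (u q) = D.R (M q) (β q)) (v : P) :
      fderiv ℝ M p (fderiv ℝ u p v) + fderiv ℝ (fderiv ℝ M) p v (u p) =
        D.R (M p) (fderiv ℝ β p v) + fderiv ℝ D.R (M p) (fderiv ℝ M p v) (β p) := by
    have h3 := ((hM'.clm_apply hu.hasFDerivAt).congr_of_eventuallyEq
      (EventuallyEq.symm h)).unique (hR.clm_apply hβ.hasFDerivAt)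
    exact DFunLike.congr_fun h3 v
  have k1 := key hu₂ hβ₂ h₂ (u₁ p)
  have k2 := key hu₁ hβ₁ h₁ (u₂ p)
  rw [h₁.self_of_nhds] at k1
  rw [h₂.self_of_nhds, (hM.isSymmSndFDerivAt (by simpa using two_le_infty)).eq] at k2
  rw [map_sub, map_add, map_sub, D.R_C _ hp]
  linear_combination (norm := abel) k1 - k2

namespace IsSolution

variable {N : Set (Q × G)} {m : ℝ × (Q × G) → E} {Ψ : ℝ × (Q × G) → (Q × G) × F →L[ℝ] F}

theorem isOpen_domain (hS : D.IsSolution N m Ψ) : IsOpen (Ioo (-2 : ℝ) 2 ×ˢ N) := isOpen_Ioo.prod hS.isOpen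

theorem contDiffAt_m (hS : D.IsSolution N m Ψ) {t : ℝ} (ht : t ∈ Ioo (-2 : ℝ) 2) {p : Q × G} (hp : p ∈ N) :
    ContDiffAt ℝ ∞ m (t, p) :=
  hS.contDiffOn_m.contDiffAt (hS.isOpen_domain.mem_nhds ⟨ht, hp⟩)

theorem contDiffAt_Ψ (hS : D.IsSolution N m Ψ) {t : ℝ} (ht : t ∈ Ioo (-2 : ℝ) 2) {p : Q × G} (hp : p ∈ N) :
    ContDiffAt ℝ ∞ Ψ (t, p) :=
  hS.contDiffOn_Ψ.contDiffAt (hS.isOpen_domain.mem_nhds ⟨ht, hp⟩)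

theorem contDiffAt_m_slice (hS : D.IsSolution N m Ψ) {t : ℝ} (ht : t ∈ Ioo (-2 : ℝ) 2) {p : Q × G} (hp : p ∈ N) :
    ContDiffAt ℝ ∞ (fun q ↦ m (t, q)) p :=
  (hS.contDiffAt_m ht hp).comp p (contDiffAt_const.prodMk contDiffAt_id)

theorem contDiffAt_Ψ_slice (hS : D.IsSolution N m Ψ) {t : ℝ} (ht : t ∈ Ioo (-2 : ℝ) 2) {p : Q × G} (hp : p ∈ N) :
    ContDiffAt ℝ ∞ (fun q ↦ Ψ (t, q)) p :=
  (hS.contDiffAt_Ψ ht hp).comp p (contDiffAt_const.prodMk contDiffAt_id)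

theorem continuousOn_m (hS : D.IsSolution N m Ψ) {p : Q × G} (hp : p ∈ N) :
    ContinuousOn (fun t ↦ m (t, p)) (Ioo (-2 : ℝ) 2) :=
  fun t ht ↦ (hS.hasDerivAt_m t ht p hp).continuousAt.continuousWithinAt

/-- The transport equation is linear. -/
theorem rhs_eq (p : Q × G) (μ : E) (u : Q × G) (β : F) : D.rhs p μ u β =
    (fderiv ℝ D.a (p, μ) ∘L ContinuousLinearMap.inr ℝ (Q × G) E ∘L D.R μ - D.C μ (D.a (p, μ))) β +
      fderiv ℝ D.a (p, μ) (u, 0) := by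
  have h : ((u, D.R μ β) : (Q × G) × E) = (0, D.R μ β) + (u, 0) := by simp
  rw [rhs, h, map_add]
  simp
  abel

/-- Uniqueness of the transport. -/
theorem transport_unique (hS : D.IsSolution N m Ψ) {p : Q × G} (hp : p ∈ N) {u : Q × G} {f g : ℝ → F}
    (hf : ∀ t ∈ Ioo (-2 : ℝ) 2, HasDerivAt f (D.rhs p (m (t, p)) u (f t)) t)
    (hg : ∀ t ∈ Ioo (-2 : ℝ) 2, HasDerivAt g (D.rhs p (m (t, p)) u (g t)) t) (h₀ : f 0 = g 0) :
    EqOn f g (Ioo (-2) 2) := by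
  have hm := hS.continuousOn_m hp
  have hmaps : MapsTo (fun t ↦ m (t, p)) (Ioo (-2 : ℝ) 2) D.domE := fun t ht ↦ hS.mem t ht p hp
  have hpm : MapsTo (fun t ↦ (p, m (t, p))) (Ioo (-2 : ℝ) 2) D.dom :=
    fun t ht ↦ ⟨⟨hS.subset p hp, trivial⟩, hmaps ht⟩
  refine eqOn_of_hasDerivAt_linear
    (L := fun t ↦ fderiv ℝ D.a (p, m (t, p)) ∘L ContinuousLinearMap.inr ℝ (Q × G) E ∘L
      D.R (m (t, p)) - D.C (m (t, p)) (D.a (p, m (t, p))))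
    (h := fun t ↦ fderiv ℝ D.a (p, m (t, p)) (u, 0)) ?_ (by norm_num)
    (fun t ht ↦ by rw [← rhs_eq]; exact hf t ht) (fun t ht ↦ by rw [← rhs_eq]; exact hg t ht) h₀
  have h1 := (D.contDiffOn_a.fderiv_of_isOpen (m := ∞) D.isOpen_dom (by simp)).continuousOn.comp
    (continuousOn_const.prodMk hm) hpm
  have h2 := D.contDiffOn_a.continuousOn.comp (continuousOn_const.prodMk hm) hpm
  have h3 := D.contDiffOn_R.continuousOn.comp hm hmaps
  have h4 := D.contDiffOn_C.continuousOn.comp hm hmaps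
  exact (h1.clm_comp (continuousOn_const.clm_comp h3)).sub (h4.clm_apply h2)

/-- The derivative of the flow in the parameter, along a pair of compatible initial values, is the
anchor of the transport. -/
theorem fderiv_m (hS : D.IsSolution N m Ψ) {p : Q × G} (hp : p ∈ N) {u : Q × G} {c : F}
    (huc : fderiv ℝ D.j p.1 u.1 = D.R (D.j p.1) c) {t : ℝ} (ht : t ∈ Ioo (-2 : ℝ) 2) :
    fderiv ℝ (fun q ↦ m (t, q)) p u = D.R (m (t, p)) (Ψ (t, p) (u, c)) := by
  have hpQ := hS.subset p hp
  -- the vector field, as a function of the parameter and the point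
  let Z : (Q × G) × E → E := fun z ↦ D.R z.2 (D.a z)
  have hZ : ContDiffOn ℝ ∞ Z D.dom :=
    (D.contDiffOn_R.comp contDiffOn_snd fun z hz ↦ hz.2).clm_apply D.contDiffOn_a
  have hZd {t : ℝ} (ht : t ∈ Ioo (-2 : ℝ) 2) (v : Q × G) (w : E) :
      fderiv ℝ Z (p, m (t, p)) (v, w) = fderiv ℝ D.R (m (t, p)) w (D.a (p, m (t, p))) +
        D.R (m (t, p)) (fderiv ℝ D.a (p, m (t, p)) (v, w)) := by
    have hμ := hS.mem t ht p hp
    have h1 : HasFDerivAt (fun z : (Q × G) × E ↦ D.R z.2)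
        (fderiv ℝ D.R (m (t, p)) ∘L ContinuousLinearMap.snd ℝ (Q × G) E) (p, m (t, p)) :=
      HasFDerivAt.comp (p, m (t, p)) (f := Prod.snd)
        ((contDiffAt_R hμ).differentiableAt (by simp)).hasFDerivAt hasFDerivAt_snd
    rw [(h1.clm_apply (differentiableAt_a hpQ hμ).hasFDerivAt).fderiv]
    simp [add_comm]
  have hZm {t : ℝ} (ht : t ∈ Ioo (-2 : ℝ) 2) : fderiv ℝ (fun q ↦ Z (q, m (t, q))) p u =
      fderiv ℝ Z (p, m (t, p)) (u, fderiv ℝ (fun q ↦ m (t, q)) p u) := by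
    have hz : DifferentiableAt ℝ Z (p, m (t, p)) :=
      (hZ.contDiffAt (D.isOpen_dom.mem_nhds ⟨⟨hpQ, trivial⟩, hS.mem t ht p hp⟩)).differentiableAt
        (by simp)
    have h1 := HasFDerivAt.comp p (f := fun q ↦ (q, m (t, q))) hz.hasFDerivAt
      ((hasFDerivAt_id p).prodMk
        ((hS.contDiffAt_m_slice ht hp).differentiableAt (by simp)).hasFDerivAt)
    rw [HasFDerivAt.fderiv (f := fun q ↦ Z (q, m (t, q))) h1]
    rfl
  have hm := hS.continuousOn_m hp
  -- Both sides solve the linearized flow equation `∂_t X = dZ(u, X)`. For `R(m) Ψ` this uses `R_C`: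
  -- the term `-R(C(α, β))` from the transport exchanges the derivative of `R` along `R α`, applied
  -- to `β`, for the derivative along `R β`, applied to `α`. The hypothesis `huc` is equality at
  -- time 0.
  refine eqOn_of_hasDerivAt_linear (f := fun t ↦ fderiv ℝ (fun q ↦ m (t, q)) p u)
    (g := fun t ↦ D.R (m (t, p)) (Ψ (t, p) (u, c))) (t₀ := 0)
    (L := fun t ↦ fderiv ℝ Z (p, m (t, p)) ∘L ContinuousLinearMap.inr ℝ (Q × G) E)
    (h := fun t ↦ fderiv ℝ Z (p, m (t, p)) (u, 0)) ?_ (by norm_num) ?_ ?_ ?_ ht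
  · have h1 := (hZ.fderiv_of_isOpen (m := ∞) D.isOpen_dom (by simp)).continuousOn.comp
      (continuousOn_const.prodMk hm) (fun t ht ↦ ⟨⟨hpQ, trivial⟩, hS.mem t ht p hp⟩)
    exact h1.clm_comp continuousOn_const
  · intro t ht
    have h1 := hasDerivAt_fderiv_slice hS.isOpen_domain hS.contDiffOn_m
      (k := fun z ↦ Z (z.2, m z)) (fun t q h ↦ hS.hasDerivAt_m t h.1 q h.2) (t := t) (p := p)
      ⟨ht, hp⟩ u
    refine h1.congr_deriv ?_
    rw [hZm ht]
    simp only [ContinuousLinearMap.comp_apply, ContinuousLinearMap.inr_apply, ← map_add]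
    congr 1
    simp
  · intro t ht
    have hμ := hS.mem t ht p hp
    have h1 : HasDerivAt (fun t ↦ D.R (m (t, p))) _ t :=
      ((contDiffAt_R hμ).differentiableAt (by simp)).hasFDerivAt.comp_hasDerivAt t
        (hS.hasDerivAt_m t ht p hp)
    refine (h1.clm_apply (hS.hasDerivAt_Ψ t ht p hp (u, c))).congr_deriv ?_
    simp only [ContinuousLinearMap.comp_apply, ContinuousLinearMap.inr_apply, ← map_add,
      Prod.mk_add_mk, zero_add, add_zero]
    rw [hZd ht, rhs, map_sub, D.R_C _ hμ]
    abel
  · have h1 : (fun q ↦ m (0, q)) =ᶠ[𝓝 p] fun q ↦ D.j q.1 := by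
      filter_upwards [hS.isOpen.mem_nhds hp] with q hq using hS.m_zero q hq
    have h2 : HasFDerivAt (fun q : Q × G ↦ D.j q.1)
        (fderiv ℝ D.j p.1 ∘L ContinuousLinearMap.fst ℝ Q G) p :=
      HasFDerivAt.comp p (f := Prod.fst) ((D.contDiffOn_j.contDiffAt
        (D.isOpen_domQ.mem_nhds hpQ)).differentiableAt (by simp)).hasFDerivAt hasFDerivAt_fst
    change fderiv ℝ (fun q ↦ m (0, q)) p u = D.R (m (0, p)) (Ψ (0, p) (u, c))
    rw [h1.fderiv_eq, h2.fderiv, hS.m_zero p hp, hS.Ψ_zero p hp]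
    exact huc

/-- The section attached to a point of the zero section is zero, so its flow is stationary. -/
theorem m_zeroSection (hS : D.IsSolution N m Ψ) {ξ : Q} (hξ : (ξ, 0) ∈ N) {t : ℝ} (ht : t ∈ Ioo (-2 : ℝ) 2) :
    m (t, (ξ, 0)) = D.j ξ := by
  have h1 := eqOn_of_hasDerivAt_const (f := fun s ↦ m (s, (ξ, 0))) (v := 0) (t₀ := 0)
    (by norm_num) (fun t ht ↦ by
      have h := hS.hasDerivAt_m t ht _ hξ
      rwa [a_zero (hS.subset _ hξ) (hS.mem t ht _ hξ), map_zero] at h) ht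
  simpa [hS.m_zero _ hξ] using h1

/-- Over the zero section `α = 0` and `m` is constant, so the right-hand side of the transport
equation is the constant `a((ξ, u.2), j ξ)`. -/
theorem Ψ_zeroSection (hS : D.IsSolution N m Ψ) {ξ : Q} (hξ : (ξ, 0) ∈ N) {t : ℝ} (ht : t ∈ Ioo (-2 : ℝ) 2)
    (u : Q × G) (c : F) : Ψ (t, (ξ, 0)) (u, c) = c + t • D.a ((ξ, u.2), D.j ξ) := by
  have h1 := eqOn_of_hasDerivAt_const (f := fun s ↦ Ψ (s, (ξ, 0)) (u, c))
    (v := D.a ((ξ, u.2), D.j ξ)) (t₀ := 0)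
    (by norm_num) (fun t ht ↦ by
      have h := hS.hasDerivAt_Ψ t ht _ hξ (u, c)
      have hμ := hS.mem t ht _ hξ
      rw [hS.m_zeroSection hξ ht] at hμ
      rw [rhs, hS.m_zeroSection hξ ht, a_zero (hS.subset _ hξ) hμ,
        fderiv_a_zero (hS.subset _ hξ) hμ] at h
      simpa using h) ht
  simpa [hS.Ψ_zero _ hξ] using h1

theorem contDiffAt_a_slice (hS : D.IsSolution N m Ψ) {t : ℝ} (ht : t ∈ Ioo (-2 : ℝ) 2) {p : Q × G} (hp : p ∈ N) :
    ContDiffAt ℝ ∞ (fun q ↦ D.a (q, m (t, q))) p :=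
  (contDiffAt_a (hS.subset p hp) (hS.mem t ht p hp)).comp p
    (contDiffAt_id.prodMk (hS.contDiffAt_m_slice ht hp))

theorem fderiv_a_slice (hS : D.IsSolution N m Ψ) {t : ℝ} (ht : t ∈ Ioo (-2 : ℝ) 2) {p : Q × G} (hp : p ∈ N) (w : Q × G) :
    fderiv ℝ (fun q ↦ D.a (q, m (t, q))) p w =
      fderiv ℝ D.a (p, m (t, p)) (w, fderiv ℝ (fun q ↦ m (t, q)) p w) := by
  have h := HasFDerivAt.comp p (f := fun q ↦ (q, m (t, q)))
    (differentiableAt_a (hS.subset p hp) (hS.mem t ht p hp)).hasFDerivAt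
    ((hasFDerivAt_id p).prodMk
      ((hS.contDiffAt_m_slice ht hp).differentiableAt (by simp)).hasFDerivAt)
  rw [HasFDerivAt.fderiv (f := fun q ↦ D.a (q, m (t, q))) h]
  rfl

set_option synthInstance.maxHeartbeats 200000 in
/-- The time derivative of the derivative of the transport of a section. -/
theorem hasDerivAt_fderiv_Ψ (hS : D.IsSolution N m Ψ) {N' : Set (Q × G)} (hN' : IsOpen N') (hN'N : N' ⊆ N) {p : Q × G}
    (hp : p ∈ N') {u : Q × G → Q × G} {c : Q × G → F} (hu : ContDiffOn ℝ ∞ u N')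
    (hc : ContDiffOn ℝ ∞ c N')
    (h : ∀ q ∈ N', fderiv ℝ D.j q.1 (u q).1 = D.R (D.j q.1) (c q)) {t : ℝ}
    (ht : t ∈ Ioo (-2 : ℝ) 2) (v : Q × G) :
    HasDerivAt (fun s ↦ fderiv ℝ (fun q ↦ Ψ (s, q) (u q, c q)) p v)
      (fderiv ℝ (fderiv ℝ (fun q ↦ D.a (q, m (t, q)))) p v (u p) +
        fderiv ℝ (fun q ↦ D.a (q, m (t, q))) p (fderiv ℝ u p v) -
        (fderiv ℝ D.C (m (t, p)) (fderiv ℝ (fun q ↦ m (t, q)) p v) (D.a (p, m (t, p)))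
            (Ψ (t, p) (u p, c p)) +
          D.C (m (t, p)) (fderiv ℝ (fun q ↦ D.a (q, m (t, q))) p v) (Ψ (t, p) (u p, c p)) +
          D.C (m (t, p)) (D.a (p, m (t, p))) (fderiv ℝ (fun q ↦ Ψ (t, q) (u q, c q)) p v))) t := by
  have hpN := hN'N hp
  have hDom : IsOpen (Ioo (-2 : ℝ) 2 ×ˢ N') := isOpen_Ioo.prod hN'
  have hg : ContDiffOn ℝ ∞ (fun z : ℝ × (Q × G) ↦ Ψ z (u z.2, c z.2)) (Ioo (-2) 2 ×ˢ N') :=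
    (hS.contDiffOn_Ψ.mono (prod_mono le_rfl hN'N)).clm_apply
      ((hu.comp contDiffOn_snd fun z hz ↦ hz.2).prodMk (hc.comp contDiffOn_snd fun z hz ↦ hz.2))
  have hd := hasDerivAt_fderiv_slice hDom hg
    (k := fun z ↦ D.rhs z.2 (m z) (u z.2) (Ψ z (u z.2, c z.2)))
    (fun t q h ↦ hS.hasDerivAt_Ψ t h.1 q (hN'N h.2) (u q, c q)) (t := t) (p := p) ⟨ht, hp⟩ v
  refine hd.congr_deriv ?_
  have hα := hS.contDiffAt_a_slice ht hpN
  -- By `fderiv_m` the vector `R β` in the right-hand side is the derivative of `m` along `u`. So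
  -- near `p` the right-hand side is `dα(u) - C(α, β)` with `α` a function of the parameter alone,
  -- and can be differentiated by the product rule.
  have hev : (fun q ↦ D.rhs q (m (t, q)) (u q) (Ψ (t, q) (u q, c q))) =ᶠ[𝓝 p]
      fun q ↦ fderiv ℝ (fun q ↦ D.a (q, m (t, q))) q (u q) -
        D.C (m (t, q)) (D.a (q, m (t, q))) (Ψ (t, q) (u q, c q)) := by
    filter_upwards [hN'.mem_nhds hp] with q hq
    rw [hS.fderiv_a_slice ht (hN'N hq), hS.fderiv_m (hN'N hq) (h q hq) ht, rhs]
  have d1 : HasFDerivAt u (fderiv ℝ u p) p :=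
    ((hu.contDiffAt (hN'.mem_nhds hp)).differentiableAt (by simp)).hasFDerivAt
  have d2 : HasFDerivAt (fderiv ℝ (fun q ↦ D.a (q, m (t, q)))) _ p :=
    ((hα.fderiv_right (m := 1) two_le_infty).differentiableAt (by simp)).hasFDerivAt
  have d3 : HasFDerivAt (fun q ↦ D.a (q, m (t, q))) _ p :=
    (hα.differentiableAt (by simp)).hasFDerivAt
  have d4 : HasFDerivAt (fun q ↦ D.C (m (t, q))) _ p :=
    HasFDerivAt.comp p (f := fun q ↦ m (t, q))
      ((contDiffAt_C (hS.mem t ht p hpN)).differentiableAt (by simp)).hasFDerivAt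
      ((hS.contDiffAt_m_slice ht hpN).differentiableAt (by simp)).hasFDerivAt
  have d5 : HasFDerivAt (fun q ↦ Ψ (t, q) (u q, c q)) _ p :=
    (((hS.contDiffAt_Ψ_slice ht hpN).clm_apply ((hu.contDiffAt (hN'.mem_nhds hp)).prodMk
      (hc.contDiffAt (hN'.mem_nhds hp)))).differentiableAt (by simp)).hasFDerivAt
  have d6 := ((d2.clm_apply d1).sub ((d4.clm_apply d3).clm_apply d5)).congr_of_eventuallyEq hev
  change fderiv ℝ (fun q ↦ D.rhs q (m (t, q)) (u q) (Ψ (t, q) (u q, c q))) p v = _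
  rw [d6.fderiv]
  simp only [sub_apply, add_apply, ContinuousLinearMap.comp_apply,
    ContinuousLinearMap.flip_apply]
  abel

set_option synthInstance.maxHeartbeats 200000 in
/-- The transport is compatible with brackets. -/
theorem Ψ_bracket (hS : D.IsSolution N m Ψ) {N' : Set (Q × G)} (hN' : IsOpen N') (hN'N : N' ⊆ N) {p : Q × G} (hp : p ∈ N')
    {u₁ u₂ : Q × G → Q × G} {c₁ c₂ : Q × G → F} (hu₁ : ContDiffOn ℝ ∞ u₁ N')
    (hu₂ : ContDiffOn ℝ ∞ u₂ N') (hc₁ : ContDiffOn ℝ ∞ c₁ N') (hc₂ : ContDiffOn ℝ ∞ c₂ N')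
    (h₁ : ∀ q ∈ N', fderiv ℝ D.j q.1 (u₁ q).1 = D.R (D.j q.1) (c₁ q))
    (h₂ : ∀ q ∈ N', fderiv ℝ D.j q.1 (u₂ q).1 = D.R (D.j q.1) (c₂ q))
    {t : ℝ} (ht : t ∈ Ioo (-2 : ℝ) 2) :
    fderiv ℝ (fun q ↦ Ψ (t, q) (u₂ q, c₂ q)) p (u₁ p) -
        fderiv ℝ (fun q ↦ Ψ (t, q) (u₁ q, c₁ q)) p (u₂ p) +
        D.C (m (t, p)) (Ψ (t, p) (u₁ p, c₁ p)) (Ψ (t, p) (u₂ p, c₂ p)) =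
      Ψ (t, p) (fderiv ℝ u₂ p (u₁ p) - fderiv ℝ u₁ p (u₂ p),
        fderiv ℝ c₂ p (u₁ p) - fderiv ℝ c₁ p (u₂ p) + D.C (D.j p.1) (c₁ p) (c₂ p)) := by
  have hpN := hN'N hp
  have hd {V : Type _} [NormedAddCommGroup V] [NormedSpace ℝ V] {f : Q × G → V}
      (hf : ContDiffOn ℝ ∞ f N') : DifferentiableAt ℝ f p :=
    (hf.contDiffAt (hN'.mem_nhds hp)).differentiableAt (by simp)
  have hβ {u : Q × G → Q × G} {c : Q × G → F} (hu : ContDiffOn ℝ ∞ u N')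
      (hc : ContDiffOn ℝ ∞ c N') {t : ℝ} (ht : t ∈ Ioo (-2 : ℝ) 2) :
      DifferentiableAt ℝ (fun q ↦ Ψ (t, q) (u q, c q)) p :=
    (((hS.contDiffAt_Ψ_slice ht hpN).clm_apply ((hu.contDiffAt (hN'.mem_nhds hp)).prodMk
      (hc.contDiffAt (hN'.mem_nhds hp)))).differentiableAt (by simp))
  have hmβ {u : Q × G → Q × G} {c : Q × G → F}
      (h : ∀ q ∈ N', fderiv ℝ D.j q.1 (u q).1 = D.R (D.j q.1) (c q)) {t : ℝ}
      (ht : t ∈ Ioo (-2 : ℝ) 2) : ∀ᶠ q in 𝓝 p,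
        fderiv ℝ (fun q ↦ m (t, q)) q (u q) = D.R (m (t, q)) (Ψ (t, q) (u q, c q)) := by
    filter_upwards [hN'.mem_nhds hp] with q hq using hS.fderiv_m (hN'N hq) (h q hq) ht
  -- The left side, the bracket of the two transported sections, is shown to solve the transport
  -- equation with tangent vector the bracket of `u₁` and `u₂`. The right side solves it by
  -- definition.
  refine hS.transport_unique hpN (u := fderiv ℝ u₂ p (u₁ p) - fderiv ℝ u₁ p (u₂ p))
    (f := fun t ↦ fderiv ℝ (fun q ↦ Ψ (t, q) (u₂ q, c₂ q)) p (u₁ p) -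
        fderiv ℝ (fun q ↦ Ψ (t, q) (u₁ q, c₁ q)) p (u₂ p) +
        D.C (m (t, p)) (Ψ (t, p) (u₁ p, c₁ p)) (Ψ (t, p) (u₂ p, c₂ p)))
    (g := fun t ↦ Ψ (t, p) (fderiv ℝ u₂ p (u₁ p) - fderiv ℝ u₁ p (u₂ p),
        fderiv ℝ c₂ p (u₁ p) - fderiv ℝ c₁ p (u₂ p) + D.C (D.j p.1) (c₁ p) (c₂ p)))
    ?_ (fun t ht ↦ hS.hasDerivAt_Ψ t ht p hpN _) ?_ ht
  · intro t ht
    have hμ := hS.mem t ht p hpN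
    have hα := hS.contDiffAt_a_slice ht hpN
    have hC : HasDerivAt (fun s ↦ D.C (m (s, p)))
        (fderiv ℝ D.C (m (t, p)) (D.R (m (t, p)) (D.a (p, m (t, p))))) t :=
      HasFDerivAt.comp_hasDerivAt t (l := D.C) (f := fun s ↦ m (s, p))
        ((contDiffAt_C hμ).differentiableAt (by simp)).hasFDerivAt (hS.hasDerivAt_m t ht p hpN)
    refine (((hS.hasDerivAt_fderiv_Ψ hN' hN'N hp hu₂ hc₂ h₂ ht (u₁ p)).sub
      (hS.hasDerivAt_fderiv_Ψ hN' hN'N hp hu₁ hc₁ h₁ ht (u₂ p))).add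
      ((hC.clm_apply (hS.hasDerivAt_Ψ t ht p hpN (u₁ p, c₁ p))).clm_apply
        (hS.hasDerivAt_Ψ t ht p hpN (u₂ p, c₂ p)))).congr_deriv ?_
    have hsymm := (hα.isSymmSndFDerivAt (by simpa using two_le_infty)).eq (u₁ p) (u₂ p)
    have m1 := hS.fderiv_m hpN (h₁ p hp) ht
    have m2 := hS.fderiv_m hpN (h₂ p hp) ht
    have a1 := hS.fderiv_a_slice ht hpN (u₁ p)
    have a2 := hS.fderiv_a_slice ht hpN (u₂ p)
    rw [m1] at a1
    rw [m2] at a2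
    -- The second derivatives of `α` cancel by symmetry (`hsymm`), and `hb` identifies the
    -- derivative of `α` along the bracket of `u₁` and `u₂`, using that this bracket is mapped by
    -- `dm` to the anchor of the transported bracket. What is left is quadratic in `C` or contains
    -- derivatives of `C`, and vanishes by the Jacobi identity for `α`, `β₁`, `β₂`.
    have hJ := D.jacobi _ hμ (D.a (p, m (t, p))) (Ψ (t, p) (u₁ p, c₁ p)) (Ψ (t, p) (u₂ p, c₂ p))
    have hsw := D.C_swap _ hμ (fderiv ℝ (fun q ↦ D.a (q, m (t, q))) p (u₂ p))
      (Ψ (t, p) (u₁ p, c₁ p))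
    have hb := hS.fderiv_a_slice ht hpN (fderiv ℝ u₂ p (u₁ p) - fderiv ℝ u₁ p (u₂ p))
    rw [fderiv_eq_R_bracket (M := fun q ↦ m (t, q)) (p := p) hμ (hS.contDiffAt_m_slice ht hpN) (hd hu₁) (hd hu₂) (hβ hu₁ hc₁ ht)
      (hβ hu₂ hc₂ ht) (hmβ h₁ ht) (hmβ h₂ ht), map_sub] at hb
    simp only [rhs]
    rw [← hb, ← a1, ← a2, m1, m2, hsymm]
    simp only [map_add, map_sub, add_apply, sub_apply]
    linear_combination (norm := abel) hJ + hsw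
  -- At time 0 the transport is the projection to the fibre component, and both sides are the fibre
  -- component of the bracket of the initial data.
  · have h0 {u : Q × G → Q × G} {c : Q × G → F} :
        (fun q ↦ Ψ (0, q) (u q, c q)) =ᶠ[𝓝 p] c := by
      filter_upwards [hN'.mem_nhds hp] with q hq
      rw [hS.Ψ_zero q (hN'N hq)]
      rfl
    simp only [h0.fderiv_eq, hS.Ψ_zero p hpN, hS.m_zero p hpN, ContinuousLinearMap.coe_snd']

end IsSolution

end LocalFamily

/-! ### Charts of the total space of a vector bundle. -/

section VectorBundleChart

variable {E : Type*} [NormedAddCommGroup E] [NormedSpace ℝ E]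
  {H : Type*} [TopologicalSpace H] (I : ModelWithCorners ℝ E H) [I.Boundaryless]
  {X : Type*} [TopologicalSpace X] [ChartedSpace H X] [IsManifold I ∞ X]
  (G : Type*) [NormedAddCommGroup G] [NormedSpace ℝ G]
  (W : X → Type*) [∀ x, AddCommGroup (W x)] [∀ x, Module ℝ (W x)]
  [∀ x, TopologicalSpace (W x)] [TopologicalSpace (TotalSpace G W)]
  [FiberBundle G W] [VectorBundle ℝ G W] [ContMDiffVectorBundle ∞ G W I]
  (x₀ : X)

/-- The chart of the total space of a vector bundle given by a chart of the base and a
trivialization around `x₀`. -/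
noncomputable def vbChart (w : TotalSpace G W) : E × G :=
  (extChartAt I x₀ w.proj, (trivializationAt G W x₀).continuousLinearMapAt ℝ w.proj w.2)

/-- The inverse of `vbChart`. -/
noncomputable def vbChartSymm (p : E × G) : TotalSpace G W :=
  ⟨(extChartAt I x₀).symm p.1, (trivializationAt G W x₀).symmL ℝ ((extChartAt I x₀).symm p.1) p.2⟩

/-- The subset of the base over which `vbChart` is defined. -/
def vbSource : Set X := (extChartAt I x₀).source ∩ (trivializationAt G W x₀).baseSet

/-- The image of `vbSource` in the chart of the base. -/
def vbTarget : Set E :=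
  (extChartAt I x₀).target ∩ (extChartAt I x₀).symm ⁻¹' (trivializationAt G W x₀).baseSet

theorem isOpen_vbSource : IsOpen (vbSource I G W x₀) :=
  (isOpen_extChartAt_source x₀).inter (Trivialization.open_baseSet _)

theorem mem_vbSource : x₀ ∈ vbSource I G W x₀ :=
  ⟨mem_extChartAt_source x₀, FiberBundle.mem_baseSet_trivializationAt' x₀⟩

theorem isOpen_vbTarget : IsOpen (vbTarget I G W x₀) :=
  (continuousOn_extChartAt_symm x₀).isOpen_inter_preimage (isOpen_extChartAt_target x₀)
    (Trivialization.open_baseSet _)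

variable {I G W x₀}

theorem vbChart_mem_vbTarget {w : TotalSpace G W} (hw : w.proj ∈ vbSource I G W x₀) :
    (vbChart I G W x₀ w).1 ∈ vbTarget I G W x₀ :=
  ⟨(extChartAt I x₀).map_source hw.1, by
    change (extChartAt I x₀).symm (extChartAt I x₀ w.proj) ∈ (trivializationAt G W x₀).baseSet
    rw [(extChartAt I x₀).left_inv hw.1]; exact hw.2⟩

theorem vbChartSymm_mem_vbSource {p : E × G} (hp : p.1 ∈ vbTarget I G W x₀) :
    (vbChartSymm I G W x₀ p).proj ∈ vbSource I G W x₀ :=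
  ⟨(extChartAt I x₀).map_target hp.1, hp.2⟩

theorem vbChartSymm_vbChart {w : TotalSpace G W} (hw : w.proj ∈ vbSource I G W x₀) :
    vbChartSymm I G W x₀ (vbChart I G W x₀ w) = w := by
  obtain ⟨x, y⟩ := w
  have h1 : (extChartAt I x₀).symm (extChartAt I x₀ x) = x := (extChartAt I x₀).left_inv hw.1
  have h2 (z : X) (hz : z = x) (v : G) :
      (⟨z, (trivializationAt G W x₀).symmL ℝ z v⟩ : TotalSpace G W) =
        ⟨x, (trivializationAt G W x₀).symmL ℝ x v⟩ := by
    subst hz; rfl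
  exact (h2 _ h1 _).trans
    (congrArg (TotalSpace.mk x) ((trivializationAt G W x₀).symmL_continuousLinearMapAt hw.2 y))

theorem vbChart_vbChartSymm {p : E × G} (hp : p.1 ∈ vbTarget I G W x₀) :
    vbChart I G W x₀ (vbChartSymm I G W x₀ p) = p := by
  exact Prod.ext ((extChartAt I x₀).right_inv hp.1)
    ((trivializationAt G W x₀).continuousLinearMapAt_symmL hp.2 p.2)

theorem vbChart_smul (x : X) (y : W x) (r : ℝ) : vbChart I G W x₀ ⟨x, r • y⟩ =
    ((vbChart I G W x₀ ⟨x, y⟩).1, r • (vbChart I G W x₀ ⟨x, y⟩).2) := by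
  simp [vbChart]

theorem vbChart_zeroSection (x : X) : vbChart I G W x₀ (zeroSection G W x) =
    (extChartAt I x₀ x, 0) := by
  exact Prod.ext rfl (map_zero ((trivializationAt G W x₀).continuousLinearMapAt ℝ x))

theorem contMDiffAt_vbChart {w : TotalSpace G W} (hw : w.proj ∈ vbSource I G W x₀) :
    ContMDiffAt (I.prod 𝓘(ℝ, G)) 𝓘(ℝ, E × G) ∞ (vbChart I G W x₀) w := by
  have hp : ContMDiffAt (I.prod 𝓘(ℝ, G)) I ∞ (TotalSpace.proj : TotalSpace G W → X) w :=
    (Bundle.contMDiff_proj W).contMDiffAt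
  refine ContMDiffAt.prodMk_space ?_ ?_
  · exact (contMDiffAt_extChartAt' (by simpa using hw.1)).comp w hp
  · exact contMDiffAt_coord (f := TotalSpace.proj) (a := fun w : TotalSpace G W ↦ w.2)
      (trivializationAt G W x₀) contMDiffAt_id hw.2

theorem contMDiffAt_vbChartSymm {p : E × G} (hp : p.1 ∈ vbTarget I G W x₀) :
    ContMDiffAt 𝓘(ℝ, E × G) (I.prod 𝓘(ℝ, G)) ∞ (vbChartSymm I G W x₀) p := by
  have h1 : ContMDiffAt 𝓘(ℝ, E) I ∞ (extChartAt I x₀).symm p.1 :=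
    (contMDiffOn_extChartAt_symm x₀).contMDiffAt ((isOpen_extChartAt_target x₀).mem_nhds hp.1)
  exact contMDiffAt_symmL (trivializationAt G W x₀)
    (f := fun p : E × G ↦ (extChartAt I x₀).symm p.1) (w := fun p : E × G ↦ p.2)
    (h1.comp p contDiff_fst.contMDiff.contMDiffAt) contDiff_snd.contMDiff.contMDiffAt hp.2

theorem vbChartSymm_smul (ξ : E) (y : G) (r : ℝ) : vbChartSymm I G W x₀ (ξ, r • y) =
    ⟨(vbChartSymm I G W x₀ (ξ, y)).proj, r • (vbChartSymm I G W x₀ (ξ, y)).2⟩ := by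
  exact congrArg (TotalSpace.mk _) (map_smul _ r y)

end VectorBundleChart

/-! ### Derivatives and velocities read in charts. -/

section ManifoldCalculus

variable {E : Type*} [NormedAddCommGroup E] [NormedSpace ℝ E]
  {H : Type*} [TopologicalSpace H] {I : ModelWithCorners ℝ E H}
  {M : Type*} [TopologicalSpace M] [ChartedSpace H M]
  {E' : Type*} [NormedAddCommGroup E'] [NormedSpace ℝ E']
  {H' : Type*} [TopologicalSpace H'] {I' : ModelWithCorners ℝ E' H'}
  {N : Type*} [TopologicalSpace N] [ChartedSpace H' N]
  {P Q : Type*} [NormedAddCommGroup P] [NormedSpace ℝ P] [NormedAddCommGroup Q] [NormedSpace ℝ Q]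

theorem mvfderiv_fderiv_comp {g : P → Q} {f : M → P} {x : M} (hg : DifferentiableAt ℝ g (f x))
    (hf : MDifferentiableAt I 𝓘(ℝ, P) f x) (u : TangentSpace I x) :
    mvfderiv I (fun z ↦ g (f z)) x u = fderiv ℝ g (f x) (mvfderiv I f x u) := by
  rw [mvfderiv_comp_apply' hg.mdifferentiableAt hf]
  change mfderiv 𝓘(ℝ, P) 𝓘(ℝ, Q) g (f x) _ = _
  rw [mfderiv_eq_fderiv]
  rfl

theorem HasMFDerivAt.hasDerivAt_comp {γ : ℝ → M} {t : ℝ} {v : TangentSpace I (γ t)}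
    (hγ : HasMFDerivAt 𝓘(ℝ, ℝ) I γ t ((1 : ℝ →L[ℝ] ℝ).smulRight v)) {g : M → P}
    (hg : MDifferentiableAt I 𝓘(ℝ, P) g (γ t)) :
    HasDerivAt (fun s ↦ g (γ s)) (mvfderiv I g (γ t) v) t := by
  have h : HasFDerivAt (fun s ↦ g (γ s))
      ((mvfderiv I g (γ t)).comp ((1 : ℝ →L[ℝ] ℝ).smulRight v)) t :=
    (hg.hasMFDerivAt.comp t hγ).hasFDerivAt
  refine h.hasDerivAt.congr_deriv ?_
  change mvfderiv I g (γ t) ((1 : ℝ) • v) = _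
  rw [one_smul]

variable [IsManifold I ∞ M]

theorem mvfderiv_extChartAt_bijective {m₀ m : M} (hm : m ∈ (extChartAt I m₀).source) :
    Function.Bijective (mvfderiv I (extChartAt I m₀) m) := by
  have : IsManifold I 1 M := .of_le (n := ∞) (by simp)
  exact (isInvertible_mfderiv_extChartAt hm).bijective

variable [I.Boundaryless]

theorem mfderiv_symm_mvfderiv_extChartAt {m₀ m : M} (hm : m ∈ (extChartAt I m₀).source)
    (v : TangentSpace I m) : mfderiv 𝓘(ℝ, E) I (extChartAt I m₀).symm (extChartAt I m₀ m)
      (mvfderiv I (extChartAt I m₀) m v) = v := by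
  have : IsManifold I 1 M := .of_le (n := ∞) (by simp)
  have h := mfderivWithin_extChartAt_symm_comp_mfderiv_extChartAt' hm
  rw [I.range_eq_univ, mfderivWithin_univ] at h
  exact DFunLike.congr_fun h v

theorem contMDiffAt_extChartAt_symm {m₀ : M} {μ : E} (hμ : μ ∈ (extChartAt I m₀).target) :
    ContMDiffAt 𝓘(ℝ, E) I ∞ (extChartAt I m₀).symm μ :=
  (contMDiffOn_extChartAt_symm m₀).contMDiffAt ((isOpen_extChartAt_target m₀).mem_nhds hμ)

/-- The velocity of a curve can be computed in a chart. -/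
theorem hasMFDerivAt_extChartAt_symm_comp {m₀ : M} {μ : ℝ → E} {t : ℝ}
    (hμ : μ t ∈ (extChartAt I m₀).target) {v : TangentSpace I ((extChartAt I m₀).symm (μ t))}
    (h : HasDerivAt μ (mvfderiv I (extChartAt I m₀) ((extChartAt I m₀).symm (μ t)) v) t) :
    HasMFDerivAt 𝓘(ℝ, ℝ) I (fun s ↦ (extChartAt I m₀).symm (μ s)) t
      ((1 : ℝ →L[ℝ] ℝ).smulRight v) := by
  have h1 := ((contMDiffAt_extChartAt_symm hμ).mdifferentiableAt (by simp)).hasMFDerivAt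
  have h2 := h1.comp t h.hasFDerivAt.hasMFDerivAt
  have h3 := mfderiv_symm_mvfderiv_extChartAt ((extChartAt I m₀).map_target hμ) v
  rw [(extChartAt I m₀).right_inv hμ] at h3
  refine h2.congr_mfderiv ?_
  refine (ContinuousLinearMap.ext fun (r : ℝ) ↦ ?_ : (_ : ℝ →L[ℝ] E) = _)
  symm
  change r • v = mfderiv 𝓘(ℝ, E) I (extChartAt I m₀).symm (μ t) (r •
    mvfderiv I (extChartAt I m₀) ((extChartAt I m₀).symm (μ t)) v)
  exact ((ContinuousLinearMap.map_smul (mfderiv 𝓘(ℝ, E) I (extChartAt I m₀).symm (μ t)) r _).trans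
    (congrArg (r • ·) h3)).symm

theorem mvfderiv_vbChart_bijective
    {G : Type*} [NormedAddCommGroup G] [NormedSpace ℝ G]
    {W : M → Type*} [∀ x, AddCommGroup (W x)] [∀ x, Module ℝ (W x)]
    [∀ x, TopologicalSpace (W x)] [TopologicalSpace (TotalSpace G W)]
    [FiberBundle G W] [VectorBundle ℝ G W] [ContMDiffVectorBundle ∞ G W I]
    {x₀ : M} {w : TotalSpace G W} (hw : w.proj ∈ vbSource I G W x₀) :
    Function.Bijective (mvfderiv (I.prod 𝓘(ℝ, G)) (vbChart I G W x₀) w) := by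
  have hχ := (contMDiffAt_vbChart hw).mdifferentiableAt (by simp)
  have hp := vbChart_mem_vbTarget hw
  have hs := (contMDiffAt_vbChartSymm hp).mdifferentiableAt (by simp)
  have hinv := vbChartSymm_vbChart hw
  have hO : ∀ᶠ w' in 𝓝 w, w'.proj ∈ vbSource I G W x₀ :=
    (FiberBundle.continuous_proj G W).continuousAt.preimage_mem_nhds
      ((isOpen_vbSource I G W x₀).mem_nhds hw)
  have hO' : ∀ᶠ p : E × G in 𝓝 (vbChart I G W x₀ w), p.1 ∈ vbTarget I G W x₀ :=
    continuousAt_fst.preimage_mem_nhds ((isOpen_vbTarget I G W x₀).mem_nhds hp)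
  constructor
  · refine Function.LeftInverse.injective (g := mfderiv 𝓘(ℝ, E × G) (I.prod 𝓘(ℝ, G))
      (vbChartSymm I G W x₀) (vbChart I G W x₀ w)) fun u ↦ ?_
    have h := mfderiv_comp_apply w hs hχ u
    have h2 : vbChartSymm I G W x₀ ∘ vbChart I G W x₀ =ᶠ[𝓝 w] id :=
      hO.mono fun w' hw' ↦ vbChartSymm_vbChart hw'
    rw [h2.mfderiv_eq, mfderiv_id] at h
    exact h.symm
  · refine Function.RightInverse.surjective (g := mfderiv 𝓘(ℝ, E × G) (I.prod 𝓘(ℝ, G))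
      (vbChartSymm I G W x₀) (vbChart I G W x₀ w)) fun u ↦ ?_
    have h := mfderiv_comp_apply (vbChart I G W x₀ w) (by rwa [hinv]) hs u
    have h2 : vbChart I G W x₀ ∘ vbChartSymm I G W x₀ =ᶠ[𝓝 (vbChart I G W x₀ w)] id :=
      hO'.mono fun p hp ↦ vbChart_vbChartSymm hp
    rw [h2.mfderiv_eq, mfderiv_id, hinv] at h
    exact h.symm

end ManifoldCalculus

/-! ### Existence of a transverse family of sections. -/

section Family

variable {EM : Type*} [NormedAddCommGroup EM] [NormedSpace ℝ EM] [FiniteDimensional ℝ EM]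
  {HM : Type*} [TopologicalSpace HM] {IM : ModelWithCorners ℝ EM HM} [IM.Boundaryless]
  {M : Type*} [TopologicalSpace M] [ChartedSpace HM M] [IsManifold IM ∞ M]
  [T2Space M]
  {F : Type*} [NormedAddCommGroup F] [NormedSpace ℝ F] [FiniteDimensional ℝ F]
  {V : M → Type*} [∀ x, AddCommGroup (V x)] [∀ x, Module ℝ (V x)]
  [∀ x, TopologicalSpace (V x)] [TopologicalSpace (TotalSpace F V)]
  [FiberBundle F V] [VectorBundle ℝ F V] [ContMDiffVectorBundle ∞ F V IM]
  {A : LieAlgebroid IM F V}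
  {EX : Type*} [NormedAddCommGroup EX] [NormedSpace ℝ EX] [FiniteDimensional ℝ EX]
  {HX : Type*} [TopologicalSpace HX] {IX : ModelWithCorners ℝ EX HX} [IX.Boundaryless]
  {X : Type*} [TopologicalSpace X] [ChartedSpace HX X] [IsManifold IX ∞ X]
  {i : A.TransverseMap IX X}
  {G : Type*} [NormedAddCommGroup G] [NormedSpace ℝ G] [FiniteDimensional ℝ G]
  {W : X → Type*} [∀ x, AddCommGroup (W x)] [∀ x, Module ℝ (W x)]
  [∀ x, TopologicalSpace (W x)] [TopologicalSpace (TotalSpace G W)]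
  [FiberBundle G W] [VectorBundle ℝ G W] [ContMDiffVectorBundle ∞ G W IX]

namespace TubularNeighborhood

variable (ψ : TubularNeighborhood IM IX i G W)

theorem contMDiff : ContMDiff (IX.prod 𝓘(ℝ, G)) IM ∞ ψ.toFun := ψ.isLocalDiffeomorph.contMDiff

/-- The velocity at `0` of the curve `r ↦ ψ (r y)`, for `y` in the fibre over `x`. -/
noncomputable def vert (x : X) (y : W x) : TangentSpace IM (i x) :=
  mfderiv 𝓘(ℝ, ℝ) IM (fun r : ℝ ↦ ψ.toFun ⟨x, r • y⟩) 0 (1 : ℝ)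

/-- The map `ψ` read in charts around `x₀` and `i x₀`. -/
noncomputable def inCharts (x₀ : X) (p : EX × G) : EM :=
  extChartAt IM (i x₀) (ψ.toFun (vbChartSymm IX G W x₀ p))

variable {ψ} {x₀ x : X}

theorem vbChartSymm_zero (hx : x ∈ vbSource IX G W x₀) :
    vbChartSymm IX G W x₀ (extChartAt IX x₀ x, 0) = zeroSection G W x := by
  rw [← vbChart_zeroSection (W := W) (G := G), vbChartSymm_vbChart (w := zeroSection G W x) hx]

theorem contDiffAt_inCharts (hx : x ∈ vbSource IX G W x₀)
    (hx' : i x ∈ (extChartAt IM (i x₀)).source) :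
    ContDiffAt ℝ ∞ (ψ.inCharts x₀) (extChartAt IX x₀ x, 0) := by
  rw [← contMDiffAt_iff_contDiffAt]
  have h1 : ContMDiffAt 𝓘(ℝ, EX × G) (IX.prod 𝓘(ℝ, G)) ∞ (vbChartSymm IX G W x₀)
      (extChartAt IX x₀ x, 0) := contMDiffAt_vbChartSymm (vbChart_mem_vbTarget
        (w := zeroSection G W x) hx)
  refine ContMDiffAt.comp _ (contMDiffAt_extChartAt' ?_) (ψ.contMDiff.contMDiffAt.comp _ h1)
  rw [vbChartSymm_zero hx, ψ.toFun_zero]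
  simpa using hx'

theorem eventually_inCharts_vbChart (hx : x ∈ vbSource IX G W x₀) :
    ∀ᶠ w in 𝓝 (zeroSection G W x),
      ψ.inCharts x₀ (vbChart IX G W x₀ w) = extChartAt IM (i x₀) (ψ.toFun w) := by
  filter_upwards [(FiberBundle.continuous_proj G W).continuousAt.preimage_mem_nhds
    ((isOpen_vbSource IX G W x₀).mem_nhds hx)] with w hw
  rw [inCharts, vbChartSymm_vbChart hw]

theorem fderiv_inCharts_mvfderiv (hx : x ∈ vbSource IX G W x₀)
    (hx' : i x ∈ (extChartAt IM (i x₀)).source)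
    (u : TangentSpace (IX.prod 𝓘(ℝ, G)) (zeroSection G W x)) :
    fderiv ℝ (ψ.inCharts x₀) (extChartAt IX x₀ x, 0)
      (mvfderiv (IX.prod 𝓘(ℝ, G)) (vbChart IX G W x₀) (zeroSection G W x) u) =
    mvfderiv IM (extChartAt IM (i x₀)) (ψ.toFun (zeroSection G W x))
      (mfderiv (IX.prod 𝓘(ℝ, G)) IM ψ.toFun (zeroSection G W x) u) := by
  have h0 := vbChart_zeroSection (I := IX) (x₀ := x₀) (W := W) (G := G) x
  have h1 := mvfderiv_fderiv_comp (I := IX.prod 𝓘(ℝ, G)) (g := ψ.inCharts x₀)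
    (f := vbChart IX G W x₀) (x := zeroSection G W x)
    (by rw [h0]; exact (contDiffAt_inCharts hx hx').differentiableAt (by simp))
    ((contMDiffAt_vbChart (w := zeroSection G W x) hx).mdifferentiableAt (by simp)) u
  have h2 : MDifferentiableAt IM 𝓘(ℝ, EM) (extChartAt IM (i x₀)) (ψ.toFun (zeroSection G W x)) := by
    rw [ψ.toFun_zero]
    exact (contMDiffAt_extChartAt' (n := ∞) (by simpa using hx')).mdifferentiableAt (by simp)
  rw [h0] at h1
  rw [← h1, mvfderiv_congr (eventually_inCharts_vbChart hx),
    mvfderiv_comp_apply' h2 (ψ.contMDiff.contMDiffAt.mdifferentiableAt (by simp))]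

/-- In charts the derivative of `ψ` is conjugate to the derivative of a local diffeomorphism. The
next lemmas identify its restrictions to the two factors `EX` and `G` as `di` and `vert`, so
injectivity says that these directions are independent. -/
theorem fderiv_inCharts_injective (hx : x ∈ vbSource IX G W x₀)
    (hx' : i x ∈ (extChartAt IM (i x₀)).source) :
    Function.Injective (fderiv ℝ (ψ.inCharts x₀) (extChartAt IX x₀ x, 0)) := by
  rw [injective_iff_map_eq_zero]
  intro p hp
  obtain ⟨u, rfl⟩ := (mvfderiv_vbChart_bijective (I := IX) (w := zeroSection G W x) hx).2 p
  rw [fderiv_inCharts_mvfderiv hx hx'] at hp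
  have h1 := (injective_iff_map_eq_zero _).1 (mvfderiv_extChartAt_bijective (I := IM) (m₀ := i x₀)
    (m := ψ.toFun (zeroSection G W x)) (by rwa [ψ.toFun_zero])).1 _ hp
  have h2 : u = 0 := ((ψ.isLocalDiffeomorph (zeroSection G W x)).mfderivToContinuousLinearEquiv
    (by simp)).map_eq_zero_iff.1 h1
  rw [h2, map_zero]

/-- `i` is `ψ` on the zero section, so its derivative is that of `ψ` in directions without fibre
component. -/
theorem mvfderiv_mfderiv_eq (hx : x ∈ vbSource IX G W x₀)
    (hx' : i x ∈ (extChartAt IM (i x₀)).source) (v : TangentSpace IX x) :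
    mvfderiv IM (extChartAt IM (i x₀)) (i x) (mfderiv IX IM i x v) =
      fderiv ℝ (ψ.inCharts x₀) (extChartAt IX x₀ x, 0) (mvfderiv IX (extChartAt IX x₀) x v, 0) := by
  have hc : ContMDiffAt IX 𝓘(ℝ, EX) ∞ (extChartAt IX x₀) x :=
    contMDiffAt_extChartAt' (by simpa using hx.1)
  have h1 : (fun z ↦ extChartAt IM (i x₀) (i z)) =ᶠ[𝓝 x]
      fun z ↦ ψ.inCharts x₀ (ContinuousLinearMap.inl ℝ EX G (extChartAt IX x₀ z)) := by
    filter_upwards [(isOpen_vbSource IX G W x₀).mem_nhds hx] with z hz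
    rw [← ψ.toFun_zero z, inCharts, ← vbChartSymm_zero hz]
    rfl
  rw [← mvfderiv_comp_apply' ((contMDiffAt_extChartAt' (n := ∞)
    (by simpa using hx')).mdifferentiableAt (by simp))
    (i.contMDiff.contMDiffAt.mdifferentiableAt (by simp)), mvfderiv_congr h1,
    mvfderiv_fderiv_comp (g := ψ.inCharts x₀)
      (f := fun z ↦ ContinuousLinearMap.inl ℝ EX G (extChartAt IX x₀ z))
      ((contDiffAt_inCharts hx hx').differentiableAt (by simp))
      ((ContinuousLinearMap.contMDiffAt (ContinuousLinearMap.inl ℝ EX G)).comp x hc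
        |>.mdifferentiableAt (by simp)),
    mvfderiv_clm_comp _ (hc.mdifferentiableAt (by simp))]
  rfl

/-- The curve `r ↦ ψ(r y)` is in charts the image of a straight line in the fibre direction. -/
theorem mvfderiv_vert (hx : x ∈ vbSource IX G W x₀)
    (hx' : i x ∈ (extChartAt IM (i x₀)).source) (y : W x) :
    mvfderiv IM (extChartAt IM (i x₀)) (i x) (ψ.vert x y) =
      fderiv ℝ (ψ.inCharts x₀) (extChartAt IX x₀ x, 0)
        (0, (trivializationAt G W x₀).continuousLinearMapAt ℝ x y) := by
  set y' := (trivializationAt G W x₀).continuousLinearMapAt ℝ x y with hy'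
  have hc : HasDerivAt (fun r : ℝ ↦ ((extChartAt IX x₀ x, r • y') : EX × G)) (0, y') 0 :=
    (hasDerivAt_const 0 _).prodMk (by simpa using (hasDerivAt_id (0 : ℝ)).smul_const y')
  have h1 (r : ℝ) : vbChartSymm IX G W x₀ (extChartAt IX x₀ x, r • y') = ⟨x, r • y⟩ := by
    have := vbChartSymm_vbChart (I := IX) (x₀ := x₀) (w := (⟨x, r • y⟩ : TotalSpace G W)) hx
    rwa [vbChart_smul] at this
  have hb : ψ.toFun ⟨x, (0 : ℝ) • y⟩ = i x := by rw [zero_smul]; exact ψ.toFun_zero x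
  have hl : ContMDiff 𝓘(ℝ, ℝ) (IX.prod 𝓘(ℝ, G)) ∞ (fun r : ℝ ↦ (⟨x, r • y⟩ : TotalSpace G W)) := by
    intro r
    have h2 : ContMDiffAt 𝓘(ℝ, ℝ) 𝓘(ℝ, EX × G) ∞
        (fun r : ℝ ↦ ((extChartAt IX x₀ x, r • y') : EX × G)) r :=
      (contDiff_const.prodMk (contDiff_id.smul contDiff_const)).contMDiff.contMDiffAt
    refine (ContMDiffAt.comp r (contMDiffAt_vbChartSymm
      (vbChart_mem_vbTarget (w := zeroSection G W x) hx)) h2).congr_of_eventuallyEq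
      (Eventually.of_forall fun r ↦ (h1 r).symm)
  have h3 := mvfderiv_comp_apply' (I' := 𝓘(ℝ, ℝ)) (g := extChartAt IM (i x₀))
    (f := fun r : ℝ ↦ ψ.toFun ⟨x, r • y⟩) (y := 0)
    (by rw [hb]
        exact (contMDiffAt_extChartAt' (n := ∞) (by simpa using hx')).mdifferentiableAt (by simp))
    ((ψ.contMDiff.comp hl).contMDiffAt.mdifferentiableAt (by simp)) (1 : ℝ)
  have h4 : mvfderiv IM (extChartAt IM (i x₀)) (ψ.toFun ⟨x, (0 : ℝ) • y⟩) (ψ.vert x y) =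
      mvfderiv IM (extChartAt IM (i x₀)) (i x) (ψ.vert x y) := by rw [hb]
  refine h4.symm.trans (h3.symm.trans ?_)
  have h5 : (fun r : ℝ ↦ extChartAt IM (i x₀) (ψ.toFun ⟨x, r • y⟩)) =
      fun r : ℝ ↦ ψ.inCharts x₀ (extChartAt IX x₀ x, r • y') := by
    funext r
    rw [inCharts, h1]
  have h6 : HasDerivAt (fun r : ℝ ↦ ψ.inCharts x₀ (extChartAt IX x₀ x, r • y'))
      (fderiv ℝ (ψ.inCharts x₀) (extChartAt IX x₀ x, 0) (0, y')) 0 := by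
    refine HasFDerivAt.comp_hasDerivAt (l := ψ.inCharts x₀) 0 ?_ hc
    rw [zero_smul]
    exact ((contDiffAt_inCharts hx hx').differentiableAt (by simp)).hasFDerivAt
  rw [h5]
  change mfderiv 𝓘(ℝ, ℝ) 𝓘(ℝ, EM) _ 0 (1 : ℝ) = _
  rw [mfderiv_eq_fderiv]
  exact (fderiv_apply_one_eq_deriv (𝕜 := ℝ) (x := (0 : ℝ))
    (f := fun r : ℝ ↦ ψ.inCharts x₀ (extChartAt IX x₀ x, r • y'))).trans h6.deriv

variable (ψ) in
-- `di v` and `vert y` are the images of `(v, 0)` and `(0, y)` under one injective map; if they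
-- agree, both vanish.
theorem eq_zero_of_vert_mem_range (x : X) (y : W x)
    (h : ∃ v : TangentSpace IX x, mfderiv IX IM i x v = ψ.vert x y) : y = 0 := by
  obtain ⟨v, hv⟩ := h
  have hx := mem_vbSource IX G W x
  have hx' := mem_extChartAt_source (I := IM) (i x)
  have h1 := mvfderiv_mfderiv_eq (ψ := ψ) hx hx' v
  rw [hv, mvfderiv_vert hx hx'] at h1
  have h2 := congrArg Prod.snd (fderiv_inCharts_injective hx hx' h1)
  rw [← (trivializationAt G W x).symmL_continuousLinearMapAt (R := ℝ) hx.2 y]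
  exact (congrArg _ h2).trans (map_zero _)

theorem mfderiv_injective (ψ : TubularNeighborhood IM IX i G W) (x : X) : Function.Injective (mfderiv IX IM i x) := by
  have hx := mem_vbSource IX G W x
  have hx' := mem_extChartAt_source (I := IM) (i x)
  rw [injective_iff_map_eq_zero]
  intro v hv
  have h1 := mvfderiv_mfderiv_eq (ψ := ψ) hx hx' v
  rw [hv, map_zero] at h1
  have h2 := congrArg Prod.fst ((injective_iff_map_eq_zero _).1
    (fderiv_inCharts_injective hx hx') _ h1.symm)
  exact (injective_iff_map_eq_zero _).1 (mvfderiv_extChartAt_bijective (I := IX) hx.1).1 _ h2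

theorem finrank_eq (ψ : TubularNeighborhood IM IX i G W) (x : X) :
    Module.finrank ℝ (EX × G) = Module.finrank ℝ EM :=
  (((ψ.isLocalDiffeomorph (zeroSection G W x)).mfderivToContinuousLinearEquiv
    (by simp)).toLinearEquiv).finrank_eq

/-- Near `x₀` the normal velocities `ψ.vert` are, up to vectors tangent to `X`, in the image of the
anchor: they lift to a smooth family of elements of `A`, read in trivializations. -/
theorem exists_local_lift (ψ : TubularNeighborhood IM IX i G W) (x₀ : X) :
    ∃ O : Set X, IsOpen O ∧ x₀ ∈ O ∧ O ⊆ (trivializationAt G W x₀).baseSet ∧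
      (∀ x ∈ O, i x ∈ (trivializationAt F V (i x₀)).baseSet) ∧ ∃ Θ : X → G →L[ℝ] F,
      (∀ x ∈ O, ContMDiffAt IX 𝓘(ℝ, G →L[ℝ] F) ∞ Θ x) ∧ ∀ x ∈ O, ∀ y : W x,
        ∃ v : TangentSpace IX x, mfderiv IX IM i x v = ψ.vert x y - A.anchor (i x)
          ((trivializationAt F V (i x₀)).symmL ℝ (i x)
            (Θ x ((trivializationAt G W x₀).continuousLinearMapAt ℝ x y))) := by
  have hsrc {x : X} (hx : x ∈ i.base x₀) : i x ∈ (extChartAt IM (i x₀)).source := by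
    rw [extChartAt_source]; exact hx.1.2.2
  -- Transversality enters here: `Q` is a right inverse, smooth in `x`, of `(v, b) ↦ di v - ρ b`,
  -- obtained from the isomorphism that trivializes the pullback bundle. Applied to the normal
  -- velocity `K x y'` it gives `di v - ρ b = vert y`, and the lift is `-b`.
  let Q : X → EM →L[ℝ] EX × F := fun x ↦ ((i.localDiff x₀ x).prod (i.localProj x₀)).inverse ∘L
    ContinuousLinearMap.inl ℝ EM (LieAlgebroid.TransverseMap.Model EM F EX)
  let K : X → G →L[ℝ] EM := fun x ↦ fderiv ℝ (ψ.inCharts x₀) (extChartAt IX x₀ x, 0) ∘L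
    ContinuousLinearMap.inr ℝ EX G
  refine ⟨vbSource IX G W x₀ ∩ i.base x₀, (isOpen_vbSource IX G W x₀).inter (i.isOpen_base x₀),
    ⟨mem_vbSource IX G W x₀, i.mem_base x₀⟩, fun x hx ↦ hx.1.2, fun x hx ↦ hx.2.1.2.1,
    fun x ↦ -(ContinuousLinearMap.snd ℝ EX F ∘L Q x ∘L K x), fun x hx ↦ ?_, fun x hx y ↦ ?_⟩
  · have hQ : ContMDiffAt IX 𝓘(ℝ, EM →L[ℝ] EX × F) ∞ Q x :=
      ((hx.2.2.contDiffAt_map_inverse (n := ∞)).contMDiffAt.comp x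
        (i.contMDiffAt_prod hx.2.1)).clm_comp contMDiffAt_const
    have hc : ContMDiffAt IX 𝓘(ℝ, EX × G) ∞ (fun z ↦ ((extChartAt IX x₀ z, 0) : EX × G)) x :=
      (contMDiffAt_extChartAt' (by simpa using hx.1.1)).prodMk_space contMDiffAt_const
    have hK : ContMDiffAt IX 𝓘(ℝ, G →L[ℝ] EM) ∞ K x :=
      (ContMDiffAt.comp x (((contDiffAt_inCharts hx.1 (hsrc hx.2)).fderiv_right
        (m := ∞) (by simp)).contMDiffAt) hc).clm_comp contMDiffAt_const
    exact (contMDiffAt_const.clm_comp (hQ.clm_comp hK)).neg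
  · set y' := (trivializationAt G W x₀).continuousLinearMapAt ℝ x y with hy'
    have h1 : i.localDiff x₀ x (Q x (K x y')) = K x y' :=
      congrArg Prod.fst (hx.2.2.self_apply_inverse (K x y', 0))
    have h2 : K x y' = mvfderiv IM (extChartAt IM (i x₀)) (i x) (ψ.vert x y) :=
      (mvfderiv_vert hx.1 (hsrc hx.2) y).symm
    rw [i.localDiff_apply, TangentBundle.continuousLinearMapAt_trivializationAt
      (by simpa using hsrc hx.2)] at h1
    have h3 := (mvfderiv_extChartAt_bijective (hsrc hx.2)).1 (h1.trans h2)
    refine ⟨(LieAlgebroid.TransverseMap.trivN (I' := IX) x₀).symmL ℝ x (Q x (K x y')).1, ?_⟩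
    have h4 : (-(ContinuousLinearMap.snd ℝ EX F ∘L Q x ∘L K x)) y' = -(Q x (K x y')).2 := rfl
    rw [h4, map_neg, map_neg, sub_neg_eq_add]
    exact eq_add_of_sub_eq h3

end TubularNeighborhood

/-- A smooth family of sections of `A`, parametrized by the vector bundle `W` and linear along its
fibres, whose anchor is along `i` transverse to `X` in the directions of `W`. -/
structure TransverseFamily (i : A.TransverseMap IX X) (G : Type*) [NormedAddCommGroup G]
    [NormedSpace ℝ G] (W : X → Type*) [∀ x, AddCommGroup (W x)] [∀ x, Module ℝ (W x)]
    [∀ x, TopologicalSpace (W x)] [TopologicalSpace (TotalSpace G W)]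
    [FiberBundle G W] [VectorBundle ℝ G W] where
  toFun : TotalSpace G W → ∀ m, V m
  contMDiff : ContMDiff ((IX.prod 𝓘(ℝ, G)).prod IM) (IM.prod 𝓘(ℝ, F)) ∞
    (fun q : TotalSpace G W × M ↦ (⟨q.2, toFun q.1 q.2⟩ : TotalSpace F V))
  toFun_smul : ∀ x (y : W x) (r : ℝ) m, toFun ⟨x, r • y⟩ m = r • toFun ⟨x, y⟩ m
  -- With `v = 0` this contains the injectivity of `y ↦ ρ(a_y)` at `i x`; in general it says
  -- moreover that the image meets the range of `di` only in zero.
  eq_zero : ∀ x (y : W x) (v : TangentSpace IX x),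
    mfderiv IX IM i x v = A.anchor (i x) (toFun ⟨x, y⟩ (i x)) → y = 0

/-- The local lifts are extended from `X` to `M` as constant sections of a trivialization times a
cutoff equal to 1 near `i x₀`, and then averaged by a partition of unity on `X`. That `vert y -
ρ(c)` is tangent to `X` is an affine condition on `c`, so it survives the averaging. -/
theorem TubularNeighborhood.exists_transverseFamily [T2Space X] [SigmaCompactSpace X]
    (ψ : TubularNeighborhood IM IX i G W) : Nonempty (TransverseFamily i G W) := by
  choose O hO hxO hOW hOV Θ hΘ hlift using ψ.exists_local_lift
  choose g hg hg1 using fun x₀ : X ↦ LieAlgebroid.exists_bump (I := IM)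
    ((trivializationAt F V (i x₀)).open_baseSet.mem_nhds
      (FiberBundle.mem_baseSet_trivializationAt' (F := F) (E := V) (i x₀)))
  -- On `O' x₀` the cutoff composed with `i` is identically 1, so multiplication by it does not
  -- change the lift along `X`.
  choose O' hO'1 hO' hxO' using fun x₀ : X ↦ mem_nhds_iff.1
    (i.contMDiff.continuous.continuousAt.preimage_mem_nhds (hg1 x₀))
  obtain ⟨θ, hθ⟩ := SmoothPartitionOfUnity.exists_isSubordinate IX (s := (univ : Set X))
    isClosed_univ (fun x ↦ O x ∩ O' x) (fun x ↦ (hO x).inter (hO' x))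
    (fun x _ ↦ mem_iUnion.2 ⟨x, hxO x, hxO' x⟩)
  let b (j : X) (w : TotalSpace G W) (m : M) : V m :=
    g j m • (trivializationAt F V (i j)).symmL ℝ m
      (Θ j w.proj ((trivializationAt G W j).continuousLinearMapAt ℝ w.proj w.2))
  have hb (j : X) (w : TotalSpace G W) (hw : w.proj ∈ O j) (m : M)
      (hm : m ∈ (trivializationAt F V (i j)).baseSet) :
      ContMDiffAt ((IX.prod 𝓘(ℝ, G)).prod IM) (IM.prod 𝓘(ℝ, F)) ∞
        (fun q : TotalSpace G W × M ↦ (⟨q.2, (trivializationAt F V (i j)).symmL ℝ q.2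
      (Θ j q.1.proj ((trivializationAt G W j).continuousLinearMapAt ℝ q.1.proj q.1.2))⟩ :
          TotalSpace F V)) (w, m) := by
    have h1 : ContMDiffAt (IX.prod 𝓘(ℝ, G)) IX ∞ (TotalSpace.proj : TotalSpace G W → X) w :=
      (Bundle.contMDiff_proj W).contMDiffAt
    have h2 : ContMDiffAt (IX.prod 𝓘(ℝ, G)) 𝓘(ℝ, F) ∞ (fun w : TotalSpace G W ↦
        Θ j w.proj ((trivializationAt G W j).continuousLinearMapAt ℝ w.proj w.2)) w :=
      ((hΘ j _ hw).comp w h1).clm_apply (contMDiffAt_coord (f := TotalSpace.proj)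
        (a := fun w : TotalSpace G W ↦ w.2) (trivializationAt G W j) contMDiffAt_id (hOW j hw))
    exact contMDiffAt_symmL (trivializationAt F V (i j)) (f := fun q : TotalSpace G W × M ↦ q.2)
      contMDiffAt_snd (ContMDiffAt.comp (w, m) h2 contMDiffAt_fst) hm
  let a (w : TotalSpace G W) (m : M) : V m := ∑ᶠ j, θ j w.proj • b j w m
  have hfin (x : X) : (Function.support fun j ↦ θ j x).Finite := θ.locallyFinite.point_finite x
  refine ⟨⟨a, ?_, fun x y r m ↦ ?_, fun x y v hv ↦ ?_⟩⟩
  · rintro ⟨w, m⟩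
    set e := trivializationAt F V m
    have hm : m ∈ e.baseSet := FiberBundle.mem_baseSet_trivializationAt' m
    refine contMDiffAt_of_coord e (f := fun q : TotalSpace G W × M ↦ q.2) contMDiffAt_snd ?_ hm
    have h1 : (fun q : TotalSpace G W × M ↦ e.continuousLinearMapAt ℝ q.2 (a q.1 q.2)) =
        fun q ↦ ∑ᶠ j, θ j q.1.proj • e.continuousLinearMapAt ℝ q.2 (b j q.1 q.2) := by
      funext q
      refine (AddMonoidHom.map_finsum (e.continuousLinearMapAt ℝ q.2 :
        V q.2 →+ F) ((hfin q.1.proj).subset fun j hj ↦ ?_)).trans ?_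
      · exact left_ne_zero_of_smul hj
      · exact finsum_congr fun j ↦ map_smul (e.continuousLinearMapAt ℝ q.2) _ _
    rw [h1]
    refine contMDiffAt_finsum ?_ fun j ↦ ?_
    · refine LocallyFinite.subset ((θ.locallyFinite.preimage_continuous
        ((FiberBundle.continuous_proj G W).comp continuous_fst))) fun j q hq ↦ ?_
      exact left_ne_zero_of_smul hq
    · have hθj : ContMDiffAt ((IX.prod 𝓘(ℝ, G)).prod IM) 𝓘(ℝ, ℝ) ∞
          (fun q : TotalSpace G W × M ↦ θ j q.1.proj) (w, m) :=
        ((θ j).contMDiff.comp ((Bundle.contMDiff_proj W).comp contMDiff_fst)).contMDiffAt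
      have hgj : ContMDiffAt ((IX.prod 𝓘(ℝ, G)).prod IM) 𝓘(ℝ, ℝ) ∞
          (fun q : TotalSpace G W × M ↦ g j q.2) (w, m) :=
        ((g j).contMDiff.comp contMDiff_snd).contMDiffAt
      -- The lifts and trivializations are smooth only over the sets belonging to `j`. Off the
      -- support of `θ j` or of the cutoff `g j` the whole summand vanishes near the given point.
      by_cases hw : w.proj ∈ tsupport (θ j)
      · by_cases hmj : m ∈ tsupport (g j)
        · refine (hθj.smul (hgj.smul (contMDiffAt_coord e (hb j w (hθ j hw).1 m (hg j hmj))
            hm))).congr_of_eventuallyEq (Eventually.of_forall fun q ↦ ?_)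
          exact congrArg (θ j q.1.proj • ·) (map_smul (e.continuousLinearMapAt ℝ q.2) _ _)
        · refine contMDiffAt_const (c := (0 : F)) |>.congr_of_eventuallyEq ?_
          filter_upwards [continuousAt_snd.preimage_mem_nhds
            ((isClosed_tsupport (g j)).isOpen_compl.mem_nhds hmj)] with q hq
          simp only [b, image_eq_zero_of_notMem_tsupport hq, zero_smul, map_zero, smul_zero]
      · refine contMDiffAt_const (c := (0 : F)) |>.congr_of_eventuallyEq ?_
        filter_upwards [((FiberBundle.continuous_proj G W).comp
          continuous_fst).continuousAt.preimage_mem_nhds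
            ((isClosed_tsupport (θ j)).isOpen_compl.mem_nhds hw)] with q hq
        have : θ j q.1.proj = 0 := image_eq_zero_of_notMem_tsupport hq
        rw [this, zero_smul]
  · have h1 (j : X) : b j ⟨x, r • y⟩ m = r • b j ⟨x, y⟩ m := by
      simp only [b, map_smul]
      exact smul_comm _ _ _
    simp only [a, h1]
    rw [smul_finsum' r ((hfin x).subset fun j hj ↦ left_ne_zero_of_smul hj)]
    exact finsum_congr fun j ↦ smul_comm _ _ _
  · have hconv : Convex ℝ {c : V (i x) | ∃ v : TangentSpace IX x,
        mfderiv IX IM i x v = ψ.vert x y - A.anchor (i x) c} := by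
      rintro c ⟨u, hu⟩ c' ⟨u', hu'⟩ s t - - hst
      refine ⟨s • u + t • u', ?_⟩
      rw [map_add, map_smul, map_smul, hu, hu', map_add, map_smul, map_smul, smul_sub, smul_sub,
        sub_add_sub_comm, ← add_smul, hst, one_smul]
    have hmem := hconv.finsum_mem (fun j ↦ θ.nonneg j x) (θ.sum_eq_one (mem_univ x))
      (z := fun j ↦ b j ⟨x, y⟩ (i x)) fun j hj ↦ by
        have hxj := hθ j (subset_tsupport _ hj)
        have h1 : g j (i x) = 1 := hO'1 j hxj.2
        have h2 : b j ⟨x, y⟩ (i x) = _ := congrArg (· • _) h1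
        rw [one_smul] at h2
        obtain ⟨u, hu⟩ := hlift j x hxj.1 y
        refine ⟨u, ?_⟩
        rw [h2]
        exact hu
    obtain ⟨u, hu⟩ := hmem
    -- `vert y - ρ(a_y)` is tangent to `X`. If `ρ(a_y)` is tangent too, then so is `vert y`, and `y
    -- = 0`.
    refine ψ.eq_zero_of_vert_mem_range x y ⟨u + v, ?_⟩
    rw [map_add, hv, hu]
    exact sub_add_cancel _ _

end Family

/-! ### The transverse family in charts, and the transport equation in an arbitrary trivialization.
-/

section LocalSolution

variable {EM : Type*} [NormedAddCommGroup EM] [NormedSpace ℝ EM] [FiniteDimensional ℝ EM]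
  {HM : Type*} [TopologicalSpace HM] {IM : ModelWithCorners ℝ EM HM} [IM.Boundaryless]
  {M : Type*} [TopologicalSpace M] [ChartedSpace HM M] [IsManifold IM ∞ M]
  [T2Space M]
  {F : Type*} [NormedAddCommGroup F] [NormedSpace ℝ F] [FiniteDimensional ℝ F]
  {V : M → Type*} [∀ x, AddCommGroup (V x)] [∀ x, Module ℝ (V x)]
  [∀ x, TopologicalSpace (V x)] [TopologicalSpace (TotalSpace F V)]
  [FiberBundle F V] [VectorBundle ℝ F V] [ContMDiffVectorBundle ∞ F V IM]
  {A : LieAlgebroid IM F V}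
  {EX : Type*} [NormedAddCommGroup EX] [NormedSpace ℝ EX] [FiniteDimensional ℝ EX]
  {HX : Type*} [TopologicalSpace HX] {IX : ModelWithCorners ℝ EX HX} [IX.Boundaryless]
  {X : Type*} [TopologicalSpace X] [ChartedSpace HX X] [IsManifold IX ∞ X]
  {i : A.TransverseMap IX X}
  {G : Type*} [NormedAddCommGroup G] [NormedSpace ℝ G] [FiniteDimensional ℝ G]
  {W : X → Type*} [∀ x, AddCommGroup (W x)] [∀ x, Module ℝ (W x)]
  [∀ x, TopologicalSpace (W x)] [TopologicalSpace (TotalSpace G W)]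
  [FiberBundle G W] [VectorBundle ℝ G W] [ContMDiffVectorBundle ∞ G W IX]

/-- The derivative of a function on a manifold, computed in a chart. -/
theorem fderiv_comp_extChartAt_symm {P : Type*} [NormedAddCommGroup P] [NormedSpace ℝ P] {h : M → P}
    {m₀ : M} {μ : EM} (hμ : μ ∈ (extChartAt IM m₀).target)
    (hh : ContMDiffAt IM 𝓘(ℝ, P) ∞ h ((extChartAt IM m₀).symm μ))
    (v : TangentSpace IM ((extChartAt IM m₀).symm μ)) :
    fderiv ℝ (fun μ ↦ h ((extChartAt IM m₀).symm μ)) μ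
      (mvfderiv IM (extChartAt IM m₀) ((extChartAt IM m₀).symm μ) v) =
    mvfderiv IM h ((extChartAt IM m₀).symm μ) v := by
  have hm := (extChartAt IM m₀).map_target hμ
  have h1 : ContDiffAt ℝ ∞ (fun μ ↦ h ((extChartAt IM m₀).symm μ)) μ :=
    contMDiffAt_iff_contDiffAt.1 (hh.comp μ (contMDiffAt_extChartAt_symm hμ))
  have h2 := mvfderiv_fderiv_comp (I := IM) (g := fun μ ↦ h ((extChartAt IM m₀).symm μ))
    (f := extChartAt IM m₀) (x := (extChartAt IM m₀).symm μ)
    (by rw [(extChartAt IM m₀).right_inv hμ]; exact h1.differentiableAt (by simp))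
    ((contMDiffAt_extChartAt' (n := ∞) (by simpa using hm)).mdifferentiableAt (by simp)) v
  rw [(extChartAt IM m₀).right_inv hμ] at h2
  rw [← h2]
  refine DFunLike.congr_fun (mvfderiv_congr ?_) v
  filter_upwards [(isOpen_extChartAt_source m₀).mem_nhds hm] with z hz
  rw [(extChartAt IM m₀).left_inv hz]

namespace TransverseFamily

variable (a : TransverseFamily i G W) (x₀ : X)

theorem contMDiffAt_coord {N : Type*} [TopologicalSpace N] {EN : Type*} [NormedAddCommGroup EN]
    [NormedSpace ℝ EN] {HN : Type*} [TopologicalSpace HN] {IN : ModelWithCorners ℝ EN HN}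
    [ChartedSpace HN N] {f : N → TotalSpace G W} {g : N → M} {y : N}
    (hf : ContMDiffAt IN (IX.prod 𝓘(ℝ, G)) ∞ f y) (hg : ContMDiffAt IN IM ∞ g y)
    (e : Trivialization F (TotalSpace.proj : TotalSpace F V → M)) [MemTrivializationAtlas e]
    (h : g y ∈ e.baseSet) : ContMDiffAt IN 𝓘(ℝ, F) ∞
      (fun z ↦ e.continuousLinearMapAt ℝ (g z) (a.toFun (f z) (g z))) y :=
  _root_.contMDiffAt_coord e (ContMDiffAt.comp y (a.contMDiff.contMDiffAt (x := (f y, g y)))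
    (hf.prodMk hg)) h

/-- The family of sections read in charts and trivializations around `x₀`. -/
noncomputable def localFamily : LocalFamily EX G EM F where
  domQ := vbTarget IX G W x₀ ∩
    (fun ξ ↦ i ((extChartAt IX x₀).symm ξ)) ⁻¹' vbSource IM F V (i x₀)
  domE := vbTarget IM F V (i x₀)
  isOpen_domQ := ((i.contMDiff.continuous.comp_continuousOn
    (continuousOn_extChartAt_symm x₀)).mono inter_subset_left).isOpen_inter_preimage
      (isOpen_vbTarget IX G W x₀) (isOpen_vbSource IM F V (i x₀))
  isOpen_domE := isOpen_vbTarget IM F V (i x₀)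
  a q := (trivializationAt F V (i x₀)).continuousLinearMapAt ℝ ((extChartAt IM (i x₀)).symm q.2)
    (a.toFun (vbChartSymm IX G W x₀ q.1) ((extChartAt IM (i x₀)).symm q.2))
  R μ := A.anchorIn (trivializationAt F V (i x₀)) (extChartAt IM (i x₀))
    ((extChartAt IM (i x₀)).symm μ)
  C μ := A.struct (trivializationAt F V (i x₀)) ((extChartAt IM (i x₀)).symm μ)
  j ξ := extChartAt IM (i x₀) (i ((extChartAt IX x₀).symm ξ))
  contDiffOn_a q hq := (contMDiffAt_iff_contDiffAt.1 (a.contMDiffAt_coord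
    (f := fun q : (EX × G) × EM ↦ vbChartSymm IX G W x₀ q.1)
    (g := fun q : (EX × G) × EM ↦ (extChartAt IM (i x₀)).symm q.2)
    (ContMDiffAt.comp q (contMDiffAt_vbChartSymm hq.1.1.1) contDiff_fst.contMDiff.contMDiffAt)
    (ContMDiffAt.comp q (contMDiffAt_extChartAt_symm hq.2.1) contDiff_snd.contMDiff.contMDiffAt)
    _ hq.2.2)).contDiffWithinAt
  contDiffOn_R μ hμ := (contMDiffAt_iff_contDiffAt.1 (ContMDiffAt.comp μ
    (A.contMDiffAt_anchorIn _ (contMDiffAt_extChartAt'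
      (by simpa using (extChartAt IM (i x₀)).map_target hμ.1)) hμ.2)
      (contMDiffAt_extChartAt_symm hμ.1))).contDiffWithinAt
  contDiffOn_C μ hμ := (contMDiffAt_iff_contDiffAt.1 (ContMDiffAt.comp μ
    (A.contMDiffAt_struct _ hμ.2) (contMDiffAt_extChartAt_symm hμ.1))).contDiffWithinAt
  contDiffOn_j ξ hξ := (contMDiffAt_iff_contDiffAt.1 (ContMDiffAt.comp ξ
    (contMDiffAt_extChartAt' (by simpa using hξ.2.1)) (i.contMDiff.contMDiffAt.comp ξ
      (contMDiffAt_extChartAt_symm hξ.1.1)))).contDiffWithinAt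
  a_smul ξ _ μ _ r y := by
    rw [vbChartSymm_smul, a.toFun_smul, map_smul]
  C_swap μ _ v w := A.struct_swap _ _ v w
  R_C μ hμ v w := by
    have hh : ContMDiffAt IM 𝓘(ℝ, EM) ∞ (extChartAt IM (i x₀)) ((extChartAt IM (i x₀)).symm μ) :=
      contMDiffAt_extChartAt' (by simpa using (extChartAt IM (i x₀)).map_target hμ.1)
    have h := fderiv_comp_extChartAt_symm hμ.1
      (A.contMDiffAt_anchorIn (trivializationAt F V (i x₀)) hh hμ.2)
    refine (A.struct_anchorIn _ hh hμ.2 v w).trans ?_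
    rw [← h, ← h]
    rfl
  jacobi μ hμ u v w := by
    have h := fderiv_comp_extChartAt_symm hμ.1
      (A.contMDiffAt_struct (trivializationAt F V (i x₀)) hμ.2)
    have h1 := A.struct_jacobi (trivializationAt F V (i x₀)) hμ.2 u v w
    rw [← h, ← h, ← h] at h1
    exact h1

/-- The right-hand side of the differential equation for the transport of a tangent vector `u` to
the parameter space and an element of the fibre, read in the trivialization `e`. -/
noncomputable def transportRHS (e : Trivialization F (TotalSpace.proj : TotalSpace F V → M))
    [MemTrivializationAtlas e] (w : TotalSpace G W) (u : TangentSpace (IX.prod 𝓘(ℝ, G)) w) (m : M)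
    (β : F) : F :=
  mvfderiv (IX.prod 𝓘(ℝ, G)) (fun w' ↦ e.continuousLinearMapAt ℝ m (a.toFun w' m)) w u +
    mvfderiv IM (fun m' ↦ e.continuousLinearMapAt ℝ m' (a.toFun w m')) m
      (A.anchor m (e.symmL ℝ m β)) -
    A.struct e m (e.continuousLinearMapAt ℝ m (a.toFun w m)) β

/-- The transport equation does not depend on the trivialization. -/
theorem hasDerivAt_transition {w : TotalSpace G W} {u : TangentSpace (IX.prod 𝓘(ℝ, G)) w}
    (e e' : Trivialization F (TotalSpace.proj : TotalSpace F V → M))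
    [MemTrivializationAtlas e] [MemTrivializationAtlas e'] {γ : ℝ → M} {b : ∀ s, V (γ s)} {t : ℝ}
    (hγ : HasMFDerivAt 𝓘(ℝ, ℝ) IM γ t
      ((1 : ℝ →L[ℝ] ℝ).smulRight (A.anchor (γ t) (a.toFun w (γ t)))))
    (he : γ t ∈ e.baseSet) (he' : γ t ∈ e'.baseSet)
    (hb : HasDerivAt (fun s ↦ e.continuousLinearMapAt ℝ (γ s) (b s))
      (a.transportRHS e w u (γ t) (e.continuousLinearMapAt ℝ (γ t) (b t))) t) :
    HasDerivAt (fun s ↦ e'.continuousLinearMapAt ℝ (γ s) (b s))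
      (a.transportRHS e' w u (γ t) (e'.continuousLinearMapAt ℝ (γ t) (b t))) t := by
  have hT := (LieAlgebroid.contMDiffAt_transition IM e e' he he').mdifferentiableAt (by simp)
  have hev {m : M} (hm : m ∈ e.baseSet) (c : V m) : e'.continuousLinearMapAt ℝ m c =
      LieAlgebroid.transition e e' m (e.continuousLinearMapAt ℝ m c) := by
    rw [LieAlgebroid.transition, ContinuousLinearMap.comp_apply, e.symmL_continuousLinearMapAt hm]
  have h1 := (hγ.hasDerivAt_comp hT).clm_apply hb
  have h2 : (fun s ↦ e'.continuousLinearMapAt ℝ (γ s) (b s)) =ᶠ[𝓝 t] fun s ↦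
      LieAlgebroid.transition e e' (γ s) (e.continuousLinearMapAt ℝ (γ s) (b s)) := by
    filter_upwards [hγ.continuousAt.preimage_mem_nhds (e.open_baseSet.mem_nhds he)] with s hs
    exact hev hs _
  refine (h1.congr_of_eventuallyEq h2).congr_deriv ?_
  have h3 : (fun w' ↦ e'.continuousLinearMapAt ℝ (γ t) (a.toFun w' (γ t))) = fun w' ↦
      LieAlgebroid.transition e e' (γ t) (e.continuousLinearMapAt ℝ (γ t) (a.toFun w' (γ t))) :=
    funext fun w' ↦ hev he _
  have h4 : (fun m' ↦ e'.continuousLinearMapAt ℝ m' (a.toFun w m')) =ᶠ[𝓝 (γ t)] fun m' ↦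
      LieAlgebroid.transition e e' m' (e.continuousLinearMapAt ℝ m' (a.toFun w m')) := by
    filter_upwards [e.open_baseSet.mem_nhds he] with m' hm'
    exact hev hm' _
  have h5 : MDifferentiableAt (IX.prod 𝓘(ℝ, G)) 𝓘(ℝ, F)
      (fun w' ↦ e.continuousLinearMapAt ℝ (γ t) (a.toFun w' (γ t))) w :=
    (a.contMDiffAt_coord (f := id) (g := fun _ ↦ γ t) contMDiffAt_id contMDiffAt_const e
      he).mdifferentiableAt (by simp)
  have h6 : MDifferentiableAt IM 𝓘(ℝ, F)
      (fun m' ↦ e.continuousLinearMapAt ℝ m' (a.toFun w m')) (γ t) :=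
    (a.contMDiffAt_coord (f := fun _ ↦ w) (g := id) contMDiffAt_const contMDiffAt_id e
      he).mdifferentiableAt (by simp)
  -- Let `T` be the transition function. Differentiating `T β` adds the derivative of `T` along
  -- `ρ(a)`, applied to `β`, and rewriting the right-hand side adds the derivative of `T` along
  -- `ρ(b)`, applied to `α`. Their difference is the inhomogeneous term in the transformation law of
  -- the structure functions.
  have h7 := A.struct_transition e e' he he' (e.continuousLinearMapAt ℝ (γ t) (a.toFun w (γ t)))
    (e.continuousLinearMapAt ℝ (γ t) (b t))
  rw [← hev he, ← hev he, e.symmL_continuousLinearMapAt he, e.symmL_continuousLinearMapAt he] at h7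
  rw [transportRHS, transportRHS, h3, mvfderiv_clm_comp _ h5, mvfderiv_congr h4,
    mvfderiv_clm_apply hT h6, e'.symmL_continuousLinearMapAt he',
    e.symmL_continuousLinearMapAt he, map_sub, map_add, h7]
  abel

/-- The curve `b` in `A` is the transport, along the integral curve of the anchor of the family at
the parameter `w`, of the element `c` and the tangent vector `u` to the parameter space. -/
structure IsTransport (w : TotalSpace G W) (u : TangentSpace (IX.prod 𝓘(ℝ, G)) w)
    (c : V (i w.proj)) (b : ℝ → TotalSpace F V) : Prop where
  zero : b 0 = ⟨i w.proj, c⟩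
  hasMFDerivAt : ∀ t ∈ Ioo (-2 : ℝ) 2, HasMFDerivAt 𝓘(ℝ, ℝ) IM (fun s ↦ (b s).proj) t
    ((1 : ℝ →L[ℝ] ℝ).smulRight (A.anchor (b t).proj (a.toFun w (b t).proj)))
  hasDerivAt : ∀ t ∈ Ioo (-2 : ℝ) 2,
    ∀ (e : Trivialization F (TotalSpace.proj : TotalSpace F V → M)) [MemTrivializationAtlas e],
    (b t).proj ∈ e.baseSet → HasDerivAt (fun s ↦ e.continuousLinearMapAt ℝ (b s).proj (b s).2)
      (a.transportRHS e w u (b t).proj (e.continuousLinearMapAt ℝ (b t).proj (b t).2)) t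

variable (i G W) in
/-- The points of `X` which lie in the charts and trivializations around `x₀` and `i x₀`. -/
def localBase : Set X := vbSource IX G W x₀ ∩ i ⁻¹' vbSource IM F V (i x₀)

variable {a x₀} {N : Set (EX × G)} {m : ℝ × (EX × G) → EM}
  {Ψ : ℝ × (EX × G) → (EX × G) × F →L[ℝ] F}

theorem localFamily_a {w : TotalSpace G W} (hw : w.proj ∈ vbSource IX G W x₀) (μ : EM) :
    (a.localFamily x₀).a (vbChart IX G W x₀ w, μ) =
      (trivializationAt F V (i x₀)).continuousLinearMapAt ℝ ((extChartAt IM (i x₀)).symm μ)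
        (a.toFun w ((extChartAt IM (i x₀)).symm μ)) := by
  simp only [localFamily]
  rw [vbChartSymm_vbChart hw]

theorem localFamily_j {x : X} (hx : x ∈ vbSource IX G W x₀) :
    (a.localFamily x₀).j (extChartAt IX x₀ x) = extChartAt IM (i x₀) (i x) := by
  simp only [localFamily]
  rw [(extChartAt IX x₀).left_inv hx.1]

theorem mem_domQ {w : TotalSpace G W} (hw : w.proj ∈ localBase i G W x₀) :
    (vbChart IX G W x₀ w).1 ∈ (a.localFamily x₀).domQ := by
  refine ⟨vbChart_mem_vbTarget hw.1, ?_⟩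
  change i ((extChartAt IX x₀).symm (extChartAt IX x₀ w.proj)) ∈ vbSource IM F V (i x₀)
  rw [(extChartAt IX x₀).left_inv hw.1.1]
  exact hw.2

/-- The transport equation in charts. -/
theorem rhs_localFamily {w : TotalSpace G W} (hw : w.proj ∈ localBase i G W x₀)
    (u : TangentSpace (IX.prod 𝓘(ℝ, G)) w) {μ : EM} (hμ : μ ∈ vbTarget IM F V (i x₀)) (β : F) :
    (a.localFamily x₀).rhs (vbChart IX G W x₀ w) μ
        (mvfderiv (IX.prod 𝓘(ℝ, G)) (vbChart IX G W x₀) w u) β =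
      a.transportRHS (trivializationAt F V (i x₀)) w u ((extChartAt IM (i x₀)).symm μ) β := by
  have hd := (a.localFamily x₀).differentiableAt_a (p := vbChart IX G W x₀ w) (mem_domQ hw) hμ
  have hm := (extChartAt IM (i x₀)).map_target hμ.1
  have hw' := vbChartSymm_vbChart hw.1
  have h1 : (fun w' ↦ (trivializationAt F V (i x₀)).continuousLinearMapAt ℝ
      ((extChartAt IM (i x₀)).symm μ) (a.toFun w' ((extChartAt IM (i x₀)).symm μ))) =ᶠ[𝓝 w]
      fun w' ↦ (a.localFamily x₀).a (vbChart IX G W x₀ w', μ) := by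
    filter_upwards [(FiberBundle.continuous_proj G W).continuousAt.preimage_mem_nhds
      ((isOpen_vbSource IX G W x₀).mem_nhds hw.1)] with w' hw'
    simp only [localFamily]
    rw [vbChartSymm_vbChart hw']
  have h2 : (fun m' ↦ (trivializationAt F V (i x₀)).continuousLinearMapAt ℝ m' (a.toFun w m'))
      =ᶠ[𝓝 ((extChartAt IM (i x₀)).symm μ)]
      fun m' ↦ (a.localFamily x₀).a (vbChart IX G W x₀ w, extChartAt IM (i x₀) m') := by
    filter_upwards [(isOpen_extChartAt_source (i x₀)).mem_nhds hm] with m' hm'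
    simp only [localFamily]
    rw [hw', (extChartAt IM (i x₀)).left_inv hm']
  have h3 : HasFDerivAt (fun p ↦ (a.localFamily x₀).a (p, μ))
      (fderiv ℝ (a.localFamily x₀).a (vbChart IX G W x₀ w, μ) ∘L
        ContinuousLinearMap.inl ℝ (EX × G) EM) (vbChart IX G W x₀ w) :=
    hd.hasFDerivAt.comp (vbChart IX G W x₀ w) (f := fun p ↦ (p, μ))
      (hasFDerivAt_prodMk_left _ _)
  have h4 : HasFDerivAt (fun ν ↦ (a.localFamily x₀).a (vbChart IX G W x₀ w, ν))
      (fderiv ℝ (a.localFamily x₀).a (vbChart IX G W x₀ w, μ) ∘L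
        ContinuousLinearMap.inr ℝ (EX × G) EM) μ :=
    hd.hasFDerivAt.comp μ (f := fun ν ↦ (vbChart IX G W x₀ w, ν)) (hasFDerivAt_prodMk_right _ _)
  have hr := (extChartAt IM (i x₀)).right_inv hμ.1
  have h5 := mvfderiv_fderiv_comp (I := IX.prod 𝓘(ℝ, G))
    (g := fun p ↦ (a.localFamily x₀).a (p, μ)) (f := vbChart IX G W x₀) h3.differentiableAt
    ((contMDiffAt_vbChart hw.1).mdifferentiableAt (by simp)) u
  have h6 := mvfderiv_fderiv_comp (I := IM)
    (g := fun ν ↦ (a.localFamily x₀).a (vbChart IX G W x₀ w, ν)) (f := extChartAt IM (i x₀))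
    (x := (extChartAt IM (i x₀)).symm μ) (by rw [hr]; exact h4.differentiableAt)
    ((contMDiffAt_extChartAt' (n := ∞) (by simpa using hm)).mdifferentiableAt (by simp))
    (A.anchor _ ((trivializationAt F V (i x₀)).symmL ℝ ((extChartAt IM (i x₀)).symm μ) β))
  rw [hr, h4.fderiv] at h6
  rw [h3.fderiv] at h5
  rw [transportRHS, mvfderiv_congr h1, mvfderiv_congr h2, h5, h6, LocalFamily.rhs]
  have h7 : ((mvfderiv (IX.prod 𝓘(ℝ, G)) (vbChart IX G W x₀) w u, (a.localFamily x₀).R μ β) :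
      (EX × G) × EM) = (mvfderiv (IX.prod 𝓘(ℝ, G)) (vbChart IX G W x₀) w u, 0) +
        (0, (a.localFamily x₀).R μ β) := by simp
  rw [h7, map_add]
  congr 1
  rw [localFamily_a hw.1]
  rfl

end TransverseFamily
end LocalSolution

/-! ### Solutions in charts are the unique intrinsic transports. -/

section LocalTransport

variable {EM : Type*} [NormedAddCommGroup EM] [NormedSpace ℝ EM] [FiniteDimensional ℝ EM]
  {HM : Type*} [TopologicalSpace HM] {IM : ModelWithCorners ℝ EM HM} [IM.Boundaryless]
  {M : Type*} [TopologicalSpace M] [ChartedSpace HM M] [IsManifold IM ∞ M]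
  [T2Space M]
  {F : Type*} [NormedAddCommGroup F] [NormedSpace ℝ F] [FiniteDimensional ℝ F]
  {V : M → Type*} [∀ x, AddCommGroup (V x)] [∀ x, Module ℝ (V x)]
  [∀ x, TopologicalSpace (V x)] [TopologicalSpace (TotalSpace F V)]
  [FiberBundle F V] [VectorBundle ℝ F V] [ContMDiffVectorBundle ∞ F V IM]
  {A : LieAlgebroid IM F V}
  {EX : Type*} [NormedAddCommGroup EX] [NormedSpace ℝ EX] [FiniteDimensional ℝ EX]
  {HX : Type*} [TopologicalSpace HX] {IX : ModelWithCorners ℝ EX HX} [IX.Boundaryless]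
  {X : Type*} [TopologicalSpace X] [ChartedSpace HX X] [IsManifold IX ∞ X]
  {i : A.TransverseMap IX X}
  {G : Type*} [NormedAddCommGroup G] [NormedSpace ℝ G] [FiniteDimensional ℝ G]
  {W : X → Type*} [∀ x, AddCommGroup (W x)] [∀ x, Module ℝ (W x)]
  [∀ x, TopologicalSpace (W x)] [TopologicalSpace (TotalSpace G W)]
  [FiberBundle G W] [VectorBundle ℝ G W] [ContMDiffVectorBundle ∞ G W IX]

namespace TransverseFamily

variable {a : TransverseFamily i G W} {x₀ : X} {N : Set (EX × G)} {m : ℝ × (EX × G) → EM}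
  {Ψ : ℝ × (EX × G) → (EX × G) × F →L[ℝ] F}

variable (i G W x₀ m) in
/-- The flow of the anchors of the family of sections, obtained from a solution in charts. -/
noncomputable def localFlow (t : ℝ) (w : TotalSpace G W) : M :=
  (extChartAt IM (i x₀)).symm (m (t, vbChart IX G W x₀ w))

variable (i G W x₀ m Ψ) in
/-- The transport obtained from a solution in charts. -/
noncomputable def localTransport (t : ℝ) (w : TotalSpace G W)
    (u : TangentSpace (IX.prod 𝓘(ℝ, G)) w) (c : V (i w.proj)) : V (localFlow i G W x₀ m t w) :=
  (trivializationAt F V (i x₀)).symmL ℝ _ (Ψ (t, vbChart IX G W x₀ w)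
    (mvfderiv (IX.prod 𝓘(ℝ, G)) (vbChart IX G W x₀) w u,
      (trivializationAt F V (i x₀)).continuousLinearMapAt ℝ (i w.proj) c))

/-- Fibres over points that are only provably equal are different types. Elements of `A` are
therefore compared in the total space. -/
theorem totalSpace_mk_symmL (e : Trivialization F (TotalSpace.proj : TotalSpace F V → M))
    [MemTrivializationAtlas e] {z z' : M} (hz : z = z') {v v' : F} (hv : v = v') :
    (⟨z, e.symmL ℝ z v⟩ : TotalSpace F V) = ⟨z', e.symmL ℝ z' v'⟩ := by
  subst hz hv; rfl

theorem localFlow_mem (hS : (a.localFamily x₀).IsSolution N m Ψ) {w : TotalSpace G W}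
    (hN : vbChart IX G W x₀ w ∈ N) {t : ℝ} (ht : t ∈ Ioo (-2 : ℝ) 2) :
    localFlow i G W x₀ m t w ∈ vbSource IM F V (i x₀) :=
  have h := hS.mem t ht _ hN
  ⟨(extChartAt IM (i x₀)).map_target h.1, h.2⟩

/-- The chart equations give the transport equation in the trivialization around `i x₀`, and
`hasDerivAt_transition` carries it to every other one. This frees the notion from the chart, as the
comparison of different charts requires. -/
theorem isTransport_localTransport (hS : (a.localFamily x₀).IsSolution N m Ψ) {w : TotalSpace G W}
    (hw : w.proj ∈ localBase i G W x₀) (hN : vbChart IX G W x₀ w ∈ N)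
    (u : TangentSpace (IX.prod 𝓘(ℝ, G)) w) (c : V (i w.proj)) :
    a.IsTransport w u c fun t ↦ ⟨localFlow i G W x₀ m t w, localTransport i G W x₀ m Ψ t w u c⟩ := by
  set e := trivializationAt F V (i x₀) with he
  have hder : ∀ t ∈ Ioo (-2 : ℝ) 2, HasMFDerivAt 𝓘(ℝ, ℝ) IM (fun s ↦ localFlow i G W x₀ m s w) t
      ((1 : ℝ →L[ℝ] ℝ).smulRight (A.anchor (localFlow i G W x₀ m t w)
        (a.toFun w (localFlow i G W x₀ m t w)))) := by
    intro t ht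
    have h1 := hS.hasDerivAt_m t ht _ hN
    have hμ := hS.mem t ht _ hN
    rw [localFamily_a hw.1] at h1
    refine hasMFDerivAt_extChartAt_symm_comp hμ.1 (h1.congr_deriv ?_)
    change mvfderiv IM _ _ (A.anchor _ (e.symmL ℝ _ (e.continuousLinearMapAt ℝ _ _))) = _
    rw [e.symmL_continuousLinearMapAt hμ.2]
    rfl
  refine ⟨?_, hder, fun t ht e' _ he' ↦ ?_⟩
  · have h1 : localFlow i G W x₀ m 0 w = i w.proj := by
      rw [localFlow, hS.m_zero _ hN]
      exact (congrArg _ (localFamily_j hw.1)).trans ((extChartAt IM (i x₀)).left_inv hw.2.1)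
    have h2 := totalSpace_mk_symmL e h1 (congrArg (fun L ↦ L
      (mvfderiv (IX.prod 𝓘(ℝ, G)) (vbChart IX G W x₀) w u, e.continuousLinearMapAt ℝ (i w.proj) c))
      (hS.Ψ_zero _ hN))
    exact h2.trans (congrArg (TotalSpace.mk _) (e.symmL_continuousLinearMapAt hw.2.2 c))
  · refine a.hasDerivAt_transition e e' (γ := fun t ↦ localFlow i G W x₀ m t w)
      (b := fun t ↦ localTransport i G W x₀ m Ψ t w u c) (hder t ht)
      (localFlow_mem hS hN ht).2 he' ?_
    have h1 {s : ℝ} (hs : s ∈ Ioo (-2 : ℝ) 2) : e.continuousLinearMapAt ℝ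
        (localFlow i G W x₀ m s w) (localTransport i G W x₀ m Ψ s w u c) =
        Ψ (s, vbChart IX G W x₀ w) (mvfderiv (IX.prod 𝓘(ℝ, G)) (vbChart IX G W x₀) w u,
          e.continuousLinearMapAt ℝ (i w.proj) c) :=
      e.continuousLinearMapAt_symmL (localFlow_mem hS hN hs).2 _
    have h2 := hS.hasDerivAt_Ψ t ht _ hN (mvfderiv (IX.prod 𝓘(ℝ, G)) (vbChart IX G W x₀) w u,
          e.continuousLinearMapAt ℝ (i w.proj) c)
    rw [rhs_localFamily hw u (hS.mem t ht _ hN), ← h1 ht] at h2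
    refine h2.congr_of_eventuallyEq ?_
    filter_upwards [isOpen_Ioo.mem_nhds ht] with s hs using h1 hs

/-- Uniqueness of the transport. -/
theorem IsTransport.eq_localTransport (hS : (a.localFamily x₀).IsSolution N m Ψ)
    {w : TotalSpace G W} (hw : w.proj ∈ localBase i G W x₀) (hN : vbChart IX G W x₀ w ∈ N)
    {u : TangentSpace (IX.prod 𝓘(ℝ, G)) w} {c : V (i w.proj)} {b : ℝ → TotalSpace F V}
    (hb : a.IsTransport w u c b) {t : ℝ} (ht : t ∈ Ioo (-2 : ℝ) 2) :
    b t = ⟨localFlow i G W x₀ m t w, localTransport i G W x₀ m Ψ t w u c⟩ := by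
  have : CompleteSpace EM := FiniteDimensional.complete ℝ EM
  have : IsManifold IM 1 M := .of_le (n := ∞) (by simp)
  set e := trivializationAt F V (i x₀) with he
  have hL := isTransport_localTransport hS hw hN u c
  have hv : ContMDiff IM IM.tangent 1
      (fun z ↦ (⟨z, A.anchor z (a.toFun w z)⟩ : TangentBundle IM M)) := fun z ↦
    (A.contMDiffAt_anchor_section (g := id) contMDiffAt_id
      ((a.contMDiff.comp (contMDiff_const.prodMk contMDiff_id)).contMDiffAt
        (x := z))).of_le (by simp)
  -- The base curves agree as integral curves of the smooth field `ρ(a_w)` on `M`. The competing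
  -- curve therefore stays in the base set of the trivialization, where uniqueness for the linear
  -- transport equation compares the fibre components.
  have hproj : EqOn (fun t ↦ (b t).proj) (fun t ↦ localFlow i G W x₀ m t w) (Ioo (-2) 2) :=
    isMIntegralCurveOn_Ioo_eqOn_of_contMDiff_boundaryless (t₀ := 0) (by norm_num) hv
      (fun t ht ↦ (hb.hasMFDerivAt t ht).hasMFDerivWithinAt)
      (fun t ht ↦ (hL.hasMFDerivAt t ht).hasMFDerivWithinAt)
      (congrArg TotalSpace.proj (hb.zero.trans hL.zero.symm))
  have hmem {t : ℝ} (ht : t ∈ Ioo (-2 : ℝ) 2) : (b t).proj ∈ e.baseSet := by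
    rw [show (b t).proj = _ from hproj ht]
    exact (localFlow_mem hS hN ht).2
  have h1 := hS.transport_unique hN (u := mvfderiv (IX.prod 𝓘(ℝ, G)) (vbChart IX G W x₀) w u)
    (f := fun t ↦ e.continuousLinearMapAt ℝ (b t).proj (b t).2)
    (g := fun t ↦ Ψ (t, vbChart IX G W x₀ w)
      (mvfderiv (IX.prod 𝓘(ℝ, G)) (vbChart IX G W x₀) w u,
        e.continuousLinearMapAt ℝ (i w.proj) c))
    (fun t ht ↦ by
      rw [rhs_localFamily hw u (hS.mem t ht _ hN)]
      have h2 := hb.hasDerivAt t ht e (hmem ht)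
      exact h2.congr_deriv (congrArg (fun z ↦ a.transportRHS e w u z
        (e.continuousLinearMapAt ℝ (b t).proj (b t).2)) (hproj ht)))
    (fun t ht ↦ hS.hasDerivAt_Ψ t ht _ hN _)
    (by
      have h3 : e.continuousLinearMapAt ℝ (b 0).proj (b 0).2 =
          e.continuousLinearMapAt ℝ (i w.proj) c := by rw [hb.zero]
      rw [h3, hS.Ψ_zero _ hN]
      rfl) ht
  have h2 : (⟨(b t).proj, e.symmL ℝ _ (e.continuousLinearMapAt ℝ (b t).proj (b t).2)⟩ :
      TotalSpace F V) = b t := congrArg (TotalSpace.mk _) (e.symmL_continuousLinearMapAt (hmem ht) _)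
  exact h2.symm.trans (totalSpace_mk_symmL e (hproj ht) h1)

end TransverseFamily
end LocalTransport

/-! ### Pullback of a pullback. -/

namespace LieAlgebroid
namespace TransverseMap

section IteratedPullback

variable {E : Type*} [NormedAddCommGroup E] [NormedSpace ℝ E] [FiniteDimensional ℝ E]
  {H : Type*} [TopologicalSpace H] {I : ModelWithCorners ℝ E H} [I.Boundaryless]
  {M : Type*} [TopologicalSpace M] [ChartedSpace H M] [IsManifold I ∞ M] [T2Space M]
  {F : Type*} [NormedAddCommGroup F] [NormedSpace ℝ F] [FiniteDimensional ℝ F]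
  {V : M → Type*} [∀ x, AddCommGroup (V x)] [∀ x, Module ℝ (V x)]
  [∀ x, TopologicalSpace (V x)] [TopologicalSpace (TotalSpace F V)]
  [FiberBundle F V] [VectorBundle ℝ F V] [ContMDiffVectorBundle ∞ F V I]
  {A : LieAlgebroid I F V}
  {E' : Type*} [NormedAddCommGroup E'] [NormedSpace ℝ E'] [FiniteDimensional ℝ E']
  {H' : Type*} [TopologicalSpace H'] {I' : ModelWithCorners ℝ E' H'} [I'.Boundaryless]
  {N : Type*} [TopologicalSpace N] [ChartedSpace H' N] [IsManifold I' ∞ N]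
  (f : TransverseMap A I' N)
  (e : Trivialization F (TotalSpace.proj : TotalSpace F V → M)) [MemTrivializationAtlas e]

/-- The canonical map `f^! A → A` is smooth. -/
theorem contMDiff_totalSpace_snd : ContMDiff (I'.prod 𝓘(ℝ, Model E F E')) (I.prod 𝓘(ℝ, F)) ∞
    (fun b : TotalSpace (Model E F E') f.Fiber ↦ (⟨f b.proj, f.snd b.proj b.2⟩ :
      TotalSpace F V)) := by
  intro b₀
  have hp : ContMDiffAt (I'.prod 𝓘(ℝ, Model E F E')) I' ∞
      (TotalSpace.proj : TotalSpace (Model E F E') f.Fiber → N) b₀ :=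
    (Bundle.contMDiff_proj f.Fiber).contMDiffAt
  refine contMDiffAt_of_coord (f.trivA b₀.proj) (f.contMDiff.contMDiffAt.comp b₀ hp) ?_
    (f.mem_preBase b₀.proj).2.1
  have h1 : ContMDiffAt (I'.prod 𝓘(ℝ, Model E F E')) 𝓘(ℝ, Model E F E') ∞
      (fun b : TotalSpace (Model E F E') f.Fiber ↦
        (trivializationAt (Model E F E') f.Fiber b₀.proj).continuousLinearMapAt ℝ b.proj b.2) b₀ :=
    _root_.contMDiffAt_coord (f := TotalSpace.proj)
      (a := fun b : TotalSpace (Model E F E') f.Fiber ↦ b.2) _ contMDiffAt_id (f.mem_base b₀.proj)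
  have h2 := ((f.contMDiffAt_localFrame (f.mem_base b₀.proj)).comp b₀ hp).clm_apply h1
  refine ((ContinuousLinearMap.contMDiffAt (ContinuousLinearMap.snd ℝ E' F)).comp b₀
    h2).congr_of_eventuallyEq ?_
  filter_upwards [hp.continuousAt.preimage_mem_nhds
    ((f.isOpen_base b₀.proj).mem_nhds (f.mem_base b₀.proj))] with b hb
  have h3 : (trivializationAt (Model E F E') f.Fiber b₀.proj).continuousLinearMapAt ℝ b.proj b.2 =
      f.localProj b₀.proj (f.coords b₀.proj b.proj b.2) :=
    continuousLinearMapAt_eq_snd _ hb b.2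
  simp only [Function.comp_apply]
  rw [h3, f.localFrame_localProj hb _ (f.localDiff_coords hb _)]
  rfl

/-- The canonical map `f^! A → A` read in trivializations. -/
noncomputable def sndIn
    (e' : Trivialization (Model E F E') (TotalSpace.proj : TotalSpace (Model E F E') f.Fiber → N))
    [MemTrivializationAtlas e'] (x : N) : Model E F E' →L[ℝ] F :=
  e.continuousLinearMapAt ℝ (f x) ∘L f.snd x ∘L e'.symmL ℝ x

variable {f e} [T2Space N]
  {e' : Trivialization (Model E F E') (TotalSpace.proj : TotalSpace (Model E F E') f.Fiber → N)}
  [MemTrivializationAtlas e']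

theorem contMDiffAt_sndIn {x : N} (hx : x ∈ e'.baseSet) (hfx : f x ∈ e.baseSet) :
    ContMDiffAt I' 𝓘(ℝ, Model E F E' →L[ℝ] F) ∞ (f.sndIn e e') x :=
  contMDiffAt_clm_of_apply fun v ↦ _root_.contMDiffAt_coord e (f.contMDiffAt_snd
    (contMDiffAt_symmL e' (f := id) contMDiffAt_id (contMDiffAt_const (c := v)) hx)) hfx

/-- The map `f^! A → A` preserves brackets; here it is stated for constant sections of a
trivialization of `f^! A`, whose images need not be constant, which explains the derivatives of
`sndIn`. It serves to rewrite brackets of `g^! f^! A`, defined through trivializations of `f^! A`,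
in trivializations of `A`. -/
theorem sndIn_struct {x : N} (hx : x ∈ e'.baseSet) (hfx : f x ∈ e.baseSet)
    (v w : Model E F E') :
    f.sndIn e e' x (f.pullback.struct e' x v w) =
      mvfderiv I' (f.sndIn e e') x (f.pullback.anchor x (e'.symmL ℝ x v)) w -
      mvfderiv I' (f.sndIn e e') x (f.pullback.anchor x (e'.symmL ℝ x w)) v +
      A.struct e (f x) (f.sndIn e e' x v) (f.sndIn e e' x w) := by
  have hL := (contMDiffAt_sndIn (f := f) hx hfx).mdifferentiableAt (by simp)
  have h1 : f.sndIn e e' x (f.pullback.struct e' x v w) =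
      f.bracketIn e (constSection I' e' x v) (constSection I' e' x w) x := by
    rw [← coord_bracketSection hfx, struct_apply, sndIn, ContinuousLinearMap.comp_apply,
      ContinuousLinearMap.comp_apply, e'.symmL_continuousLinearMapAt hx]
    rfl
  have h2 (v : Model E F E') : f.coord e (constSection I' e' x v) =ᶠ[𝓝 x]
      fun z ↦ f.sndIn e e' z v := by
    filter_upwards [constSection_eventually (I := I') e' hx v] with z hz
    rw [coord, hz]
    rfl
  have h3 (v : Model E F E') : f.vec (constSection I' e' x v) x =
      f.pullback.anchor x (e'.symmL ℝ x v) := by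
    rw [vec, (constSection_eventually (I := I') e' hx v).self_of_nhds]
    rfl
  rw [h1, bracketIn, mvfderiv_congr (h2 v), mvfderiv_congr (h2 w), mvfderiv_clm_const hL,
    mvfderiv_clm_const hL, h3, h3, (h2 v).self_of_nhds, (h2 w).self_of_nhds]

variable {E'' : Type*} [NormedAddCommGroup E''] [NormedSpace ℝ E''] [FiniteDimensional ℝ E'']
  {H'' : Type*} [TopologicalSpace H''] {I'' : ModelWithCorners ℝ E'' H''} [I''.Boundaryless]
  {Y : Type*} [TopologicalSpace Y] [ChartedSpace H'' Y] [IsManifold I'' ∞ Y]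
  (g : TransverseMap f.pullback I'' Y)

/-- The component in `A` of the bracket of two sections of `g^! f^! A`. -/
theorem coord_snd_bracket (σ τ : Cₛ^∞⟮I''; Model E' (Model E F E') E'', g.Fiber⟯) {y : Y}
    (hy : f (g y) ∈ e.baseSet) :
    e.continuousLinearMapAt ℝ (f (g y)) (f.snd (g y) (g.snd y (g.pullback.bracket σ τ y))) =
      mvfderiv I'' (fun z ↦ e.continuousLinearMapAt ℝ (f (g z)) (f.snd (g z) (g.snd z (τ z)))) y
        (g.vec σ y) -
      mvfderiv I'' (fun z ↦ e.continuousLinearMapAt ℝ (f (g z)) (f.snd (g z) (g.snd z (σ z)))) y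
        (g.vec τ y) +
      A.struct e (f (g y))
        (e.continuousLinearMapAt ℝ (f (g y)) (f.snd (g y) (g.snd y (σ y))))
        (e.continuousLinearMapAt ℝ (f (g y)) (f.snd (g y) (g.snd y (τ y)))) := by
  have hx : g y ∈ (g.trivA y).baseSet := (g.mem_preBase y).2.1
  have hL := contMDiffAt_sndIn (f := f) (e := e) hx hy
  have h1 {σ : Cₛ^∞⟮I''; Model E' (Model E F E') E'', g.Fiber⟯} {z : Y}
      (hz : g z ∈ (g.trivA y).baseSet) :
      e.continuousLinearMapAt ℝ (f (g z)) (f.snd (g z) (g.snd z (σ z))) =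
        f.sndIn e (g.trivA y) (g z) (g.coord (g.trivA y) σ z) := by
    rw [sndIn, ContinuousLinearMap.comp_apply, ContinuousLinearMap.comp_apply, symmL_coord hz]
  have h2 (σ : Cₛ^∞⟮I''; Model E' (Model E F E') E'', g.Fiber⟯) :
      (fun z ↦ e.continuousLinearMapAt ℝ (f (g z)) (f.snd (g z) (g.snd z (σ z)))) =ᶠ[𝓝 y]
        fun z ↦ f.sndIn e (g.trivA y) (g z) (g.coord (g.trivA y) σ z) := by
    filter_upwards [eventually_mem_baseSet hx] with z hz using h1 hz
  have h3 : e.continuousLinearMapAt ℝ (f (g y)) (f.snd (g y) (g.snd y (g.pullback.bracket σ τ y))) =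
      f.sndIn e (g.trivA y) (g y) (g.bracketIn (g.trivA y) σ τ y) := rfl
  rw [h3, mvfderiv_congr (h2 σ), mvfderiv_congr (h2 τ), mvfderiv_comp_coord hx hL,
    mvfderiv_comp_coord hx hL, h1 hx, h1 hx, bracketIn, map_add, map_sub, sndIn_struct hx hy]
  abel

end IteratedPullback

end TransverseMap
end LieAlgebroid

section MvfderivApply

variable {EM : Type*} [NormedAddCommGroup EM] [NormedSpace ℝ EM]
  {HM : Type*} [TopologicalSpace HM] {IM : ModelWithCorners ℝ EM HM}
  {M : Type*} [TopologicalSpace M] [ChartedSpace HM M] [IsManifold IM ∞ M]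

theorem contMDiffAt_mvfderiv_apply_comp {P : Type*} [NormedAddCommGroup P] [NormedSpace ℝ P]
    {Y : Type*} [TopologicalSpace Y] {EY : Type*} [NormedAddCommGroup EY]
    [NormedSpace ℝ EY] {HY : Type*} [TopologicalSpace HY] {J : ModelWithCorners ℝ EY HY}
    [ChartedSpace HY Y] {g : M → P} {f : Y → M} {y : Y} {u : ∀ y, TangentSpace IM (f y)}
    (hg : ContMDiffAt IM 𝓘(ℝ, P) ∞ g (f y)) (hf : ContMDiffAt J IM ∞ f y)
    (hu : ContMDiffAt J IM.tangent ∞ (fun y ↦ (⟨f y, u y⟩ : TangentBundle IM M)) y) :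
    ContMDiffAt J 𝓘(ℝ, P) ∞ (fun y ↦ mvfderiv IM g (f y) (u y)) y := by
  have : IsManifold IM 1 M := .of_le (n := ∞) (by simp)
  have h1 := (hg.mfderiv_const (m := ∞) (by simp)).comp y hf
  have h2 : ContMDiffAt J 𝓘(ℝ, P).tangent ∞
      (fun y ↦ (⟨g (f y), mfderiv IM 𝓘(ℝ, P) g (f y) (u y)⟩ : TangentBundle 𝓘(ℝ, P) P)) y :=
    ContMDiffAt.clm_apply_of_inCoordinates (b₁ := f) (b₂ := fun y ↦ g (f y)) h1 hu (hg.comp y hf)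
  exact (contMDiff_snd_tangentBundle_modelSpace P 𝓘(ℝ, P)).contMDiffAt.comp y h2

end MvfderivApply

/-! ### The transport at time 1 as a bundle map in charts. -/

section LocalMorphism

variable {EM : Type*} [NormedAddCommGroup EM] [NormedSpace ℝ EM] [FiniteDimensional ℝ EM]
  {HM : Type*} [TopologicalSpace HM] {IM : ModelWithCorners ℝ EM HM} [IM.Boundaryless]
  {M : Type*} [TopologicalSpace M] [ChartedSpace HM M] [IsManifold IM ∞ M]
  [T2Space M]
  {F : Type*} [NormedAddCommGroup F] [NormedSpace ℝ F] [FiniteDimensional ℝ F]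
  {V : M → Type*} [∀ x, AddCommGroup (V x)] [∀ x, Module ℝ (V x)]
  [∀ x, TopologicalSpace (V x)] [TopologicalSpace (TotalSpace F V)]
  [FiberBundle F V] [VectorBundle ℝ F V] [ContMDiffVectorBundle ∞ F V IM]
  {A : LieAlgebroid IM F V}
  {EX : Type*} [NormedAddCommGroup EX] [NormedSpace ℝ EX] [FiniteDimensional ℝ EX]
  {HX : Type*} [TopologicalSpace HX] {IX : ModelWithCorners ℝ EX HX} [IX.Boundaryless]
  {X : Type*} [TopologicalSpace X] [ChartedSpace HX X] [IsManifold IX ∞ X]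
  [T2Space X]
  {i : A.TransverseMap IX X}
  {G : Type*} [NormedAddCommGroup G] [NormedSpace ℝ G] [FiniteDimensional ℝ G]
  {W : X → Type*} [∀ x, AddCommGroup (W x)] [∀ x, Module ℝ (W x)]
  [∀ x, TopologicalSpace (W x)] [TopologicalSpace (TotalSpace G W)]
  [FiberBundle G W] [VectorBundle ℝ G W] [ContMDiffVectorBundle ∞ G W IX]

namespace TransverseFamily

variable {a : TransverseFamily i G W} {x₀ : X} {N : Set (EX × G)} {m : ℝ × (EX × G) → EM}
  {Ψ : ℝ × (EX × G) → (EX × G) × F →L[ℝ] F}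

theorem fderiv_localFamily_j {w : TotalSpace G W} (hw : w.proj ∈ localBase i G W x₀)
    (u : TangentSpace (IX.prod 𝓘(ℝ, G)) w) :
    fderiv ℝ (a.localFamily x₀).j (vbChart IX G W x₀ w).1
      (mvfderiv (IX.prod 𝓘(ℝ, G)) (vbChart IX G W x₀) w u).1 =
    mvfderiv IM (extChartAt IM (i x₀)) (i w.proj) (mfderiv IX IM i w.proj
      (mfderiv (IX.prod 𝓘(ℝ, G)) IX (TotalSpace.proj : TotalSpace G W → X) w u)) := by
  have hχ := (contMDiffAt_vbChart hw.1).mdifferentiableAt (by simp)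
  have hp : MDifferentiableAt (IX.prod 𝓘(ℝ, G)) IX (TotalSpace.proj : TotalSpace G W → X) w :=
    (Bundle.contMDiff_proj W (n := ∞)).contMDiffAt.mdifferentiableAt (by simp)
  have hi : MDifferentiableAt IX IM i w.proj :=
    i.contMDiff.contMDiffAt.mdifferentiableAt (by simp)
  have hκ : MDifferentiableAt IM 𝓘(ℝ, EM) (extChartAt IM (i x₀)) (i w.proj) :=
    (contMDiffAt_extChartAt' (n := ∞) (by simpa using hw.2.1)).mdifferentiableAt (by simp)
  have hj : DifferentiableAt ℝ (a.localFamily x₀).j (vbChart IX G W x₀ w).1 :=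
    ((a.localFamily x₀).contDiffOn_j.contDiffAt
      ((a.localFamily x₀).isOpen_domQ.mem_nhds (mem_domQ hw))).differentiableAt (by simp)
  have h1 : (fun z : TotalSpace G W ↦ (a.localFamily x₀).j (vbChart IX G W x₀ z).1) =ᶠ[𝓝 w]
      fun z ↦ extChartAt IM (i x₀) (i z.proj) := by
    filter_upwards [(FiberBundle.continuous_proj G W).continuousAt.preimage_mem_nhds
      ((isOpen_vbSource IX G W x₀).mem_nhds hw.1)] with z hz
    exact localFamily_j hz
  have h2 := mvfderiv_fderiv_comp (I := IX.prod 𝓘(ℝ, G)) (g := (a.localFamily x₀).j)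
    (f := fun z ↦ ContinuousLinearMap.fst ℝ EX G (vbChart IX G W x₀ z)) (x := w) hj
    ((ContinuousLinearMap.contMDiffAt (ContinuousLinearMap.fst ℝ EX G)).comp w
      (contMDiffAt_vbChart hw.1) |>.mdifferentiableAt (by simp)) u
  rw [mvfderiv_clm_comp _ hχ] at h2
  refine h2.symm.trans ?_
  rw [← mvfderiv_comp_apply' hκ hi, ← mvfderiv_comp_apply'
    (g := fun y ↦ extChartAt IM (i x₀) (i y)) (hκ.comp w.proj hi) hp]
  exact DFunLike.congr_fun (mvfderiv_congr h1) u

theorem localFamily_R_j {w : TotalSpace G W} (hw : w.proj ∈ localBase i G W x₀)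
    (c : V (i w.proj)) : (a.localFamily x₀).R ((a.localFamily x₀).j (vbChart IX G W x₀ w).1)
      ((trivializationAt F V (i x₀)).continuousLinearMapAt ℝ (i w.proj) c) =
    mvfderiv IM (extChartAt IM (i x₀)) (i w.proj) (A.anchor (i w.proj) c) := by
  have h1 : (a.localFamily x₀).j (vbChart IX G W x₀ w).1 = extChartAt IM (i x₀) (i w.proj) :=
    localFamily_j hw.1
  have h2 : (a.localFamily x₀).R (extChartAt IM (i x₀) (i w.proj)) =
      A.anchorIn (trivializationAt F V (i x₀)) (extChartAt IM (i x₀)) (i w.proj) :=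
    congrArg (A.anchorIn (trivializationAt F V (i x₀)) (extChartAt IM (i x₀)))
      ((extChartAt IM (i x₀)).left_inv hw.2.1)
  rw [h1, h2, LieAlgebroid.anchorIn, ContinuousLinearMap.comp_apply, ContinuousLinearMap.comp_apply,
    (trivializationAt F V (i x₀)).symmL_continuousLinearMapAt hw.2.2]

/-- The compatibility of initial values required in `fderiv_m` is thus the equation `d(i ∘ p) u =
ρ(c)` read in a chart. -/
theorem fderiv_localFamily_j_eq_iff {w : TotalSpace G W} (hw : w.proj ∈ localBase i G W x₀)
    (u : TangentSpace (IX.prod 𝓘(ℝ, G)) w) (c : V (i w.proj)) :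
    fderiv ℝ (a.localFamily x₀).j (vbChart IX G W x₀ w).1
      (mvfderiv (IX.prod 𝓘(ℝ, G)) (vbChart IX G W x₀) w u).1 =
      (a.localFamily x₀).R ((a.localFamily x₀).j (vbChart IX G W x₀ w).1)
        ((trivializationAt F V (i x₀)).continuousLinearMapAt ℝ (i w.proj) c) ↔
    mfderiv IX IM i w.proj
      (mfderiv (IX.prod 𝓘(ℝ, G)) IX (TotalSpace.proj : TotalSpace G W → X) w u) =
        A.anchor (i w.proj) c := by
  rw [fderiv_localFamily_j hw, localFamily_R_j hw]
  exact (mvfderiv_extChartAt_bijective hw.2.1).1.eq_iff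

/-- An element of the iterated pullback is a pair `(u, (v, c))` with `dp u = v` and `di v = ρ c`.
Eliminating `v` describes it as a compatible pair `(u, c)`. -/
theorem mfderiv_fiber {w : TotalSpace G W} (b : (i.pullback.bundleProj G W).Fiber w) :
    mfderiv IX IM i w.proj (mfderiv (IX.prod 𝓘(ℝ, G)) IX (TotalSpace.proj : TotalSpace G W → X) w
      ((i.pullback.bundleProj G W).fst w b)) =
    A.anchor (i w.proj) (i.snd w.proj ((i.pullback.bundleProj G W).snd w b)) := by
  have h1 := (i.pullback.bundleProj G W).mfderiv_fst b
  have h2 := i.mfderiv_fst ((i.pullback.bundleProj G W).snd w b)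
  exact (congrArg (mfderiv IX IM i w.proj) h1).trans h2

theorem fderiv_localFamily_j_fiber {w : TotalSpace G W} (hw : w.proj ∈ localBase i G W x₀)
    (b : (i.pullback.bundleProj G W).Fiber w) :
    fderiv ℝ (a.localFamily x₀).j (vbChart IX G W x₀ w).1
      (mvfderiv (IX.prod 𝓘(ℝ, G)) (vbChart IX G W x₀) w ((i.pullback.bundleProj G W).fst w b)).1 =
      (a.localFamily x₀).R ((a.localFamily x₀).j (vbChart IX G W x₀ w).1)
        ((trivializationAt F V (i x₀)).continuousLinearMapAt ℝ (i w.proj)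
          (i.snd w.proj ((i.pullback.bundleProj G W).snd w b))) :=
  (fderiv_localFamily_j_eq_iff hw _ _).2 (mfderiv_fiber b)

variable (i G W x₀ m Ψ) in
/-- The morphism of Lie algebroids given by the transport at time `1`, from a solution in charts. -/
noncomputable def localMorphism (w : TotalSpace G W) :
    (i.pullback.bundleProj G W).Fiber w →ₗ[ℝ] V (localFlow i G W x₀ m 1 w) :=
  ((trivializationAt F V (i x₀)).symmL ℝ _ ∘L Ψ (1, vbChart IX G W x₀ w) ∘L
    ((mvfderiv (IX.prod 𝓘(ℝ, G)) (vbChart IX G W x₀) w ∘L (i.pullback.bundleProj G W).fst w).prod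
      ((trivializationAt F V (i x₀)).continuousLinearMapAt ℝ (i w.proj) ∘L i.snd w.proj ∘L
        (i.pullback.bundleProj G W).snd w))).toLinearMap

theorem one_mem : (1 : ℝ) ∈ Ioo (-2 : ℝ) 2 := by norm_num

theorem contMDiffAt_localFlow (hS : (a.localFamily x₀).IsSolution N m Ψ) {w : TotalSpace G W}
    (hw : w.proj ∈ vbSource IX G W x₀) (hN : vbChart IX G W x₀ w ∈ N) :
    ContMDiffAt (IX.prod 𝓘(ℝ, G)) IM ∞ (localFlow i G W x₀ m 1) w :=
  ContMDiffAt.comp w (contMDiffAt_extChartAt_symm (hS.mem 1 one_mem _ hN).1)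
    (ContMDiffAt.comp w (g := fun q ↦ m (1, q))
      (hS.contDiffAt_m_slice one_mem hN).contMDiffAt (contMDiffAt_vbChart hw))

theorem mvfderiv_localFlow (hS : (a.localFamily x₀).IsSolution N m Ψ) {w : TotalSpace G W}
    (hw : w.proj ∈ vbSource IX G W x₀) (hN : vbChart IX G W x₀ w ∈ N)
    (u : TangentSpace (IX.prod 𝓘(ℝ, G)) w) :
    mvfderiv IM (extChartAt IM (i x₀)) (localFlow i G W x₀ m 1 w)
      (mfderiv (IX.prod 𝓘(ℝ, G)) IM (localFlow i G W x₀ m 1) w u) =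
    fderiv ℝ (fun q ↦ m (1, q)) (vbChart IX G W x₀ w)
      (mvfderiv (IX.prod 𝓘(ℝ, G)) (vbChart IX G W x₀) w u) := by
  have hκ : MDifferentiableAt IM 𝓘(ℝ, EM) (extChartAt IM (i x₀)) (localFlow i G W x₀ m 1 w) :=
    (contMDiffAt_extChartAt' (n := ∞)
      (by simpa using (localFlow_mem hS hN one_mem).1)).mdifferentiableAt (by simp)
  have hχ := contMDiffAt_vbChart hw
  rw [← mvfderiv_comp_apply' hκ ((contMDiffAt_localFlow hS hw hN).mdifferentiableAt (by simp)),
    ← mvfderiv_fderiv_comp (g := fun q ↦ m (1, q))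
      ((hS.contDiffAt_m_slice one_mem hN).differentiableAt (by simp))
      (hχ.mdifferentiableAt (by simp))]
  refine DFunLike.congr_fun (mvfderiv_congr ?_) u
  filter_upwards [hχ.continuousAt.preimage_mem_nhds (hS.isOpen.mem_nhds hN)] with z hz
  exact (extChartAt IM (i x₀)).right_inv (hS.mem 1 one_mem _ hz).1

/-- Compatibility with anchors is `fderiv_m` at time 1. The chart of `M` has injective derivative,
so it suffices to check it there. -/
theorem mfderiv_localFlow_fst (hS : (a.localFamily x₀).IsSolution N m Ψ) {w : TotalSpace G W}
    (hw : w.proj ∈ localBase i G W x₀) (hN : vbChart IX G W x₀ w ∈ N)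
    (b : (i.pullback.bundleProj G W).Fiber w) :
    mfderiv (IX.prod 𝓘(ℝ, G)) IM (localFlow i G W x₀ m 1) w
      ((i.pullback.bundleProj G W).fst w b) =
    A.anchor (localFlow i G W x₀ m 1 w) (localMorphism i G W x₀ m Ψ w b) := by
  refine (mvfderiv_extChartAt_bijective (localFlow_mem hS hN one_mem).1).1 ?_
  rw [mvfderiv_localFlow hS hw.1 hN,
    hS.fderiv_m hN (fderiv_localFamily_j_fiber hw b) one_mem]
  rfl

theorem coord_localMorphism (hS : (a.localFamily x₀).IsSolution N m Ψ) {w : TotalSpace G W}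
    (hN : vbChart IX G W x₀ w ∈ N) (b : (i.pullback.bundleProj G W).Fiber w) :
    (trivializationAt F V (i x₀)).continuousLinearMapAt ℝ (localFlow i G W x₀ m 1 w)
      (localMorphism i G W x₀ m Ψ w b) =
    Ψ (1, vbChart IX G W x₀ w) (mvfderiv (IX.prod 𝓘(ℝ, G)) (vbChart IX G W x₀) w
      ((i.pullback.bundleProj G W).fst w b),
      (trivializationAt F V (i x₀)).continuousLinearMapAt ℝ (i w.proj)
        (i.snd w.proj ((i.pullback.bundleProj G W).snd w b))) :=
  (trivializationAt F V (i x₀)).continuousLinearMapAt_symmL (localFlow_mem hS hN one_mem).2 _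

theorem contMDiffAt_localMorphism (hS : (a.localFamily x₀).IsSolution N m Ψ)
    {b₀ : TotalSpace (LieAlgebroid.TransverseMap.Model EX
      (LieAlgebroid.TransverseMap.Model EM F EX) (EX × G)) (i.pullback.bundleProj G W).Fiber}
    (hw : b₀.proj.proj ∈ localBase i G W x₀) (hN : vbChart IX G W x₀ b₀.proj ∈ N) :
    ContMDiffAt ((IX.prod 𝓘(ℝ, G)).prod 𝓘(ℝ, LieAlgebroid.TransverseMap.Model EX
      (LieAlgebroid.TransverseMap.Model EM F EX) (EX × G))) (IM.prod 𝓘(ℝ, F)) ∞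
      (fun b : TotalSpace (LieAlgebroid.TransverseMap.Model EX
        (LieAlgebroid.TransverseMap.Model EM F EX) (EX × G)) (i.pullback.bundleProj G W).Fiber ↦
        (⟨localFlow i G W x₀ m 1 b.proj, localMorphism i G W x₀ m Ψ b.proj b.2⟩ :
          TotalSpace F V)) b₀ := by
  have hp : ContMDiffAt ((IX.prod 𝓘(ℝ, G)).prod 𝓘(ℝ, LieAlgebroid.TransverseMap.Model EX
      (LieAlgebroid.TransverseMap.Model EM F EX) (EX × G))) (IX.prod 𝓘(ℝ, G)) ∞
      (TotalSpace.proj : TotalSpace (LieAlgebroid.TransverseMap.Model EX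
        (LieAlgebroid.TransverseMap.Model EM F EX) (EX × G)) (i.pullback.bundleProj G W).Fiber →
          TotalSpace G W) b₀ :=
    (Bundle.contMDiff_proj (i.pullback.bundleProj G W).Fiber).contMDiffAt
  have hu := contMDiffAt_mvfderiv_apply_comp (contMDiffAt_vbChart hw.1) hp
    ((i.pullback.bundleProj G W).pullback.contMDiffAt_anchor_section hp
      (a := fun b : TotalSpace (LieAlgebroid.TransverseMap.Model EX
        (LieAlgebroid.TransverseMap.Model EM F EX) (EX × G)) (i.pullback.bundleProj G W).Fiber ↦
          b.2) contMDiffAt_id)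
  have hc := _root_.contMDiffAt_coord (trivializationAt F V (i x₀))
    (f := fun b : TotalSpace (LieAlgebroid.TransverseMap.Model EX
        (LieAlgebroid.TransverseMap.Model EM F EX) (EX × G)) (i.pullback.bundleProj G W).Fiber ↦
          i b.proj.proj)
    (a := fun b ↦ i.snd b.proj.proj ((i.pullback.bundleProj G W).snd b.proj b.2))
    ((i.contMDiff_totalSpace_snd.comp
      (i.pullback.bundleProj G W).contMDiff_totalSpace_snd).contMDiffAt (x := b₀)) hw.2.2
  have hΨ := ContMDiffAt.comp b₀ (g := fun q ↦ Ψ (1, q))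
    (hS.contDiffAt_Ψ_slice one_mem hN).contMDiffAt ((contMDiffAt_vbChart hw.1).comp b₀ hp)
  exact contMDiffAt_symmL (trivializationAt F V (i x₀)) ((contMDiffAt_localFlow hS hw.1 hN).comp b₀ hp)
    (hΨ.clm_apply (hu.prodMk_space hc)) (localFlow_mem hS hN one_mem).2

end TransverseFamily
end LocalMorphism

/-! ### Compatibility of the local morphism with brackets. -/

section LocalBracket

variable {EM : Type*} [NormedAddCommGroup EM] [NormedSpace ℝ EM] [FiniteDimensional ℝ EM]
  {HM : Type*} [TopologicalSpace HM] {IM : ModelWithCorners ℝ EM HM} [IM.Boundaryless]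
  {M : Type*} [TopologicalSpace M] [ChartedSpace HM M] [IsManifold IM ∞ M]
  [T2Space M]
  {F : Type*} [NormedAddCommGroup F] [NormedSpace ℝ F] [FiniteDimensional ℝ F]
  {V : M → Type*} [∀ x, AddCommGroup (V x)] [∀ x, Module ℝ (V x)]
  [∀ x, TopologicalSpace (V x)] [TopologicalSpace (TotalSpace F V)]
  [FiberBundle F V] [VectorBundle ℝ F V] [ContMDiffVectorBundle ∞ F V IM]
  {A : LieAlgebroid IM F V}
  {EX : Type*} [NormedAddCommGroup EX] [NormedSpace ℝ EX] [FiniteDimensional ℝ EX]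
  {HX : Type*} [TopologicalSpace HX] {IX : ModelWithCorners ℝ EX HX} [IX.Boundaryless]
  {X : Type*} [TopologicalSpace X] [ChartedSpace HX X] [IsManifold IX ∞ X]
  [T2Space X]
  {i : A.TransverseMap IX X}
  {G : Type*} [NormedAddCommGroup G] [NormedSpace ℝ G] [FiniteDimensional ℝ G]
  {W : X → Type*} [∀ x, AddCommGroup (W x)] [∀ x, Module ℝ (W x)]
  [∀ x, TopologicalSpace (W x)] [TopologicalSpace (TotalSpace G W)]
  [FiberBundle G W] [VectorBundle ℝ G W] [ContMDiffVectorBundle ∞ G W IX]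

/-- The derivative of a function on the total space of a vector bundle, computed in a chart. -/
theorem fderiv_comp_vbChartSymm {P : Type*} [NormedAddCommGroup P] [NormedSpace ℝ P]
    {k : TotalSpace G W → P} {x₀ : X} {w : TotalSpace G W} (hw : w.proj ∈ vbSource IX G W x₀)
    (hk : ContMDiffAt (IX.prod 𝓘(ℝ, G)) 𝓘(ℝ, P) ∞ k w) (u : TangentSpace (IX.prod 𝓘(ℝ, G)) w) :
    fderiv ℝ (fun p ↦ k (vbChartSymm IX G W x₀ p)) (vbChart IX G W x₀ w)
      (mvfderiv (IX.prod 𝓘(ℝ, G)) (vbChart IX G W x₀) w u) = mvfderiv (IX.prod 𝓘(ℝ, G)) k w u := by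
  have h1 : ContDiffAt ℝ ∞ (fun p ↦ k (vbChartSymm IX G W x₀ p)) (vbChart IX G W x₀ w) :=
    contMDiffAt_iff_contDiffAt.1 (ContMDiffAt.comp (vbChart IX G W x₀ w) (g := k)
      (by rwa [vbChartSymm_vbChart hw]) (contMDiffAt_vbChartSymm (vbChart_mem_vbTarget hw)))
  rw [← mvfderiv_fderiv_comp (g := fun p ↦ k (vbChartSymm IX G W x₀ p))
    (h1.differentiableAt (by simp)) ((contMDiffAt_vbChart hw).mdifferentiableAt (by simp))]
  refine DFunLike.congr_fun (mvfderiv_congr ?_) u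
  filter_upwards [(FiberBundle.continuous_proj G W).continuousAt.preimage_mem_nhds
    ((isOpen_vbSource IX G W x₀).mem_nhds hw)] with z hz
  rw [vbChartSymm_vbChart hz]

namespace TransverseFamily

variable {a : TransverseFamily i G W} {x₀ : X} {N : Set (EX × G)} {m : ℝ × (EX × G) → EM}
  {Ψ : ℝ × (EX × G) → (EX × G) × F →L[ℝ] F}

theorem vbChartSymm_mem_localBase (hS : (a.localFamily x₀).IsSolution N m Ψ) {p : EX × G}
    (hp : p ∈ N) : (vbChartSymm IX G W x₀ p).proj ∈ localBase i G W x₀ :=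
  ⟨vbChartSymm_mem_vbSource (hS.subset p hp).1, (hS.subset p hp).2⟩

section Bracket

variable (i x₀) in
/-- The tangent component of a section, read in a chart. -/
noncomputable def tangentCoord
    (σ : Cₛ^∞⟮IX.prod 𝓘(ℝ, G); LieAlgebroid.TransverseMap.Model EX
      (LieAlgebroid.TransverseMap.Model EM F EX) (EX × G), (i.pullback.bundleProj G W).Fiber⟯)
    (w : TotalSpace G W) : EX × G :=
  mvfderiv (IX.prod 𝓘(ℝ, G)) (vbChart IX G W x₀) w ((i.pullback.bundleProj G W).vec σ w)

variable (i x₀) in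
/-- The component in `A` of a section, read in a trivialization. -/
noncomputable def fiberCoord
    (σ : Cₛ^∞⟮IX.prod 𝓘(ℝ, G); LieAlgebroid.TransverseMap.Model EX
      (LieAlgebroid.TransverseMap.Model EM F EX) (EX × G), (i.pullback.bundleProj G W).Fiber⟯)
    (w : TotalSpace G W) : F :=
  (trivializationAt F V (i x₀)).continuousLinearMapAt ℝ (i w.proj)
    (i.snd w.proj ((i.pullback.bundleProj G W).snd w (σ w)))

variable (σ τ : Cₛ^∞⟮IX.prod 𝓘(ℝ, G); LieAlgebroid.TransverseMap.Model EX
      (LieAlgebroid.TransverseMap.Model EM F EX) (EX × G), (i.pullback.bundleProj G W).Fiber⟯)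

theorem contMDiffAt_tangentCoord {w : TotalSpace G W} (hw : w.proj ∈ localBase i G W x₀) :
    ContMDiffAt (IX.prod 𝓘(ℝ, G)) 𝓘(ℝ, EX × G) ∞ (tangentCoord i x₀ σ) w :=
  contMDiffAt_mvfderiv_apply (contMDiffAt_vbChart hw.1)
    (LieAlgebroid.TransverseMap.contMDiffAt_vec σ w)

theorem contMDiffAt_fiberCoord {w : TotalSpace G W} (hw : w.proj ∈ localBase i G W x₀) :
    ContMDiffAt (IX.prod 𝓘(ℝ, G)) 𝓘(ℝ, F) ∞ (fiberCoord i x₀ σ) w :=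
  _root_.contMDiffAt_coord (trivializationAt F V (i x₀))
    (f := fun w : TotalSpace G W ↦ i w.proj)
    (a := fun w ↦ i.snd w.proj ((i.pullback.bundleProj G W).snd w (σ w)))
    ((i.contMDiff_totalSpace_snd.comp ((i.pullback.bundleProj G W).contMDiff_totalSpace_snd.comp
      σ.contMDiff)).contMDiffAt (x := w)) hw.2.2

theorem contDiffOn_comp_vbChartSymm (hS : (a.localFamily x₀).IsSolution N m Ψ)
    {P : Type*} [NormedAddCommGroup P] [NormedSpace ℝ P] {k : TotalSpace G W → P}
    (hk : ∀ {w : TotalSpace G W}, w.proj ∈ localBase i G W x₀ →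
      ContMDiffAt (IX.prod 𝓘(ℝ, G)) 𝓘(ℝ, P) ∞ k w) :
    ContDiffOn ℝ ∞ (fun p ↦ k (vbChartSymm IX G W x₀ p)) N := fun p hp ↦
  (contMDiffAt_iff_contDiffAt.1 (ContMDiffAt.comp p (g := k)
    (hk (vbChartSymm_mem_localBase hS hp))
    (contMDiffAt_vbChartSymm (hS.subset p hp).1))).contDiffWithinAt

/-- The derivative of the image of a section under the local morphism. -/
theorem fderiv_Ψ_coord (hS : (a.localFamily x₀).IsSolution N m Ψ) {w : TotalSpace G W}
    (hw : w.proj ∈ localBase i G W x₀) (hN : vbChart IX G W x₀ w ∈ N) (a₂ : Cₛ^∞⟮IM; F, V⟯)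
    (hτ : ∀ᶠ z in 𝓝 w, localMorphism i G W x₀ m Ψ z (τ z) = a₂ (localFlow i G W x₀ m 1 z))
    (b : (i.pullback.bundleProj G W).Fiber w) :
    fderiv ℝ (fun q ↦ Ψ (1, q) (tangentCoord i x₀ τ (vbChartSymm IX G W x₀ q),
        fiberCoord i x₀ τ (vbChartSymm IX G W x₀ q))) (vbChart IX G W x₀ w)
        (mvfderiv (IX.prod 𝓘(ℝ, G)) (vbChart IX G W x₀) w
          ((i.pullback.bundleProj G W).fst w b)) =
      mvfderiv IM (fun y ↦ (trivializationAt F V (i x₀)).continuousLinearMapAt ℝ y (a₂ y))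
        (localFlow i G W x₀ m 1 w)
        (A.anchor (localFlow i G W x₀ m 1 w) (localMorphism i G W x₀ m Ψ w b)) := by
  have hχ := contMDiffAt_vbChart hw.1
  have hfl := localFlow_mem hS hN one_mem
  -- By `hτ` the transported components of `τ` are, near `w`, the coordinates of `a₂` composed with
  -- the flow. The anchor of the image of `b` is the derivative of the flow along the tangent part
  -- of `b`, so the claim is the chain rule.
  rw [← mfderiv_localFlow_fst hS hw hN, ← mvfderiv_comp_apply'
    ((LieAlgebroid.contMDiffAt_coord_section (trivializationAt F V (i x₀)) a₂ hfl.2).mdifferentiableAt (by simp))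
    ((contMDiffAt_localFlow hS hw.1 hN).mdifferentiableAt (by simp)),
    ← mvfderiv_fderiv_comp (g := fun q ↦ Ψ (1, q) (tangentCoord i x₀ τ (vbChartSymm IX G W x₀ q),
        fiberCoord i x₀ τ (vbChartSymm IX G W x₀ q))) (((hS.contDiffAt_Ψ_slice one_mem hN).clm_apply
        (((contDiffOn_comp_vbChartSymm hS (contMDiffAt_tangentCoord τ)).contDiffAt
          (hS.isOpen.mem_nhds hN)).prodMk
          ((contDiffOn_comp_vbChartSymm hS (contMDiffAt_fiberCoord τ)).contDiffAt
          (hS.isOpen.mem_nhds hN)))).differentiableAt (by simp)) (hχ.mdifferentiableAt (by simp))]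
  refine DFunLike.congr_fun (mvfderiv_congr ?_) _
  filter_upwards [hτ, hχ.continuousAt.preimage_mem_nhds (hS.isOpen.mem_nhds hN),
    (FiberBundle.continuous_proj G W).continuousAt.preimage_mem_nhds
      ((isOpen_vbSource IX G W x₀).mem_nhds hw.1)] with z hz hzN hzS
  rw [← hz, coord_localMorphism hS hzN, vbChartSymm_vbChart hzS]
  rfl

/-- `Ψ_bracket` is applied at time 1 to the chart components of `σ` and `τ`. Its left side is the
local formula for the bracket of `a₁` and `a₂`, by `fderiv_Ψ_coord`. Its right side is the transport
of the components of the bracket of `σ` and `τ`: the Lie bracket of the tangent parts (`h7`) and the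
component in `A` (`h8`). -/
theorem localMorphism_bracket (hS : (a.localFamily x₀).IsSolution N m Ψ) {w : TotalSpace G W}
    (hw : w.proj ∈ localBase i G W x₀) (hN : vbChart IX G W x₀ w ∈ N)
    (a₁ a₂ : Cₛ^∞⟮IM; F, V⟯)
    (hσ : ∀ᶠ z in 𝓝 w, localMorphism i G W x₀ m Ψ z (σ z) = a₁ (localFlow i G W x₀ m 1 z))
    (hτ : ∀ᶠ z in 𝓝 w, localMorphism i G W x₀ m Ψ z (τ z) = a₂ (localFlow i G W x₀ m 1 z)) :
    localMorphism i G W x₀ m Ψ w ((i.pullback.bundleProj G W).pullback.bracket σ τ w) =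
      A.bracket a₁ a₂ (localFlow i G W x₀ m 1 w) := by
  have : CompleteSpace (EX × G) := FiniteDimensional.complete ℝ (EX × G)
  have hfl := localFlow_mem hS hN one_mem
  have hp := vbChartSymm_vbChart hw.1
  have hχ := contMDiffAt_vbChart hw.1
  have hcomp (σ : Cₛ^∞⟮IX.prod 𝓘(ℝ, G); LieAlgebroid.TransverseMap.Model EX
      (LieAlgebroid.TransverseMap.Model EM F EX) (EX × G), (i.pullback.bundleProj G W).Fiber⟯) :
      ∀ q ∈ N, fderiv ℝ (a.localFamily x₀).j q.1
        (tangentCoord i x₀ σ (vbChartSymm IX G W x₀ q)).1 =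
          (a.localFamily x₀).R ((a.localFamily x₀).j q.1)
            (fiberCoord i x₀ σ (vbChartSymm IX G W x₀ q)) := by
    intro q hq
    have h1 := fderiv_localFamily_j_fiber (a := a) (vbChartSymm_mem_localBase hS hq)
      (σ (vbChartSymm IX G W x₀ q))
    rwa [vbChart_vbChartSymm (hS.subset q hq).1] at h1
  have key := hS.Ψ_bracket hS.isOpen subset_rfl hN
    (contDiffOn_comp_vbChartSymm hS (contMDiffAt_tangentCoord σ))
    (contDiffOn_comp_vbChartSymm hS (contMDiffAt_tangentCoord τ))
    (contDiffOn_comp_vbChartSymm hS (contMDiffAt_fiberCoord σ))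
    (contDiffOn_comp_vbChartSymm hS (contMDiffAt_fiberCoord τ)) (hcomp σ) (hcomp τ) one_mem
  simp only [hp] at key
  have hu (σ τ : Cₛ^∞⟮IX.prod 𝓘(ℝ, G); LieAlgebroid.TransverseMap.Model EX
      (LieAlgebroid.TransverseMap.Model EM F EX) (EX × G), (i.pullback.bundleProj G W).Fiber⟯) :
      fderiv ℝ (fun p ↦ tangentCoord i x₀ τ (vbChartSymm IX G W x₀ p)) (vbChart IX G W x₀ w)
        (tangentCoord i x₀ σ w) = _ :=
    fderiv_comp_vbChartSymm hw.1 (contMDiffAt_tangentCoord τ hw)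
      ((i.pullback.bundleProj G W).vec σ w)
  have hc (σ τ : Cₛ^∞⟮IX.prod 𝓘(ℝ, G); LieAlgebroid.TransverseMap.Model EX
      (LieAlgebroid.TransverseMap.Model EM F EX) (EX × G), (i.pullback.bundleProj G W).Fiber⟯) :
      fderiv ℝ (fun p ↦ fiberCoord i x₀ τ (vbChartSymm IX G W x₀ p)) (vbChart IX G W x₀ w)
        (tangentCoord i x₀ σ w) = _ :=
    fderiv_comp_vbChartSymm hw.1 (contMDiffAt_fiberCoord τ hw)
      ((i.pullback.bundleProj G W).vec σ w)
  have hC : (a.localFamily x₀).C ((a.localFamily x₀).j (vbChart IX G W x₀ w).1) =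
      A.struct (trivializationAt F V (i x₀)) (i w.proj) :=
    (congrArg (a.localFamily x₀).C (localFamily_j hw.1)).trans
      (congrArg (A.struct (trivializationAt F V (i x₀))) ((extChartAt IM (i x₀)).left_inv hw.2.1))
  have h1 (σ : Cₛ^∞⟮IX.prod 𝓘(ℝ, G); LieAlgebroid.TransverseMap.Model EX
      (LieAlgebroid.TransverseMap.Model EM F EX) (EX × G), (i.pullback.bundleProj G W).Fiber⟯)
      (a₁ : Cₛ^∞⟮IM; F, V⟯)
      (hσ : localMorphism i G W x₀ m Ψ w (σ w) = a₁ (localFlow i G W x₀ m 1 w)) :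
      Ψ (1, vbChart IX G W x₀ w) (tangentCoord i x₀ σ w, fiberCoord i x₀ σ w) =
        (trivializationAt F V (i x₀)).continuousLinearMapAt ℝ (localFlow i G W x₀ m 1 w)
          (a₁ (localFlow i G W x₀ m 1 w)) := by
    rw [← hσ, coord_localMorphism hS hN]
    rfl
  have h2 := fderiv_Ψ_coord τ hS hw hN a₂ hτ (σ w)
  have h3 := fderiv_Ψ_coord σ hS hw hN a₁ hσ (τ w)
  rw [hσ.self_of_nhds] at h2
  rw [hτ.self_of_nhds] at h3
  rw [h1 σ a₁ hσ.self_of_nhds, h1 τ a₂ hτ.self_of_nhds, hu, hu, hc, hc, hC] at key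
  have h4 := A.bracket_expand (trivializationAt F V (i x₀)) a₁ a₂ hfl.2
  rw [← h2, ← h3] at h4
  have h5 : (trivializationAt F V (i x₀)).continuousLinearMapAt ℝ (localFlow i G W x₀ m 1 w)
      (A.bracket a₁ a₂ (localFlow i G W x₀ m 1 w)) = _ := h4.trans key
  have h6 := coord_localMorphism hS hN ((i.pullback.bundleProj G W).pullback.bracket σ τ w)
  have h7 : mvfderiv (IX.prod 𝓘(ℝ, G)) (vbChart IX G W x₀) w ((i.pullback.bundleProj G W).fst w
      ((i.pullback.bundleProj G W).pullback.bracket σ τ w)) = _ :=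
    mvfderiv_mlieBracket hχ (LieAlgebroid.TransverseMap.contMDiffAt_vec σ w)
      (LieAlgebroid.TransverseMap.contMDiffAt_vec τ w)
  have h8 := LieAlgebroid.TransverseMap.coord_snd_bracket (e := trivializationAt F V (i x₀))
    (i.pullback.bundleProj G W) σ τ (y := w) hw.2.2
  have h9 := h6.trans ((congrArg (Ψ (1, vbChart IX G W x₀ w)) (Prod.ext h7 h8)).trans h5.symm)
  rw [← (trivializationAt F V (i x₀)).symmL_continuousLinearMapAt (R := ℝ) hfl.2
    (localMorphism i G W x₀ m Ψ w _), h9,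
    (trivializationAt F V (i x₀)).symmL_continuousLinearMapAt hfl.2]

end Bracket

end TransverseFamily
end LocalBracket

/-! ### Invertible linear maps and the inverse function theorem. -/

section Invertible

variable {E F : Type*} [NormedAddCommGroup E] [NormedSpace ℝ E] [NormedAddCommGroup F]
  [NormedSpace ℝ F]

theorem ContinuousLinearMap.isInvertible_of_injective_of_finrank_eq [FiniteDimensional ℝ E]
    [FiniteDimensional ℝ F] {L : E →L[ℝ] F} (hL : Function.Injective L)
    (hd : Module.finrank ℝ E = Module.finrank ℝ F) : L.IsInvertible :=
  ⟨((L : E →ₗ[ℝ] F).linearEquivOfInjective hL hd).toContinuousLinearEquiv, by ext; rfl⟩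

theorem ContinuousLinearMap.isOpen_setOf_isInvertible [CompleteSpace E] :
    IsOpen {L : E →L[ℝ] F | L.IsInvertible} :=
  ContinuousLinearEquiv.isOpen

/-- The inverse function theorem. -/
theorem ContDiffOn.isLocalDiffeomorphAt [CompleteSpace E] {f : E → F} {s : Set E} (hs : IsOpen s)
    (hf : ContDiffOn ℝ ∞ f s) (h : ∀ q ∈ s, (fderiv ℝ f q).IsInvertible) {p : E} (hp : p ∈ s) :
    IsLocalDiffeomorphAt 𝓘(ℝ, E) 𝓘(ℝ, F) ∞ f p := by
  have hf' {q : E} (hq : q ∈ s) : ContDiffAt ℝ ∞ f q := hf.contDiffAt (hs.mem_nhds hq)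
  have hd {q : E} (hq : q ∈ s) : ∃ L : E ≃L[ℝ] F, HasFDerivAt f (L : E →L[ℝ] F) q := by
    obtain ⟨L, hL⟩ := h q hq
    exact ⟨L, hL ▸ ((hf' hq).differentiableAt (by simp)).hasFDerivAt⟩
  obtain ⟨L, hL⟩ := hd hp
  let T := (hf' hp).toOpenPartialHomeomorph f hL (by simp)
  -- On `s` the derivative is invertible everywhere, so after this restriction the inverse is smooth
  -- at every point of the target and not only at the image of `p`.
  let T' := T.restrOpen s hs
  refine ⟨⟨T'.toPartialEquiv, T'.open_source, T'.open_target, ?_, ?_⟩, ?_, fun q _ ↦ rfl⟩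
  · rw [contMDiffOn_iff_contDiffOn]
    exact hf.mono fun q hq ↦ hq.2
  · rw [contMDiffOn_iff_contDiffOn]
    intro y hy
    have hy' : T'.symm y ∈ s := (T'.map_target hy).2
    obtain ⟨L', hL'⟩ := hd hy'
    exact (T'.contDiffAt_symm hy hL' (hf' hy')).contDiffWithinAt
  · exact ⟨(hf' hp).mem_toOpenPartialHomeomorph_source hL (by simp), hp⟩

end Invertible

/-! ### Nondegeneracy near the zero section. -/

namespace LocalFamily

variable {Q G E F : Type*} [NormedAddCommGroup Q] [NormedSpace ℝ Q]
    [NormedAddCommGroup G] [NormedSpace ℝ G] [NormedAddCommGroup E] [NormedSpace ℝ E]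
    [NormedAddCommGroup F] [NormedSpace ℝ F] (D : LocalFamily Q G E F)

/-- The transport at time `1` together with the defect of a pair from being in the pullback. -/
noncomputable def pairing (Ψ : ℝ × (Q × G) → (Q × G) × F →L[ℝ] F) (p : Q × G) :
    (Q × G) × F →L[ℝ] E × F :=
  -- The fibres of the pullback are the kernels of the first component and vary with `p`. Adding
  -- this component replaces bijectivity of the transport between varying spaces by invertibility of
  -- one map between fixed spaces, an open condition.
  (fderiv ℝ D.j p.1 ∘L ContinuousLinearMap.fst ℝ Q G ∘L ContinuousLinearMap.fst ℝ (Q × G) F -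
    D.R (D.j p.1) ∘L ContinuousLinearMap.snd ℝ (Q × G) F).prod (Ψ (1, p))

theorem pairing_apply (Ψ : ℝ × (Q × G) → (Q × G) × F →L[ℝ] F) (p u : Q × G) (c : F) :
    D.pairing Ψ p (u, c) = (fderiv ℝ D.j p.1 u.1 - D.R (D.j p.1) c, Ψ (1, p) (u, c)) := rfl

namespace IsSolution

variable {D} {N N' : Set (Q × G)} {m : ℝ × (Q × G) → E} {Ψ : ℝ × (Q × G) → (Q × G) × F →L[ℝ] F}

theorem mono (hS : D.IsSolution N m Ψ) (hN' : IsOpen N') (h : N' ⊆ N) : D.IsSolution N' m Ψ where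
  isOpen := hN'
  subset p hp := hS.subset p (h hp)
  contDiffOn_m := hS.contDiffOn_m.mono (prod_mono_right h)
  contDiffOn_Ψ := hS.contDiffOn_Ψ.mono (prod_mono_right h)
  mem t ht p hp := hS.mem t ht p (h hp)
  m_zero p hp := hS.m_zero p (h hp)
  Ψ_zero p hp := hS.Ψ_zero p (h hp)
  hasDerivAt_m t ht p hp := hS.hasDerivAt_m t ht p (h hp)
  hasDerivAt_Ψ t ht p hp := hS.hasDerivAt_Ψ t ht p (h hp)

/-- In base directions the flow at time 1 is `j`. A fibre direction `(0, y)` is compatible with the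
initial value `c = 0`, so `fderiv_m` applies and the transport formula over the zero section gives
`R(a_y)`. -/
theorem fderiv_m_zeroSection [FiniteDimensional ℝ Q] [FiniteDimensional ℝ G]
    [FiniteDimensional ℝ E] [FiniteDimensional ℝ F]
    (hS : D.IsSolution N m Ψ) {ξ : Q} (hξ : (ξ, 0) ∈ N) (u : Q × G) :
    fderiv ℝ (fun q ↦ m (1, q)) (ξ, 0) u =
      fderiv ℝ D.j ξ u.1 + D.R (D.j ξ) (D.a ((ξ, u.2), D.j ξ)) := by
  have h1 : (1 : ℝ) ∈ Ioo (-2 : ℝ) 2 := by norm_num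
  have hu : u = (u.1, 0) + (0, u.2) := by simp
  have hm := (hS.contDiffAt_m_slice h1 hξ).differentiableAt (by simp)
  rw [hu, map_add]
  congr 1
  · have h2 : HasFDerivAt (fun ζ : Q ↦ m (1, (ζ, (0 : G)))) _ ξ :=
      hm.hasFDerivAt.comp ξ (f := fun ζ : Q ↦ (ζ, (0 : G))) (hasFDerivAt_prodMk_left _ _)
    have h3 : (fun ζ : Q ↦ m (1, (ζ, (0 : G)))) =ᶠ[𝓝 ξ] D.j := by
      filter_upwards [(Continuous.prodMk_left (0 : G)).continuousAt.preimage_mem_nhds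
        (hS.isOpen.mem_nhds hξ)] with ζ hζ using hS.m_zeroSection hζ h1
    rw [← h3.fderiv_eq, h2.fderiv]
    simp
  · rw [hS.fderiv_m hξ (u := (0, u.2)) (c := 0) (by simp) h1, hS.m_zeroSection hξ h1,
      hS.Ψ_zeroSection hξ h1]
    simp

variable [FiniteDimensional ℝ Q] [FiniteDimensional ℝ G] [FiniteDimensional ℝ E]
  [FiniteDimensional ℝ F]

theorem isInvertible_fderiv_m (hS : D.IsSolution N m Ψ) {ξ : Q} (hξ : (ξ, 0) ∈ N)
    (hd : Module.finrank ℝ (Q × G) = Module.finrank ℝ E)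
    (hz : ∀ u : Q × G, fderiv ℝ D.j ξ u.1 + D.R (D.j ξ) (D.a ((ξ, u.2), D.j ξ)) = 0 → u = 0) :
    (fderiv ℝ (fun q ↦ m (1, q)) (ξ, 0)).IsInvertible := by
  refine ContinuousLinearMap.isInvertible_of_injective_of_finrank_eq ?_ hd
  rw [injective_iff_map_eq_zero]
  intro u hu
  rw [hS.fderiv_m_zeroSection hξ] at hu
  exact hz u hu

/-- Over the zero section `Ψ(u, c) = c + a_y`, with `y` the fibre part of `u`. If this vanishes then
`c = -a_y`, and vanishing of the defect becomes the hypothesis of `hz`. Source and target have the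
same dimension. -/
theorem isInvertible_pairing (hS : D.IsSolution N m Ψ) {ξ : Q} (hξ : (ξ, 0) ∈ N)
    (hd : Module.finrank ℝ (Q × G) = Module.finrank ℝ E)
    (hz : ∀ u : Q × G, fderiv ℝ D.j ξ u.1 + D.R (D.j ξ) (D.a ((ξ, u.2), D.j ξ)) = 0 → u = 0) :
    (D.pairing Ψ (ξ, 0)).IsInvertible := by
  refine ContinuousLinearMap.isInvertible_of_injective_of_finrank_eq ?_
    (by rw [Module.finrank_prod, Module.finrank_prod (M := E), hd])
  rw [injective_iff_map_eq_zero]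
  rintro ⟨u, c⟩ huc
  rw [pairing_apply, hS.Ψ_zeroSection hξ (by norm_num), one_smul] at huc
  obtain ⟨h1, h2⟩ := Prod.mk_eq_zero.1 huc
  have hc := eq_neg_of_add_eq_zero_left h2
  have hu := hz u (by rw [hc, map_neg, sub_neg_eq_add] at h1; exact h1)
  have hμ : D.j ξ ∈ D.domE := by
    have := hS.mem 0 (by norm_num) _ hξ
    rwa [hS.m_zero _ hξ] at this
  subst hu
  rw [hc, Prod.snd_zero, a_zero (hS.subset _ hξ) hμ, neg_zero]
  rfl

theorem continuousOn_pairing (hS : D.IsSolution N m Ψ) : ContinuousOn (D.pairing Ψ) N := by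
  intro p hp
  have hj := D.contDiffOn_j.contDiffAt (D.isOpen_domQ.mem_nhds (hS.subset p hp))
  have hμ : D.j p.1 ∈ D.domE := by
    have := hS.mem 0 (by norm_num) _ hp
    rwa [hS.m_zero _ hp] at this
  have h1 : ContinuousAt (fun q : Q × G ↦ fderiv ℝ D.j q.1) p :=
    ((hj.fderiv_right (m := ∞) (by simp)).continuousAt).comp continuousAt_fst
  have h2 : ContinuousAt (fun q : Q × G ↦ D.R (D.j q.1)) p :=
    ContinuousAt.comp (f := fun q : Q × G ↦ D.j q.1) (contDiffAt_R hμ).continuousAt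
      (ContinuousAt.comp (x := p) hj.continuousAt continuousAt_fst)
  have h3 := (hS.contDiffAt_Ψ_slice (t := 1) (by norm_num) hp).continuousAt
  refine ContinuousAt.continuousWithinAt ?_
  have h4 : ContinuousAt (fun q ↦ (fderiv ℝ D.j q.1 ∘L ContinuousLinearMap.fst ℝ Q G ∘L
      ContinuousLinearMap.fst ℝ (Q × G) F -
      D.R (D.j q.1) ∘L ContinuousLinearMap.snd ℝ (Q × G) F, Ψ (1, q))) p :=
    ((h1.clm_comp continuousAt_const).sub (h2.clm_comp continuousAt_const)).prodMk h3
  have h5 : Continuous fun q : ((Q × G) × F →L[ℝ] E) × ((Q × G) × F →L[ℝ] F) ↦ q.1.prod q.2 :=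
    (ContinuousLinearMap.prodₗᵢ ℝ).continuous
  exact h5.continuousAt.comp h4

end IsSolution

/-- Near a point of the zero section where the flow is nondegenerate, there is a solution whose
flow at time `1` is a local diffeomorphism and whose transport is bijective. -/
theorem exists_isSolution_isInvertible [FiniteDimensional ℝ Q] [FiniteDimensional ℝ G]
    [FiniteDimensional ℝ E] [FiniteDimensional ℝ F] {ξ : Q} (hξ : ξ ∈ D.domQ) (hj : D.j ξ ∈ D.domE)
    (hd : Module.finrank ℝ (Q × G) = Module.finrank ℝ E)
    (hz : ∀ u : Q × G, fderiv ℝ D.j ξ u.1 + D.R (D.j ξ) (D.a ((ξ, u.2), D.j ξ)) = 0 → u = 0) :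
    ∃ N m Ψ, (ξ, 0) ∈ N ∧ D.IsSolution N m Ψ ∧
      ∀ p ∈ N, (fderiv ℝ (fun q ↦ m (1, q)) p).IsInvertible ∧ (D.pairing Ψ p).IsInvertible := by
  have : CompleteSpace (Q × G) := FiniteDimensional.complete ℝ _
  have : CompleteSpace ((Q × G) × F) := FiniteDimensional.complete ℝ _
  obtain ⟨N, m, Ψ, hξN, hS⟩ := D.exists_isSolution hξ hj
  have hm : ContinuousOn (fun p ↦ fderiv ℝ (fun q ↦ m (1, q)) p) N := fun p hp ↦
    ((hS.contDiffAt_m_slice (t := 1) (by norm_num) hp).fderiv_right (m := ∞)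
      (by simp)).continuousAt.continuousWithinAt
  have hm' := hm.isOpen_inter_preimage hS.isOpen
    (ContinuousLinearMap.isOpen_setOf_isInvertible (E := Q × G) (F := E))
  have hP' := hS.continuousOn_pairing.isOpen_inter_preimage hS.isOpen
    (ContinuousLinearMap.isOpen_setOf_isInvertible (E := (Q × G) × F) (F := E × F))
  refine ⟨(N ∩ _) ∩ (N ∩ _), m, Ψ, ⟨⟨hξN, hS.isInvertible_fderiv_m hξN hd hz⟩,
    hξN, hS.isInvertible_pairing hξN hd hz⟩, hS.mono (hm'.inter hP') fun p hp ↦ hp.1.1,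
    fun p hp ↦ ⟨hp.1.2, hp.2.2⟩⟩

end LocalFamily

/-! ### The local morphism is an isomorphism extending the inclusion of `i^! A`. -/

section LocalIsomorphism

variable {EM : Type*} [NormedAddCommGroup EM] [NormedSpace ℝ EM] [FiniteDimensional ℝ EM]
  {HM : Type*} [TopologicalSpace HM] {IM : ModelWithCorners ℝ EM HM} [IM.Boundaryless]
  {M : Type*} [TopologicalSpace M] [ChartedSpace HM M] [IsManifold IM ∞ M]
  [T2Space M]
  {F : Type*} [NormedAddCommGroup F] [NormedSpace ℝ F] [FiniteDimensional ℝ F]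
  {V : M → Type*} [∀ x, AddCommGroup (V x)] [∀ x, Module ℝ (V x)]
  [∀ x, TopologicalSpace (V x)] [TopologicalSpace (TotalSpace F V)]
  [FiberBundle F V] [VectorBundle ℝ F V] [ContMDiffVectorBundle ∞ F V IM]
  {A : LieAlgebroid IM F V}
  {EX : Type*} [NormedAddCommGroup EX] [NormedSpace ℝ EX] [FiniteDimensional ℝ EX]
  {HX : Type*} [TopologicalSpace HX] {IX : ModelWithCorners ℝ EX HX} [IX.Boundaryless]
  {X : Type*} [TopologicalSpace X] [ChartedSpace HX X] [IsManifold IX ∞ X]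
  [T2Space X]
  {i : A.TransverseMap IX X}
  {G : Type*} [NormedAddCommGroup G] [NormedSpace ℝ G] [FiniteDimensional ℝ G]
  {W : X → Type*} [∀ x, AddCommGroup (W x)] [∀ x, Module ℝ (W x)]
  [∀ x, TopologicalSpace (W x)] [TopologicalSpace (TotalSpace G W)]
  [FiberBundle G W] [VectorBundle ℝ G W] [ContMDiffVectorBundle ∞ G W IX]

theorem isLocalDiffeomorphAt_vbChart {x₀ : X} {w : TotalSpace G W}
    (hw : w.proj ∈ vbSource IX G W x₀) :
    IsLocalDiffeomorphAt (IX.prod 𝓘(ℝ, G)) 𝓘(ℝ, EX × G) ∞ (vbChart IX G W x₀) w :=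
  ⟨{ toFun := vbChart IX G W x₀
     invFun := vbChartSymm IX G W x₀
     source := TotalSpace.proj ⁻¹' vbSource IX G W x₀
     target := Prod.fst ⁻¹' vbTarget IX G W x₀
     map_source' := fun _ hz ↦ vbChart_mem_vbTarget hz
     map_target' := fun _ hp ↦ vbChartSymm_mem_vbSource hp
     left_inv' := fun _ hz ↦ vbChartSymm_vbChart hz
     right_inv' := fun _ hp ↦ vbChart_vbChartSymm hp
     open_source := (isOpen_vbSource IX G W x₀).preimage (FiberBundle.continuous_proj G W)
     open_target := (isOpen_vbTarget IX G W x₀).preimage continuous_fst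
     contMDiffOn_toFun := fun _ hz ↦ (contMDiffAt_vbChart hz).contMDiffWithinAt
     contMDiffOn_invFun := fun _ hp ↦ (contMDiffAt_vbChartSymm hp).contMDiffWithinAt },
    hw, fun _ _ ↦ rfl⟩

theorem isLocalDiffeomorphAt_extChartAt_symm {m₀ : M} {μ : EM}
    (hμ : μ ∈ (extChartAt IM m₀).target) :
    IsLocalDiffeomorphAt 𝓘(ℝ, EM) IM ∞ (extChartAt IM m₀).symm μ :=
  ⟨{ toPartialEquiv := (extChartAt IM m₀).symm
     open_source := isOpen_extChartAt_target m₀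
     open_target := isOpen_extChartAt_source m₀
     contMDiffOn_toFun := contMDiffOn_extChartAt_symm m₀
     contMDiffOn_invFun := fun _ hz ↦
      (contMDiffAt_extChartAt' (by simpa using hz)).contMDiffWithinAt }, hμ, fun _ _ ↦ rfl⟩

theorem mvfderiv_vbChart_fst {x₀ : X} {w : TotalSpace G W} (hw : w.proj ∈ vbSource IX G W x₀)
    (u : TangentSpace (IX.prod 𝓘(ℝ, G)) w) :
    (mvfderiv (IX.prod 𝓘(ℝ, G)) (vbChart IX G W x₀) w u).1 =
      mvfderiv IX (extChartAt IX x₀) w.proj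
        (mfderiv (IX.prod 𝓘(ℝ, G)) IX (TotalSpace.proj : TotalSpace G W → X) w u) := by
  have h1 : MDifferentiableAt IX 𝓘(ℝ, EX) (extChartAt IX x₀) w.proj :=
    (contMDiffAt_extChartAt' (n := ∞) (by simpa using hw.1)).mdifferentiableAt (by simp)
  rw [← mvfderiv_comp_apply' h1
    ((Bundle.contMDiff_proj W (n := ∞)).contMDiffAt.mdifferentiableAt (by simp))]
  exact (mvfderiv_clm_comp (ContinuousLinearMap.fst ℝ EX G)
    ((contMDiffAt_vbChart hw).mdifferentiableAt (by simp)) u).symm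

namespace TransverseFamily

variable {a : TransverseFamily i G W} {x₀ : X} {N : Set (EX × G)} {m : ℝ × (EX × G) → EM}
  {Ψ : ℝ × (EX × G) → (EX × G) × F →L[ℝ] F}

theorem mem_localBase : x₀ ∈ localBase i G W x₀ := ⟨mem_vbSource .., mem_vbSource ..⟩

/-- The chart form of the following: if `di v + ρ(a_y) = 0`, then `ρ(a_y)` is tangent to `X`, so `y
= 0` by transversality of the family, and then `di v = 0` forces `v = 0`. -/
theorem localFamily_nondegenerate (hi : Function.Injective (mfderiv IX IM i x₀)) (u : EX × G)
    (hu : fderiv ℝ (a.localFamily x₀).j (extChartAt IX x₀ x₀) u.1 +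
      (a.localFamily x₀).R ((a.localFamily x₀).j (extChartAt IX x₀ x₀))
        ((a.localFamily x₀).a ((extChartAt IX x₀ x₀, u.2),
          (a.localFamily x₀).j (extChartAt IX x₀ x₀))) = 0) : u = 0 := by
  have hx := mem_localBase (i := i) (G := G) (W := W) (x₀ := x₀)
  let w : TotalSpace G W := ⟨x₀, (trivializationAt G W x₀).symmL ℝ x₀ u.2⟩
  have hw : vbChart IX G W x₀ w = (extChartAt IX x₀ x₀, u.2) :=
    Prod.ext rfl ((trivializationAt G W x₀).continuousLinearMapAt_symmL hx.1.2 u.2)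
  obtain ⟨u', hu'⟩ := (mvfderiv_vbChart_bijective (w := w) hx.1).2 (u.1, 0)
  have h1 := fderiv_localFamily_j (a := a) (w := w) hx u'
  rw [hu'] at h1
  have h2 := localFamily_R_j (a := a) (w := w) hx (a.toFun w (i x₀))
  have h3 : (a.localFamily x₀).a ((extChartAt IX x₀ x₀, u.2),
      (a.localFamily x₀).j (extChartAt IX x₀ x₀)) =
      (trivializationAt F V (i x₀)).continuousLinearMapAt ℝ (i x₀) (a.toFun w (i x₀)) := by
    rw [← hw, localFamily_a (w := w) hx.1, localFamily_j hx.1]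
    exact congrArg (fun z ↦ (trivializationAt F V (i x₀)).continuousLinearMapAt ℝ z (a.toFun w z))
      ((extChartAt IM (i x₀)).left_inv hx.2.1)
  rw [h3] at hu
  have h4 : mvfderiv IM (extChartAt IM (i x₀)) (i x₀) (mfderiv IX IM i x₀
      (mfderiv (IX.prod 𝓘(ℝ, G)) IX (TotalSpace.proj : TotalSpace G W → X) w u') +
        A.anchor (i x₀) (a.toFun w (i x₀))) = 0 := by
    rw [map_add]
    exact (congrArg₂ (· + ·) h1 h2).symm.trans hu
  have h5 := (injective_iff_map_eq_zero _).1 (mvfderiv_extChartAt_bijective hx.2.1).1 _ h4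
  have h6 := a.eq_zero x₀ _ (-mfderiv (IX.prod 𝓘(ℝ, G)) IX
    (TotalSpace.proj : TotalSpace G W → X) w u')
    (by rw [map_neg]; exact neg_eq_of_add_eq_zero_right h5)
  have h7 : u.2 = 0 := by
    have := (trivializationAt G W x₀).continuousLinearMapAt_symmL (R := ℝ) hx.1.2 u.2
    rw [h6, map_zero] at this
    exact this.symm
  have h8 : a.toFun w (i x₀) = 0 := by
    have := a.toFun_smul x₀ 0 0 (i x₀)
    rw [smul_zero, zero_smul] at this
    simpa only [w, h6] using this
  rw [h8, map_zero, add_zero] at h5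
  have h9 := (injective_iff_map_eq_zero _).1 hi _ h5
  have h10 := mvfderiv_vbChart_fst (w := w) hx.1 u'
  rw [h9, hu', map_zero] at h10
  exact Prod.ext h10 h7

theorem exists_isSolution_isInvertible (hi : Function.Injective (mfderiv IX IM i x₀))
    (hd : Module.finrank ℝ (EX × G) = Module.finrank ℝ EM) :
    ∃ N m Ψ, vbChart IX G W x₀ (zeroSection G W x₀) ∈ N ∧ (a.localFamily x₀).IsSolution N m Ψ ∧
      ∀ p ∈ N, (fderiv ℝ (fun q ↦ m (1, q)) p).IsInvertible ∧
        ((a.localFamily x₀).pairing Ψ p).IsInvertible := by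
  rw [vbChart_zeroSection]
  have hx := mem_localBase (i := i) (G := G) (W := W) (x₀ := x₀)
  refine (a.localFamily x₀).exists_isSolution_isInvertible
    (mem_domQ (w := zeroSection G W x₀) hx) ?_ hd (localFamily_nondegenerate hi)
  rw [localFamily_j hx.1]
  exact vbChart_mem_vbTarget (w := zeroSection F V (i x₀)) hx.2

theorem isLocalDiffeomorphAt_localFlow (hS : (a.localFamily x₀).IsSolution N m Ψ)
    (hm : ∀ p ∈ N, (fderiv ℝ (fun q ↦ m (1, q)) p).IsInvertible) {w : TotalSpace G W}
    (hw : w.proj ∈ localBase i G W x₀) (hN : vbChart IX G W x₀ w ∈ N) :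
    IsLocalDiffeomorphAt (IX.prod 𝓘(ℝ, G)) IM ∞ (localFlow i G W x₀ m 1) w := by
  have : CompleteSpace (EX × G) := FiniteDimensional.complete ℝ _
  have h1 : IsLocalDiffeomorphAt 𝓘(ℝ, EX × G) 𝓘(ℝ, EM) ∞ (fun q ↦ m (1, q))
      (vbChart IX G W x₀ w) :=
    ContDiffOn.isLocalDiffeomorphAt hS.isOpen
      (fun p hp ↦ (hS.contDiffAt_m_slice one_mem hp).contDiffWithinAt) hm hN
  exact ((isLocalDiffeomorphAt_vbChart hw.1).comp (hg := h1)).comp (hg :=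
    isLocalDiffeomorphAt_extChartAt_symm (hS.mem 1 one_mem _ hN).1)

/-- Elements of the fibre have zero defect, so injectivity of the pairing gives injectivity here.
Conversely a preimage of `(0, v)` under the pairing has zero defect and hence comes from the fibre.
-/
theorem localMorphism_bijective (hS : (a.localFamily x₀).IsSolution N m Ψ) {w : TotalSpace G W}
    (hw : w.proj ∈ localBase i G W x₀) (hN : vbChart IX G W x₀ w ∈ N)
    (hP : ((a.localFamily x₀).pairing Ψ (vbChart IX G W x₀ w)).IsInvertible) :
    Function.Bijective (localMorphism i G W x₀ m Ψ w) := by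
  have hfl := localFlow_mem hS hN one_mem
  constructor
  · rw [injective_iff_map_eq_zero]
    intro b hb
    have h1 := coord_localMorphism hS hN b
    rw [hb, map_zero] at h1
    have h2 := (injective_iff_map_eq_zero _).1 hP.bijective.1
      (mvfderiv (IX.prod 𝓘(ℝ, G)) (vbChart IX G W x₀) w ((i.pullback.bundleProj G W).fst w b),
      (trivializationAt F V (i x₀)).continuousLinearMapAt ℝ (i w.proj)
        (i.snd w.proj ((i.pullback.bundleProj G W).snd w b)))
      (Prod.ext (sub_eq_zero.2 (fderiv_localFamily_j_fiber hw b)) h1.symm)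
    have h3 := (injective_iff_map_eq_zero _).1 (mvfderiv_vbChart_bijective hw.1).1 _
      (congrArg Prod.fst h2)
    have h4 : i.snd w.proj ((i.pullback.bundleProj G W).snd w b) = 0 := by
      rw [← (trivializationAt F V (i x₀)).symmL_continuousLinearMapAt (R := ℝ) hw.2.2
        (i.snd w.proj ((i.pullback.bundleProj G W).snd w b))]
      exact (congrArg _ (congrArg Prod.snd h2)).trans (map_zero _)
    have h5 := (i.pullback.bundleProj G W).mfderiv_fst b
    rw [h3, map_zero] at h5
    exact LieAlgebroid.TransverseMap.fiber_ext h3 (LieAlgebroid.TransverseMap.fiber_ext h5.symm h4)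
  · intro v
    obtain ⟨⟨u, c⟩, huc⟩ := hP.bijective.2
      (0, (trivializationAt F V (i x₀)).continuousLinearMapAt ℝ _ v)
    rw [LocalFamily.pairing_apply] at huc
    obtain ⟨u', rfl⟩ := (mvfderiv_vbChart_bijective (w := w) hw.1).2 u
    obtain ⟨c', rfl⟩ : ∃ c', (trivializationAt F V (i x₀)).continuousLinearMapAt ℝ (i w.proj) c' = c :=
      ⟨_, (trivializationAt F V (i x₀)).continuousLinearMapAt_symmL hw.2.2 c⟩
    have h1 := (fderiv_localFamily_j_eq_iff hw u' c').1 (sub_eq_zero.1 (congrArg Prod.fst huc))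
    refine ⟨(i.pullback.bundleProj G W).fiberMk u' (i.fiberMk _ c' h1) rfl, ?_⟩
    exact (congrArg ((trivializationAt F V (i x₀)).symmL ℝ _) (congrArg Prod.snd huc)).trans
      ((trivializationAt F V (i x₀)).symmL_continuousLinearMapAt hfl.2 v)

/-- A tangent vector of the zero section has no fibre component in the chart, so the correction
`a_y` to `c` in `Ψ_zeroSection` vanishes. -/
theorem localMorphism_inclZero (hS : (a.localFamily x₀).IsSolution N m Ψ) {x : X}
    (hx : x ∈ localBase i G W x₀) (hN : vbChart IX G W x₀ (zeroSection G W x) ∈ N)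
    (c : i.Fiber x) :
    (⟨localFlow i G W x₀ m 1 (zeroSection G W x),
      localMorphism i G W x₀ m Ψ (zeroSection G W x) (i.pullback.inclZero G W x c)⟩ :
        TotalSpace F V) = ⟨i x, i.snd x c⟩ := by
  have hN' := hN
  rw [vbChart_zeroSection] at hN'
  have h1 : localFlow i G W x₀ m 1 (zeroSection G W x) = i x := by
    rw [localFlow, vbChart_zeroSection, hS.m_zeroSection hN' one_mem, localFamily_j hx.1]
    exact (extChartAt IM (i x₀)).left_inv hx.2.1
  have h0 : MDifferentiableAt IX (IX.prod 𝓘(ℝ, G)) (zeroSection G W) x :=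
    ((Bundle.contMDiff_zeroSection ℝ W (n := ∞)).contMDiffAt).mdifferentiableAt (by simp)
  have h2 (v : TangentSpace IX x) : (mvfderiv (IX.prod 𝓘(ℝ, G)) (vbChart IX G W x₀)
      (zeroSection G W x) (mfderiv IX (IX.prod 𝓘(ℝ, G)) (zeroSection G W) x v)).2 = 0 := by
    have hχ : MDifferentiableAt (IX.prod 𝓘(ℝ, G)) 𝓘(ℝ, EX × G) (vbChart IX G W x₀)
        (zeroSection G W x) :=
      (contMDiffAt_vbChart (w := zeroSection G W x) hx.1).mdifferentiableAt (by simp)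
    rw [← mvfderiv_comp_apply' hχ h0]
    have h3 := mvfderiv_clm_comp (ContinuousLinearMap.snd ℝ EX G) (hχ.comp x h0) v
    refine h3.symm.trans ?_
    have h4 : (fun z : X ↦ ContinuousLinearMap.snd ℝ EX G
        ((vbChart IX G W x₀ ∘ zeroSection G W) z)) = fun _ ↦ 0 := by
      ext z
      simp [vbChart_zeroSection]
    rw [h4]
    simp [mvfderiv]
  have h3 : Ψ (1, vbChart IX G W x₀ (zeroSection G W x))
      (mvfderiv (IX.prod 𝓘(ℝ, G)) (vbChart IX G W x₀) (zeroSection G W x)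
        (mfderiv IX (IX.prod 𝓘(ℝ, G)) (zeroSection G W) x (i.fst x c)),
        (trivializationAt F V (i x₀)).continuousLinearMapAt ℝ (i x) (i.snd x c)) =
      (trivializationAt F V (i x₀)).continuousLinearMapAt ℝ (i x) (i.snd x c) := by
    have hμ := hS.mem 1 one_mem _ hN'
    rw [hS.m_zeroSection hN' one_mem] at hμ
    rw [vbChart_zeroSection, hS.Ψ_zeroSection hN' one_mem, h2,
      LocalFamily.a_zero (hS.subset _ hN') hμ, smul_zero, add_zero]
  exact (totalSpace_mk_symmL (trivializationAt F V (i x₀)) h1 h3).trans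
    (congrArg (TotalSpace.mk _)
      ((trivializationAt F V (i x₀)).symmL_continuousLinearMapAt hx.2.2 _))

end TransverseFamily
end LocalIsomorphism

/-! ### From local injectivity to injectivity near a subset. -/

/-- A map which is locally injective along a subset, and agrees there with an open injective map, is
injective near the subset. -/
theorem exists_isOpen_injOn {E M X : Type*} [TopologicalSpace E] [TopologicalSpace M]
    [TopologicalSpace.MetrizableSpace M] {ψ φ : E → M} {s : X → E} {D : Set E}
    (hψ : Continuous ψ) (hψo : IsOpenMap ψ) (hψi : Function.Injective ψ)
    (hφψ : ∀ x, φ (s x) = ψ (s x)) (hD : IsOpen D) (hφ : ContinuousOn φ D) (hs : ∀ x, s x ∈ D)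
    (hloc : ∀ x, ∃ O ∈ 𝓝 (s x), InjOn φ O) :
    ∃ U, IsOpen U ∧ U ⊆ D ∧ (∀ x, s x ∈ U) ∧ InjOn φ U ∧ φ '' U ⊆ range ψ := by
  let := TopologicalSpace.metrizableSpaceMetric M
  choose O hO hinj using hloc
  -- Distances are measured in `M` through the reference map `ψ`, which is open and injective. The
  -- factor 3 leaves room for the triangle inequalities in `key`.
  have hr (x : X) : ∃ r > 0, ψ ⁻¹' Metric.ball (ψ (s x)) (3 * r) ⊆ O x := by
    obtain ⟨r, hr, h⟩ := Metric.mem_nhds_iff.1 (hψo.image_mem_nhds (hO x))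
    refine ⟨r / 3, by positivity, fun w hw ↦ ?_⟩
    obtain ⟨w', hw', h'⟩ := h (show ψ w ∈ _ by rwa [mem_preimage, mul_div_cancel₀ _ three_ne_zero] at hw)
    rwa [← hψi h']
  choose r hr hrO using hr
  -- Both `φ` and `ψ` are kept within `r x` of their common value at `s x`. Intersecting with the
  -- range of `ψ` gives the last claim of the theorem.
  let B (x : X) : Set E := (D ∩ φ ⁻¹' (Metric.ball (ψ (s x)) (r x) ∩ range ψ)) ∩
    ψ ⁻¹' Metric.ball (ψ (s x)) (r x)
  have hB (x : X) : IsOpen (B x) :=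
    (hφ.isOpen_inter_preimage hD (Metric.isOpen_ball.inter hψo.isOpen_range)).inter
      (Metric.isOpen_ball.preimage hψ)
  -- If `φ w = φ w'`, the centers `ψ (s x)` and `ψ (s x')` are less than `r x + r x'` apart, so `ψ
  -- w'` lies within `r x + 2 r x' ≤ 3 r x` of `ψ (s x)`. Both points are then in `O x`, where `φ`
  -- is injective; the larger radius decides which of the two sets is used.
  have key {x x' : X} {w w' : E} (hw : w ∈ B x) (hw' : w' ∈ B x') (h : φ w = φ w')
      (hxx' : r x' ≤ r x) : w = w' := by
    have h1 : dist (φ w) (ψ (s x)) < r x := hw.1.2.1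
    have h2 : dist (ψ w) (ψ (s x)) < r x := hw.2
    have h3 : dist (φ w') (ψ (s x')) < r x' := hw'.1.2.1
    have h4 : dist (ψ w') (ψ (s x')) < r x' := hw'.2
    have h5 := dist_triangle (ψ w') (ψ (s x')) (ψ (s x))
    have h6 := dist_triangle_left (ψ (s x')) (ψ (s x)) (φ w)
    have h7 : dist (φ w) (ψ (s x')) < r x' := h ▸ h3
    refine hinj x (hrO x ?_) (hrO x ?_) h
    · exact h2.trans_le (by linarith [hr x])
    · exact (show dist (ψ w') (ψ (s x)) < 3 * r x by linarith)
  refine ⟨⋃ x, B x, isOpen_iUnion hB, iUnion_subset fun x w hw ↦ hw.1.1, fun x ↦ mem_iUnion.2 ⟨x, ?_⟩,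
    ?_, ?_⟩
  · refine ⟨⟨hs x, ?_⟩, Metric.mem_ball_self (hr x)⟩
    rw [mem_preimage, hφψ]
    exact ⟨Metric.mem_ball_self (hr x), mem_range_self _⟩
  · intro w hw w' hw' h
    obtain ⟨x, hx⟩ := mem_iUnion.1 hw
    obtain ⟨x', hx'⟩ := mem_iUnion.1 hw'
    rcases le_total (r x') (r x) with hr | hr
    · exact key hx hx' h hr
    · exact (key hx' hx h.symm hr).symm
  · rintro _ ⟨w, hw, rfl⟩
    obtain ⟨x, hx⟩ := mem_iUnion.1 hw
    exact hx.1.2.2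

theorem IsLocalDiffeomorphAt.congr_of_eventuallyEq {𝕜 : Type*} [NontriviallyNormedField 𝕜]
    {E : Type*} [NormedAddCommGroup E] [NormedSpace 𝕜 E] {E' : Type*} [NormedAddCommGroup E']
    [NormedSpace 𝕜 E'] {H : Type*} [TopologicalSpace H] {H' : Type*} [TopologicalSpace H']
    {I : ModelWithCorners 𝕜 E H} {J : ModelWithCorners 𝕜 E' H'} {M : Type*} [TopologicalSpace M]
    [ChartedSpace H M] {N : Type*} [TopologicalSpace N] [ChartedSpace H' N] {n : WithTop ℕ∞}
    {f g : M → N} {x : M} (hf : IsLocalDiffeomorphAt I J n f x) (h : g =ᶠ[𝓝 x] f) :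
    IsLocalDiffeomorphAt I J n g x := by
  obtain ⟨Φ, hx, hΦ⟩ := hf
  obtain ⟨s, hs, hso, hxs⟩ := eventually_nhds_iff.1 h
  let T := Φ.toOpenPartialHomeomorph.restrOpen s hso
  exact ⟨⟨T.toPartialEquiv, T.open_source, T.open_target,
    Φ.contMDiffOn_toFun.mono inter_subset_left, Φ.contMDiffOn_invFun.mono inter_subset_left⟩,
    ⟨hx, hxs⟩, fun z hz ↦ (hs z hz.2).trans (hΦ hz.1)⟩

theorem IsLocalDiffeomorphAt.exists_injOn {𝕜 : Type*} [NontriviallyNormedField 𝕜]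
    {E : Type*} [NormedAddCommGroup E] [NormedSpace 𝕜 E] {E' : Type*} [NormedAddCommGroup E']
    [NormedSpace 𝕜 E'] {H : Type*} [TopologicalSpace H] {H' : Type*} [TopologicalSpace H']
    {I : ModelWithCorners 𝕜 E H} {J : ModelWithCorners 𝕜 E' H'} {M : Type*} [TopologicalSpace M]
    [ChartedSpace H M] {N : Type*} [TopologicalSpace N] [ChartedSpace H' N] {n : WithTop ℕ∞}
    {f : M → N} {x : M} (hf : IsLocalDiffeomorphAt I J n f x) : ∃ O ∈ 𝓝 x, InjOn f O := by
  obtain ⟨Φ, hx, hΦ⟩ := hf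
  exact ⟨Φ.source, Φ.open_source.mem_nhds hx, hΦ.injOn_iff.2 Φ.toPartialEquiv.injOn⟩

/-! ### Gluing the local isomorphisms. -/

section Gluing

variable {EM : Type*} [NormedAddCommGroup EM] [NormedSpace ℝ EM] [FiniteDimensional ℝ EM]
  {HM : Type*} [TopologicalSpace HM] {IM : ModelWithCorners ℝ EM HM} [IM.Boundaryless]
  {M : Type*} [TopologicalSpace M] [ChartedSpace HM M] [IsManifold IM ∞ M]
  [T2Space M]
  {F : Type*} [NormedAddCommGroup F] [NormedSpace ℝ F] [FiniteDimensional ℝ F]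
  {V : M → Type*} [∀ x, AddCommGroup (V x)] [∀ x, Module ℝ (V x)]
  [∀ x, TopologicalSpace (V x)] [TopologicalSpace (TotalSpace F V)]
  [FiberBundle F V] [VectorBundle ℝ F V] [ContMDiffVectorBundle ∞ F V IM]
  {A : LieAlgebroid IM F V}
  {EX : Type*} [NormedAddCommGroup EX] [NormedSpace ℝ EX] [FiniteDimensional ℝ EX]
  {HX : Type*} [TopologicalSpace HX] {IX : ModelWithCorners ℝ EX HX} [IX.Boundaryless]
  {X : Type*} [TopologicalSpace X] [ChartedSpace HX X] [IsManifold IX ∞ X]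
  [T2Space X]
  {i : A.TransverseMap IX X}
  {G : Type*} [NormedAddCommGroup G] [NormedSpace ℝ G] [FiniteDimensional ℝ G]
  {W : X → Type*} [∀ x, AddCommGroup (W x)] [∀ x, Module ℝ (W x)]
  [∀ x, TopologicalSpace (W x)] [TopologicalSpace (TotalSpace G W)]
  [FiberBundle G W] [VectorBundle ℝ G W] [ContMDiffVectorBundle ∞ G W IX]

/-- A nondegenerate solution in charts around `x₀` of the equations for the flow of a transverse
family of sections and the transport along it. -/
structure TransverseFamily.LocalSolution (a : TransverseFamily i G W) (x₀ : X) where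
  N : Set (EX × G)
  m : ℝ × (EX × G) → EM
  Ψ : ℝ × (EX × G) → (EX × G) × F →L[ℝ] F
  isSolution : (a.localFamily x₀).IsSolution N m Ψ
  zero_mem : vbChart IX G W x₀ (zeroSection G W x₀) ∈ N
  isInvertible_fderiv : ∀ p ∈ N, (fderiv ℝ (fun q ↦ m (1, q)) p).IsInvertible
  isInvertible_pairing : ∀ p ∈ N, ((a.localFamily x₀).pairing Ψ p).IsInvertible

theorem TubularNeighborhood.nonempty_localSolution (ψ : TubularNeighborhood IM IX i G W)
    (a : TransverseFamily i G W) (x₀ : X) : Nonempty (a.LocalSolution x₀) := by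
  obtain ⟨N, m, Ψ, h0, hS, h⟩ :=
    TransverseFamily.exists_isSolution_isInvertible (a := a) (ψ.mfderiv_injective x₀)
      (ψ.finrank_eq x₀)
  exact ⟨⟨N, m, Ψ, hS, h0, fun p hp ↦ (h p hp).1, fun p hp ↦ (h p hp).2⟩⟩

namespace TransverseFamily

variable {a : TransverseFamily i G W} {x₀ : X}

/-- The subset of the vector bundle on which a solution in charts is defined. -/
def LocalSolution.dom (S : a.LocalSolution x₀) : Set (TotalSpace G W) :=
  {w | w.proj ∈ localBase i G W x₀ ∧ vbChart IX G W x₀ w ∈ S.N}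

theorem LocalSolution.isOpen_dom (S : a.LocalSolution x₀) : IsOpen S.dom := by
  have h1 : IsOpen (localBase i G W x₀) := (isOpen_vbSource IX G W x₀).inter
    ((isOpen_vbSource IM F V (i x₀)).preimage i.contMDiff.continuous)
  exact ContinuousOn.isOpen_inter_preimage
    (fun w hw ↦ (contMDiffAt_vbChart hw.1).continuousAt.continuousWithinAt)
    (h1.preimage (FiberBundle.continuous_proj G W)) S.isSolution.isOpen

variable (S : ∀ x, a.LocalSolution x)

open Classical in
/-- The point whose chart is used at `w`. -/
noncomputable def center (w : TotalSpace G W) : X :=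
  -- The alternative concerns points outside all domains, where the value does not matter.
  if h : ∃ x, w ∈ (S x).dom then h.choose else w.proj

/-- The flow at time `1` of the transverse family. -/
noncomputable def flow (w : TotalSpace G W) : M :=
  localFlow i G W (center S w) (S (center S w)).m 1 w

/-- The transport at time `1` of the transverse family. -/
noncomputable def transport (w : TotalSpace G W) :
    (i.pullback.bundleProj G W).Fiber w →ₗ[ℝ] V (flow S w) :=
  localMorphism i G W (center S w) (S (center S w)).m (S (center S w)).Ψ w

variable {S}

theorem mem_dom_center {w : TotalSpace G W} (hw : w ∈ (S x₀).dom) : w ∈ (S (center S w)).dom := by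
  have h : ∃ x, w ∈ (S x).dom := ⟨x₀, hw⟩
  rw [center, dif_pos h]
  exact h.choose_spec

/-- Any two solutions in charts whose domains contain `w` yield the same transport, by its
uniqueness. So the choice of `center` is immaterial, and near each point the glued maps coincide
with those of one solution and inherit their properties. -/
theorem transport_eq {w : TotalSpace G W} (hw : w ∈ (S x₀).dom)
    (b : (i.pullback.bundleProj G W).Fiber w) :
    (⟨flow S w, transport S w b⟩ : TotalSpace F V) =
      ⟨localFlow i G W x₀ (S x₀).m 1 w, localMorphism i G W x₀ (S x₀).m (S x₀).Ψ w b⟩ :=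
  have hc := mem_dom_center hw
  (isTransport_localTransport (S (center S w)).isSolution hc.1 hc.2 _ _).eq_localTransport
    (S x₀).isSolution hw.1 hw.2 one_mem

theorem flow_eq {w : TotalSpace G W} (hw : w ∈ (S x₀).dom) :
    flow S w = localFlow i G W x₀ (S x₀).m 1 w :=
  congrArg TotalSpace.proj (transport_eq hw 0)

theorem flow_eventuallyEq {w : TotalSpace G W} (hw : w ∈ (S x₀).dom) :
    flow S =ᶠ[𝓝 w] localFlow i G W x₀ (S x₀).m 1 := by
  filter_upwards [(S x₀).isOpen_dom.mem_nhds hw] with z hz using flow_eq hz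

theorem isLocalDiffeomorphAt_flow {w : TotalSpace G W} (hw : w ∈ (S x₀).dom) :
    IsLocalDiffeomorphAt (IX.prod 𝓘(ℝ, G)) IM ∞ (flow S) w :=
  (isLocalDiffeomorphAt_localFlow (S x₀).isSolution (S x₀).isInvertible_fderiv hw.1
    hw.2).congr_of_eventuallyEq (flow_eventuallyEq hw)

theorem transport_eventuallyEq {w : TotalSpace G W} (hw : w ∈ (S x₀).dom)
    {σ : ∀ w, (i.pullback.bundleProj G W).Fiber w} {τ : ∀ m, V m}
    (h : ∀ᶠ z in 𝓝 w, transport S z (σ z) = τ (flow S z)) :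
    ∀ᶠ z in 𝓝 w, localMorphism i G W x₀ (S x₀).m (S x₀).Ψ z (σ z) =
      τ (localFlow i G W x₀ (S x₀).m 1 z) := by
  filter_upwards [h, (S x₀).isOpen_dom.mem_nhds hw] with z hz hzD
  have h1 := transport_eq hzD (σ z)
  rw [hz, flow_eq hzD] at h1
  exact (TotalSpace.mk_inj.1 h1).symm

set_option maxHeartbeats 1000000 in
theorem contMDiffAt_transport
    {b₀ : TotalSpace (LieAlgebroid.TransverseMap.Model EX
      (LieAlgebroid.TransverseMap.Model EM F EX) (EX × G)) (i.pullback.bundleProj G W).Fiber}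
    (hb : b₀.proj ∈ (S x₀).dom) :
    ContMDiffAt ((IX.prod 𝓘(ℝ, G)).prod 𝓘(ℝ, LieAlgebroid.TransverseMap.Model EX
      (LieAlgebroid.TransverseMap.Model EM F EX) (EX × G))) (IM.prod 𝓘(ℝ, F)) ∞
      (fun b : TotalSpace (LieAlgebroid.TransverseMap.Model EX
        (LieAlgebroid.TransverseMap.Model EM F EX) (EX × G)) (i.pullback.bundleProj G W).Fiber ↦
        (⟨flow S b.proj, transport S b.proj b.2⟩ : TotalSpace F V)) b₀ := by
  refine (contMDiffAt_localMorphism (S x₀).isSolution hb.1 hb.2).congr_of_eventuallyEq ?_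
  have hp : Continuous (TotalSpace.proj : TotalSpace (LieAlgebroid.TransverseMap.Model EX
      (LieAlgebroid.TransverseMap.Model EM F EX) (EX × G)) (i.pullback.bundleProj G W).Fiber →
        TotalSpace G W) := FiberBundle.continuous_proj _ _
  filter_upwards [hp.continuousAt.preimage_mem_nhds ((S x₀).isOpen_dom.mem_nhds hb)] with z hz
  exact transport_eq hz z.2

/-- Apart from the injectivity assumed, every condition is local, so it can be checked at `w` with
the single solution at `center S w`. -/
theorem isIsoOn {U : Set (TotalSpace G W)} (hU : IsOpen U) (hUS : U ⊆ ⋃ x, (S x).dom)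
    (hinj : InjOn (flow S) U) :
    (i.pullback.bundleProj G W).pullback.IsIsoOn A U (flow S) (transport S) := by
  have hc {w : TotalSpace G W} (hw : w ∈ U) : w ∈ (S (center S w)).dom :=
    have ⟨_, h⟩ := mem_iUnion.1 (hUS hw)
    mem_dom_center h
  refine ⟨hU, hinj, fun w ↦ isLocalDiffeomorphAt_flow (hc w.2), fun b hb ↦ ?_, fun w hw ↦ ?_,
    fun w hw b ↦ ?_, fun w hw b₁ b₂ a₁ a₂ h₁ h₂ ↦ ?_⟩
  · exact (contMDiffAt_transport (hc hb)).contMDiffWithinAt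
  · exact localMorphism_bijective (S _).isSolution (hc hw).1 (hc hw).2
      ((S _).isInvertible_pairing _ (hc hw).2)
  · exact (DFunLike.congr_fun (flow_eventuallyEq (hc hw)).mfderiv_eq _).trans
      (mfderiv_localFlow_fst (S _).isSolution (hc hw).1 (hc hw).2 b)
  · exact localMorphism_bracket b₁ b₂ (S _).isSolution (hc hw).1 (hc hw).2 a₁ a₂
      (transport_eventuallyEq (hc hw) h₁) (transport_eventuallyEq (hc hw) h₂)

theorem zeroSection_mem (x : X) : zeroSection G W x ∈ (S x).dom :=
  ⟨mem_localBase, (S x).zero_mem⟩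

theorem transport_inclZero (x : X) (c : i.Fiber x) :
    (⟨flow S (zeroSection G W x), transport S (zeroSection G W x)
      (i.pullback.inclZero G W x c)⟩ : TotalSpace F V) = ⟨i x, i.snd x c⟩ :=
  (transport_eq (zeroSection_mem x) _).trans
    (localMorphism_inclZero (S x).isSolution mem_localBase (S x).zero_mem c)

end TransverseFamily
end Gluing

/-! ### The normal form near a transversal. -/

theorem theorem2
    -- the manifold `M`
    {EM : Type*} [NormedAddCommGroup EM] [NormedSpace ℝ EM] [FiniteDimensional ℝ EM]
    {HM : Type*} [TopologicalSpace HM] {IM : ModelWithCorners ℝ EM HM} [IM.Boundaryless]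
    {M : Type*} [TopologicalSpace M] [ChartedSpace HM M] [IsManifold IM ∞ M]
    [T2Space M] [SigmaCompactSpace M]
    -- the Lie algebroid `A` on `M`
    {F : Type*} [NormedAddCommGroup F] [NormedSpace ℝ F] [FiniteDimensional ℝ F]
    {V : M → Type*} [∀ x, AddCommGroup (V x)] [∀ x, Module ℝ (V x)]
    [∀ x, TopologicalSpace (V x)] [TopologicalSpace (TotalSpace F V)]
    [FiberBundle F V] [VectorBundle ℝ F V] [ContMDiffVectorBundle ∞ F V IM]
    (A : LieAlgebroid IM F V)
    -- the submanifold `i : X → M`, transverse to `A`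
    {EX : Type*} [NormedAddCommGroup EX] [NormedSpace ℝ EX] [FiniteDimensional ℝ EX]
    {HX : Type*} [TopologicalSpace HX] {IX : ModelWithCorners ℝ EX HX} [IX.Boundaryless]
    {X : Type*} [TopologicalSpace X] [ChartedSpace HX X] [IsManifold IX ∞ X]
    [T2Space X] [SigmaCompactSpace X]
    (i : A.TransverseMap IX X) (hi : Manifold.IsSmoothEmbedding IX IM ∞ i)
    -- the tubular neighborhood `p : W → X`, with `ψ : W → M`
    {G : Type*} [NormedAddCommGroup G] [NormedSpace ℝ G] [FiniteDimensional ℝ G]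
    {W : X → Type*} [∀ x, AddCommGroup (W x)] [∀ x, Module ℝ (W x)]
    [∀ x, TopologicalSpace (W x)] [TopologicalSpace (TotalSpace G W)]
    [FiberBundle G W] [VectorBundle ℝ G W] [ContMDiffVectorBundle ∞ G W IX]
    (ψ : TubularNeighborhood IM IX i G W) :
    ∃ (U : Set (TotalSpace G W)) (φ : TotalSpace G W → M)
      (Φ : ∀ w, (i.pullback.bundleProj G W).Fiber w →ₗ[ℝ] V (φ w)),
      (∀ x, zeroSection G W x ∈ U) ∧
      φ '' U ⊆ range ψ.toFun ∧
      (i.pullback.bundleProj G W).pullback.IsIsoOn A U φ Φ ∧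
      ∀ x (c : i.Fiber x),
        (⟨φ (zeroSection G W x), Φ (zeroSection G W x) (i.pullback.inclZero G W x c)⟩ :
          TotalSpace F V) = ⟨i x, i.snd x c⟩ := by
  obtain ⟨a⟩ := ψ.exists_transverseFamily
  let S (x : X) := (ψ.nonempty_localSolution a x).some
  -- A metric is needed to compare neighborhoods of different points of `X` when making the flow
  -- injective.
  have : TopologicalSpace.MetrizableSpace M := Manifold.metrizableSpace IM M
  have hflow (x : X) : TransverseFamily.flow S (zeroSection G W x) = i x :=
    congrArg TotalSpace.proj (TransverseFamily.transport_inclZero (S := S) x 0)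
  -- The flow is compared with `ψ`, an open injective map with the same values on the zero section.
  -- This gives injectivity on `U` and the inclusion of the image in the range of `ψ` together.
  obtain ⟨U, hU, hUS, h0, hinj, hrange⟩ := exists_isOpen_injOn (ψ := ψ.toFun)
    (φ := TransverseFamily.flow S) (s := zeroSection G W) (D := ⋃ x, (S x).dom)
    ψ.isLocalDiffeomorph.contMDiff.continuous ψ.isLocalDiffeomorph.isOpenMap ψ.injective
    (fun x ↦ (hflow x).trans (ψ.toFun_zero x).symm)
    (isOpen_iUnion fun x ↦ (S x).isOpen_dom)
    (fun w hw ↦ have ⟨_, hx⟩ := mem_iUnion.1 hw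
      (TransverseFamily.isLocalDiffeomorphAt_flow hx).contMDiffAt.continuousAt.continuousWithinAt)
    (fun x ↦ mem_iUnion.2 ⟨x, TransverseFamily.zeroSection_mem x⟩)
    (fun x ↦ (TransverseFamily.isLocalDiffeomorphAt_flow
      (TransverseFamily.zeroSection_mem (S := S) x)).exists_injOn)
  exact ⟨U, TransverseFamily.flow S, TransverseFamily.transport S, h0, hrange,
    TransverseFamily.isIsoOn hU hUS hinj, TransverseFamily.transport_inclZero⟩
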